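/- **Setting.** States $s\in\mathcal S$ and actions $a\in\mathcal A$ lie in measurable spaces; policies $\pi(a\mid s)$ are densities with respect to a $\sigma$-finite base measure $\nu$ on $\mathcal A$ (counting measure for discrete actions). Contexts have law $p_S$, rewards $r\in[0,R_{\max}]$ have conditional law $p_{R\mid S,A}$, and $\pi_1,\dots,\pi_K$ are logging policies. For a policy $\pi$, $\mathbb E_\pi$ is expectation under $p_S(s)\pi(a\mid s)p_{R\mid S,A}(r\mid s,a)$. Let $\pi^e$ be the evaluation policy, $J=\mathbb E_{\pi^e}[r]$, $q(s,a)=\mathbb E[r\mid s,a]$, $\sigma_r^2(s,a)=\mathrm{var}[r\mid s,a]$, $g(s,\pi^e)=\int g(s,a)\,d\pi^e(a\mid s)$, $v(s)=q(s,\pi^e)$. Fix stratum sizes $n_1,\dots,n_K$ with $n=\sum_k n_k>0$, and put $\pi_*=\sum_k (n_k/n)\pi_k$, $\|f\|_2=\{\mathbb E_{\pi_*}f^2\}^{1/2}$ and $$V^*=\mathbb E_{\pi_*}\Big[\Big\{\tfrac{\pi^e(a\mid s)}{\pi_*(a\mid s)}\Big\}^2\sigma_r^2(s,a)\Big]+\mathrm{var}_{p_S}[v(s)].$$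 For $m\to\infty$ let $n'_k=mn_k$, $n'=mn$, and observe independent triplets $(S_{ki},A_{ki},R_{ki})\sim p_S\,\pi_k\,p_{R\mid S,A}$, $1\le k\le K$, $1\le i\le n'_k$. **Estimator.** Fix $Z\ge 1$. Independently of the data, the indices of each stratum $k$ are randomly partitioned into $Z$ folds, each of size within $1$ of $n'_k/Z$. Let $\mathcal L_z$ be the observations in fold $z$ (over all strata) and $\mathcal U_z$ the remaining ones. From $\mathcal U_z$ only, estimates $\hat q^{(z)}$ of $q$ and $\hat\pi_*^{(z)}$ of $\pi_*$ are computed, jointly measurably in the data and $(s,a)$. Put $$\hat J=\frac1{n'}\sum_{z=1}^Z\ \sum_{(s,a,r)\in\mathcal L_z}\Big\{\frac{\pi^e(a\mid s)}{\hat\pi_*^{(z)}(a\mid s)}\big(r-\hat q^{(z)}(s,a)\big)+\hat q^{(z)}(s,\pi^e)\Big\}.$$ **Theorem.** Suppose that weak overlap holds, $\pi^e(\cdot\mid s)\ll\pi_*(\cdot\mid s)$ for every $s$; that $|\hat q^{(z)}|\le C$ and, at all $(s,a)$ with $\pi_*(a\mid s)>0$, that $1/\pi_*\le C$, $\hat\pi^{(z)}_*>0$,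 $1/\hat\pi_*^{(z)}\le C$ and $\pi^e/\pi_*\le C$, for a constant $C$ (independent of the data, of $m$ and of $z$; if actions are discrete, the bound on $\pi^e/\pi_*$ follows from that on $1/\pi_*$). Suppose also that, for every $z$, $\|\hat q^{(z)}-q\|_2=o_p(1)$, $\|\hat\pi_*^{(z)}-\pi_*\|_2=o_p(1)$ and $\|\hat q^{(z)}-q\|_2\,\|\hat\pi_*^{(z)}-\pi_*\|_2=o_p(n'^{-1/2})$. Then $\hat J$ is efficient: as $m\to\infty$, $$\sqrt{n'}\,(\hat J-J)\ \xrightarrow{d}\ \mathcal N(0,V^*),$$ and $V^*$ is the efficiency bound for $J$ when the logging policies are unknown. That is, consider the model for one stratified data set $\mathcal D$ (with stratum sizes $n_k$) in which $p_S$, $p_{R\mid S,A}$ (on $[0,R_{\max}]$) and $\pi_1,\dots,\pi_K$ vary freely subject to weak overlap. Call $f(\mathcal D)\in L_2$ a gradient of $J$ if $\frac{d}{dt}J(t)|_{t=0}=\mathbb E[f(\mathcal D)\,\dot\ell(\mathcal D)]$ along every one-dimensional submodel through the truth whose factors $p_S,\pi_k,p_{R\mid S,A}$ are differentiable in quadratic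 mean at $t=0$, where $\dot\ell$ is the resulting score of $\mathcal D$. Then $V^*$ is the minimum of $n\,\mathrm{var}[f(\mathcal D)]$ over all gradients $f$, and it is attained. -/

import Mathlib

open MeasureTheory ProbabilityTheory Filter Topology
open scoped ENNReal

noncomputable section

namespace OPE

/-! ## Contextual bandits with several logging policies -/

/-- An observation `((s, a), r)`: state (context), action and reward. -/
abbrev Obs (S A : Type*) : Type _ := (S × A) × ℝ

/-- A policy `π(a ∣ s)`, given by its density with respect to the base measure `ν` on actions
(counting measure for discrete actions, Lebesgue measure for continuous ones, etc.). -/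
structure Policy (S A : Type*) [MeasurableSpace S] [MeasurableSpace A] (ν : Measure A) where
  dens : S → A → ℝ
  measurable_dens : Measurable (Function.uncurry dens)
  dens_nonneg : ∀ s a, 0 ≤ dens s a
  lintegral_dens : ∀ s, ∫⁻ a, ENNReal.ofReal (dens s a) ∂ν = 1

/-- The kernel `s ↦ p(· ∣ s)` with `p(da ∣ s) = p(s, a) ν(da)`. -/
def densKernel {S A : Type*} [MeasurableSpace S] [MeasurableSpace A] (ν : Measure A) [SFinite ν]
    (p : S → A → ℝ) : Kernel S A :=
  (Kernel.const S ν).withDensity (fun s a => ENNReal.ofReal (p s a))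

/-- A problem instance: a law of states, a law of rewards in `[0, Rmax]` given state and action,
and `K` logging policies. -/
structure Bandit (S A : Type*) [MeasurableSpace S] [MeasurableSpace A] (ν : Measure A)
    (Rmax : ℝ) (K : ℕ) where
  stateLaw : Measure S
  isProb_stateLaw : IsProbabilityMeasure stateLaw
  rewardLaw : Kernel (S × A) ℝ
  isMarkov_rewardLaw : IsMarkovKernel rewardLaw
  reward_mem : ∀ x, ∀ᵐ r ∂(rewardLaw x), r ∈ Set.Icc 0 Rmax
  logging : Fin K → Policy S A ν

/-- The index set of a stratified data set whose `k`-th stratum has `N k` observations. -/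
abbrev Idx {K : ℕ} (N : Fin K → ℕ) : Type := (k : Fin K) × Fin (N k)

/-- A stratified data set with stratum sizes `N`. -/
abbrev Dataset (S A : Type*) {K : ℕ} (N : Fin K → ℕ) : Type _ := Idx N → Obs S A

namespace Bandit

variable {S A : Type*} [MeasurableSpace S] [MeasurableSpace A] {ν : Measure A} [SFinite ν]
  {Rmax : ℝ} {K : ℕ}

/-- `q(s, a) = E[r ∣ s, a]`. -/
def q (B : Bandit S A ν Rmax K) (s : S) (a : A) : ℝ := ∫ r, r ∂(B.rewardLaw (s, a))

/-- `σ_r²(s, a) = var[r ∣ s, a]`. -/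
def rewardVar (B : Bandit S A ν Rmax K) (s : S) (a : A) : ℝ := Var[id; B.rewardLaw (s, a)]

/-- `v(s) = q(s, π^e) = ∫ q(s, a) dπ^e(a ∣ s)`. -/
def v (B : Bandit S A ν Rmax K) (πe : Policy S A ν) (s : S) : ℝ :=
  ∫ a, B.q s a ∂(densKernel ν πe.dens s)

/-- The law `p_S(s) π(a ∣ s)` of a state-action pair when actions follow the density `p`. -/
def saLaw (B : Bandit S A ν Rmax K) (p : S → A → ℝ) : Measure (S × A) :=
  B.stateLaw ⊗ₘ densKernel ν p

/-- The law `p_S(s) π(a ∣ s) p_{R∣S,A}(r ∣ s, a)` of an observation. -/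
def obsLaw (B : Bandit S A ν Rmax K) (p : S → A → ℝ) : Measure (Obs S A) :=
  B.saLaw p ⊗ₘ B.rewardLaw

/-- The estimand `J = E_{π^e}[r]`. -/
def value (B : Bandit S A ν Rmax K) (πe : Policy S A ν) : ℝ := ∫ o, o.2 ∂(B.obsLaw πe.dens)

/-- The density of the marginal logging policy `π_* = ∑ₖ (nₖ / n) πₖ`, with `n = ∑ₖ nₖ`. -/
def mix (B : Bandit S A ν Rmax K) (n : Fin K → ℕ) (s : S) (a : A) : ℝ :=
  ∑ k, ((n k : ℝ) / ((∑ j, n j : ℕ) : ℝ)) * (B.logging k).dens s a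

/-- Weak overlap: `π^e(· ∣ s) ≪ π_*(· ∣ s)` for every state `s`. -/
def WeakOverlap (B : Bandit S A ν Rmax K) (n : Fin K → ℕ) (πe : Policy S A ν) : Prop :=
  ∀ s, densKernel ν πe.dens s ≪ densKernel ν (B.mix n) s

/-- The norm `‖f‖₂ = (E_{π_*}[f²])^{1/2}`, as an extended nonnegative real. -/
def l2 (B : Bandit S A ν Rmax K) (n : Fin K → ℕ) (f : S → A → ℝ) : ℝ≥0∞ :=
  eLpNorm (fun x : S × A => f x.1 x.2) 2 (B.saLaw (B.mix n))

/-- `V* = E_{π_*}[{π^e(a ∣ s) / π_*(a ∣ s)}² σ_r²(s, a)] + var_{p_S}[v(s)]`. -/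
def Vstar (B : Bandit S A ν Rmax K) (n : Fin K → ℕ) (πe : Policy S A ν) : ℝ :=
  (∫ x, (πe.dens x.1 x.2 / B.mix n x.1 x.2) ^ 2 * B.rewardVar x.1 x.2 ∂(B.saLaw (B.mix n)))
    + Var[B.v πe; B.stateLaw]

/-- The law of one stratified data set `𝒟`: independent observations, those of stratum `k` being
generated by the `k`-th logging policy. -/
def dataLaw (B : Bandit S A ν Rmax K) (n : Fin K → ℕ) : Measure (Dataset S A n) :=
  Measure.pi (fun p : Idx n => B.obsLaw (B.logging p.1).dens)

end Bandit

/-! ## The cross-fitted estimator -/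

/-- An even `Z`-fold partition, coded by the map that sends an index to its fold: within each
stratum `k`, the size of each fold is within `1` of `N k / Z`. -/
def IsEvenPartition {K Z : ℕ} {N : Fin K → ℕ} (f : Idx N → Fin Z) : Prop :=
  ∀ k z, |((Finset.univ.filter (fun i : Fin (N k) => f ⟨k, i⟩ = z)).card : ℝ) - (N k : ℝ) / Z| ≤ 1

/-- The indices of the evaluation sample `ℒ_z`. -/
def evalFold {K Z : ℕ} {N : Fin K → ℕ} (f : Idx N → Fin Z) (z : Fin Z) : Finset (Idx N) :=
  Finset.univ.filter (fun p => f p = z)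

/-- A cross-fitted estimator of a function of `(s, a)`: given a partition `f` and a fold `z`, it
returns a function of `(s, a)` computed from the observations of the training sample `𝒰_z` (those
outside the fold `z`) only. -/
structure CrossFit (S A : Type*) [MeasurableSpace S] [MeasurableSpace A] {K : ℕ} (Z : ℕ)
    (N : Fin K → ℕ) where
  est : (Idx N → Fin Z) → Fin Z → Dataset S A N → S → A → ℝ
  measurable_est : ∀ f z, Measurable (fun y : Dataset S A N × (S × A) => est f z y.1 y.2.1 y.2.2)
  dependsOn_train : ∀ f z, DependsOn (est f z) {p | f p ≠ z}

section Estimator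

variable {S A : Type*} [MeasurableSpace S] [MeasurableSpace A] {ν : Measure A} [SFinite ν]
  {K Z : ℕ} {N : Fin K → ℕ}

/-- `Γ(ℒ; h, g) = E_ℒ[h(k, s, a) π^e(a ∣ s) (r - g(s, a)) + g(s, π^e)]`, where `E_ℒ` is the
empirical mean over the observations of `x` with index in `L`. -/
def Gam (πe : Policy S A ν) (L : Finset (Idx N)) (x : Dataset S A N)
    (h : Fin K → S → A → ℝ) (g : S → A → ℝ) : ℝ :=
  (L.card : ℝ)⁻¹ * ∑ p ∈ L,
    (h p.1 (x p).1.1 (x p).1.2 * πe.dens (x p).1.1 (x p).1.2 * ((x p).2 - g (x p).1.1 (x p).1.2)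
      + ∫ a, g (x p).1.1 a ∂(densKernel ν πe.dens (x p).1.1))

/-- The cross-fold estimator `Ĵ_BI(ĥ, ĝ) = (1/N) ∑_z |ℒ_z| Γ(ℒ_z; ĥ⁽ᶻ⁾, ĝ⁽ᶻ⁾)`, with `N` the
total size of the data set `x`. -/
def JBI (πe : Policy S A ν) (f : Idx N → Fin Z) (x : Dataset S A N)
    (h : Fin Z → Fin K → S → A → ℝ) (g : Fin Z → S → A → ℝ) : ℝ :=
  ((∑ k, N k : ℕ) : ℝ)⁻¹ * ∑ z, ((evalFold f z).card : ℝ) * Gam πe (evalFold f z) x (h z) (g z)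

/-- The doubly robust estimator with estimated `π_*`, namely `Ĵ_BI(1/π̂_*, q̂)`. -/
def JDR (πe : Policy S A ν) (qhat pihat : CrossFit S A Z N) (f : Idx N → Fin Z)
    (x : Dataset S A N) : ℝ :=
  JBI πe f x (fun z _ s a => 1 / pihat.est f z x s a) (fun z => qhat.est f z x)

end Estimator

/-- `Y_m = o_p(r_m)` for nonnegative (possibly infinite) random quantities `Y_m` and rates `r_m`:
`P(Y_m ≥ ε r_m) → 0` for every `ε > 0`. -/
def IsLittleOP {Ω : Type*} [MeasurableSpace Ω] (P : Measure Ω) (Y : ℕ → Ω → ℝ≥0∞)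
    (r : ℕ → ℝ) : Prop :=
  ∀ ε : ℝ, 0 < ε → Tendsto (fun m => P {ω | ENNReal.ofReal (ε * r m) ≤ Y m ω}) atTop (𝓝 0)

/-! ## The efficiency bound in the model with unknown logging policies -/

/-- A one-parameter family `p t` of densities with respect to `μ` is differentiable in quadratic
mean at `t = 0` with score `g`: `∫ {(√p_t - √p_0) / t - g √p_0 / 2}² dμ → 0` as `t → 0`. -/
def HasQMScore {α : Type*} [MeasurableSpace α] (μ : Measure α) (p : ℝ → α → ℝ) (g : α → ℝ) :
    Prop :=
  Measurable g ∧
    Tendsto (fun t : ℝ =>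
      eLpNorm (fun x => (√(p t x) - √(p 0 x)) / t - g x * √(p 0 x) / 2) 2 μ) (𝓝[≠] 0) (𝓝 0)

section Efficiency

variable {S A : Type*} [MeasurableSpace S] [MeasurableSpace A] {ν : Measure A} [SFinite ν]
  {Rmax : ℝ} {K : ℕ}

/-- A regular one-dimensional submodel through the instance `B`, in the model where the law of
states, the law of rewards and all the logging policies vary freely, subject to weak overlap.
The laws of states and of rewards have densities with respect to `baseS` and `baseR`, and every
factor of the density of the data is differentiable in quadratic mean at `t = 0`. -/
structure Submodel (B : Bandit S A ν Rmax K) (n : Fin K → ℕ) (πe : Policy S A ν) where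
  inst : ℝ → Bandit S A ν Rmax K
  inst_zero : inst 0 = B
  overlap : ∀ t, (inst t).WeakOverlap n πe
  baseS : Measure S
  sigmaFinite_baseS : SigmaFinite baseS
  densS : ℝ → S → ℝ
  measurable_densS : ∀ t, Measurable (densS t)
  densS_nonneg : ∀ t s, 0 ≤ densS t s
  stateLaw_eq : ∀ t, (inst t).stateLaw = baseS.withDensity (fun s => ENNReal.ofReal (densS t s))
  baseR : Kernel (S × A) ℝ
  isSFiniteKernel_baseR : IsSFiniteKernel baseR
  densR : ℝ → Obs S A → ℝ
  measurable_densR : ∀ t, Measurable (densR t)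
  densR_nonneg : ∀ t o, 0 ≤ densR t o
  rewardLaw_eq : ∀ t x,
    (inst t).rewardLaw x = (baseR x).withDensity (fun r => ENNReal.ofReal (densR t (x, r)))
  scoreS : S → ℝ
  scoreA : Fin K → S × A → ℝ
  scoreR : Obs S A → ℝ
  qm_S : HasQMScore baseS densS scoreS
  qm_A : ∀ k, HasQMScore (B.stateLaw.prod ν)
    (fun t x => ((inst t).logging k).dens x.1 x.2) (scoreA k)
  qm_R : HasQMScore (B.saLaw (B.mix n) ⊗ₘ baseR) densR scoreR

/-- The score of the submodel for one stratified data set. -/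
def Submodel.score {B : Bandit S A ν Rmax K} {n : Fin K → ℕ} {πe : Policy S A ν}
    (M : Submodel B n πe) (x : Dataset S A n) : ℝ :=
  ∑ p : Idx n, (M.scoreS (x p).1.1 + M.scoreA p.1 (x p).1 + M.scoreR (x p))

/-- `f` is a gradient (influence function) of the estimand `J` at `B`: along every regular
submodel, the derivative of `J` at `t = 0` is `E[f(𝒟) · score(𝒟)]`. -/
def IsGradient (B : Bandit S A ν Rmax K) (n : Fin K → ℕ) (πe : Policy S A ν)
    (f : Dataset S A n → ℝ) : Prop :=
  MemLp f 2 (B.dataLaw n) ∧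
    ∀ M : Submodel B n πe,
      HasDerivAt (fun t => (M.inst t).value πe) (∫ x, f x * M.score x ∂(B.dataLaw n)) 0

/-- `V` is the efficiency bound: `n` times the variance of the gradient of least variance. (Adding
a constant to a gradient gives a gradient, so this is `n` times the squared norm of the centred
gradient of least norm, the efficient influence function.) -/
def IsEfficiencyBound (B : Bandit S A ν Rmax K) (n : Fin K → ℕ) (πe : Policy S A ν) (V : ℝ) :
    Prop :=
  IsLeast {W : ℝ | ∃ f, IsGradient B n πe f ∧ W = ((∑ k, n k : ℕ) : ℝ) * Var[f; B.dataLaw n]} V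

end Efficiency

end OPE

end

open OPE

/-!
The proof rests on the function `drScore(s, a, r) = w(s, a) (r - q(s, a)) + v(s)`, where
`w = π^e / π_*` is the importance weight (`Bandit.weight`). Both halves of the theorem say that the
average of `drScore` over the data is the right first-order approximation.

*Asymptotic normality.* `sqrt_mul_JDR_sub` writes `√n' (Ĵ - J)` as the normalised sum of
`drScore - J` plus, for every fold, a normalised sum of errors `drError` of the estimated summands.

* The leading term is a sum over `m` independent blocks, each distributed as one data set with
  stratum sizes `n`. The central limit theorem for independent identically distributed variables
  applies to the blocks (`tendstoInDistribution_drScore`). The mean of `drScore` is `J` in every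
  stratum, and its variances, which depend on the stratum, add up to `n V*`
  (`sum_variance_drScore`): the variance of `drScore` under `π_k` is
  `E_{π_k}[w² σ_r²] + var[v]`, which is affine in `π_k`.
* For the errors in fold `z`, condition on the training data. This is done by resampling the
  coordinates of fold `z` (`measurePreserving_finset_piecewise`, `measure_inter_sum_ge_le`), after
  the random partition has been fixed by independence (`measure_indep_mem_le`). Then the summands
  are independent; their second moments are of the order of the squared errors of the nuisance
  functions (`integral_sq_drError_le`), and their mean under `π_*` is of the order of the product of
  these errors (`sq_integral_drError_le`), because the doubly robust summand has the right mean when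
  either nuisance function is correct. The means in the single strata need not be of that order, but
  a fold contains a fraction `1 / Z` of each stratum up to one observation, so that the mean of the
  sum over the fold is `n' / Z` times the mean under `π_*`, up to a bounded multiple of the root
  mean square of one summand (`sq_sum_integral_add_le`). Chebyshev's inequality concludes.

*Efficiency.* Along a submodel, `J(t) = ∫∫ q_t dπ^e dp_{S,t}` has derivative
`E[f(𝒟) score(𝒟)]`, where `f` (`Bandit.effScore`) is the average of `drScore` over the data set
(`hasDerivAt_value`, `isGradient_effScore`); the variance of `f` is `V* / n`. For the lower bound it
is enough to exhibit one submodel whose score is `n (f - J)` (`Bandit.score_tiltModel`): it tilts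
the law of states along `v - J` and that of rewards along `w (r - q)`, and leaves the logging
policies alone. Any other gradient has the same covariance with that score, hence at least the
variance of `f` by the Cauchy–Schwarz inequality (`Bandit.isEfficiencyBound_Vstar`).
-/

open OPE
set_option linter.unusedSectionVars false

namespace OPE

/-! ### Laws of actions and observations, and changes of measure -/

section Laws

variable {S A : Type*} [MeasurableSpace S] [MeasurableSpace A] {ν : Measure A} [SFinite ν]
  {Rmax : ℝ} {K : ℕ}

instance (B : Bandit S A ν Rmax K) : IsProbabilityMeasure B.stateLaw := B.isProb_stateLaw

instance (B : Bandit S A ν Rmax K) : IsMarkovKernel B.rewardLaw := B.isMarkov_rewardLaw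

instance (p : S → A → ℝ) : IsSFiniteKernel (densKernel ν p) :=
  Kernel.IsSFiniteKernel.withDensity _ fun _ _ => ENNReal.ofReal_ne_top

lemma densKernel_apply {p : S → A → ℝ} (hp : Measurable (Function.uncurry p)) (s : S) :
    densKernel ν p s = ν.withDensity (fun a => ENNReal.ofReal (p s a)) := by
  rw [densKernel, Kernel.withDensity_apply _ (by exact hp.ennreal_ofReal)]
  rfl

instance (π : Policy S A ν) : IsMarkovKernel (densKernel ν π.dens) := by
  refine ⟨fun s => ⟨?_⟩⟩
  rw [densKernel_apply π.measurable_dens, withDensity_apply _ MeasurableSet.univ,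
    Measure.restrict_univ, π.lintegral_dens]

/-- Changing a kernel by a density changes the joint law by the same density. -/
lemma compProd_eq_withDensity {α β : Type*} [MeasurableSpace α] [MeasurableSpace β]
    (μ : Measure α) [SFinite μ] (κ κ' : Kernel α β) [IsSFiniteKernel κ] [IsSFiniteKernel κ']
    {f : α × β → ℝ≥0∞} (hf : Measurable f)
    (h : ∀ x, κ' x = (κ x).withDensity (fun y => f (x, y))) :
    μ ⊗ₘ κ' = (μ ⊗ₘ κ).withDensity f := by
  ext s hs
  rw [Measure.compProd_apply hs, withDensity_apply _ hs, ← lintegral_indicator hs,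
    Measure.lintegral_compProd (hf.indicator hs)]
  refine lintegral_congr fun x => ?_
  rw [h, withDensity_apply _ (measurable_prodMk_left hs),
    ← lintegral_indicator (measurable_prodMk_left hs)]
  rfl

/-- Changing the first marginal by a density changes the joint law by the same density. -/
lemma withDensity_compProd {α β : Type*} [MeasurableSpace α] [MeasurableSpace β]
    (μ : Measure α) [SFinite μ] (κ : Kernel α β) [IsSFiniteKernel κ] {f : α → ℝ≥0∞}
    (hf : Measurable f) [SFinite (μ.withDensity f)] :
    (μ.withDensity f) ⊗ₘ κ = (μ ⊗ₘ κ).withDensity (fun x => f x.1) := by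
  ext s hs
  have h1 : Measurable fun x => κ x (Prod.mk x ⁻¹' s) :=
    Kernel.measurable_kernel_prodMk_left hs
  rw [Measure.compProd_apply hs, withDensity_apply _ hs, ← lintegral_indicator hs,
    Measure.lintegral_compProd (f := s.indicator fun x => f x.1)
      ((hf.comp measurable_fst).indicator hs),
    lintegral_withDensity_eq_lintegral_mul _ hf h1]
  refine lintegral_congr fun x => ?_
  rw [Pi.mul_apply, ← lintegral_indicator_one (measurable_prodMk_left hs),
    ← lintegral_const_mul _ (measurable_one.indicator (measurable_prodMk_left hs))]
  refine lintegral_congr fun y => ?_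
  by_cases hy : (x, y) ∈ s <;> simp [Set.indicator, hy]

lemma integral_withDensity_ofReal {α : Type*} [MeasurableSpace α] {μ : Measure α} {p : α → ℝ}
    (hp : Measurable p) (hp0 : ∀ x, 0 ≤ p x) (f : α → ℝ) :
    ∫ x, f x ∂(μ.withDensity fun x => ENNReal.ofReal (p x)) = ∫ x, p x * f x ∂μ := by
  rw [integral_withDensity_eq_integral_toReal_smul hp.ennreal_ofReal (by simp)]
  simp [ENNReal.toReal_ofReal (hp0 _)]

lemma integrable_withDensity_ofReal {α : Type*} [MeasurableSpace α] {μ : Measure α} {p : α → ℝ}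
    (hp : Measurable p) (hp0 : ∀ x, 0 ≤ p x) (f : α → ℝ) :
    Integrable f (μ.withDensity fun x => ENNReal.ofReal (p x)) ↔
      Integrable (fun x => p x * f x) μ := by
  rw [integrable_withDensity_iff_integrable_smul' hp.ennreal_ofReal (by simp)]
  simp [ENNReal.toReal_ofReal (hp0 _)]

namespace Bandit

variable (B : Bandit S A ν Rmax K)

/-- The marginal logging policy `π_*`, as a policy. -/
noncomputable def mixPolicy (n : Fin K → ℕ) (hn : 0 < ∑ k, n k) : Policy S A ν where
  dens := B.mix n
  measurable_dens := by
    change Measurable fun x : S × A =>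
      ∑ k, ((n k : ℝ) / ((∑ j, n j : ℕ) : ℝ)) * (B.logging k).dens x.1 x.2
    exact Finset.measurable_fun_sum _ fun k _ => ((B.logging k).measurable_dens).const_mul _
  dens_nonneg s a := Finset.sum_nonneg fun k _ =>
    mul_nonneg (by positivity) ((B.logging k).dens_nonneg s a)
  lintegral_dens s := by
    have hm (k : Fin K) : Measurable fun a => ENNReal.ofReal ((B.logging k).dens s a) :=
      ((B.logging k).measurable_dens.comp measurable_prodMk_left).ennreal_ofReal
    have (a : A) : ENNReal.ofReal (B.mix n s a) = ∑ k, ENNReal.ofReal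
        ((n k : ℝ) / ((∑ j, n j : ℕ) : ℝ)) * ENNReal.ofReal ((B.logging k).dens s a) := by
      rw [mix, ENNReal.ofReal_sum_of_nonneg fun k _ =>
        mul_nonneg (by positivity) ((B.logging k).dens_nonneg s a)]
      exact Finset.sum_congr rfl fun k _ => ENNReal.ofReal_mul (by positivity)
    simp_rw [this]
    rw [lintegral_finsetSum _ fun k _ => (hm k).const_mul _]
    simp_rw [lintegral_const_mul _ (hm _), (B.logging _).lintegral_dens, mul_one]
    rw [← ENNReal.ofReal_sum_of_nonneg fun k _ => by positivity, ← Finset.sum_div,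
      ← Nat.cast_sum, div_self (by exact_mod_cast hn.ne'), ENNReal.ofReal_one]

@[simp] lemma mixPolicy_dens (n : Fin K → ℕ) (hn : 0 < ∑ k, n k) :
    (B.mixPolicy n hn).dens = B.mix n := rfl

instance (p : S → A → ℝ) : SFinite (B.saLaw p) := by unfold saLaw; infer_instance

instance (π : Policy S A ν) : IsProbabilityMeasure (B.saLaw π.dens) := by
  unfold saLaw; infer_instance

instance (π : Policy S A ν) : IsProbabilityMeasure (B.obsLaw π.dens) := by
  unfold obsLaw; infer_instance

instance (n : Fin K → ℕ) : IsProbabilityMeasure (B.dataLaw n) := by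
  unfold dataLaw; infer_instance

lemma saLaw_eq_withDensity {p : S → A → ℝ} (hp : Measurable (Function.uncurry p)) :
    B.saLaw p = (B.stateLaw.prod ν).withDensity (fun x => ENNReal.ofReal (p x.1 x.2)) := by
  rw [saLaw, ← Measure.compProd_const]
  refine compProd_eq_withDensity _ _ _ hp.ennreal_ofReal fun s => ?_
  rw [densKernel_apply hp]
  rfl

lemma map_fst_obsLaw (p : S → A → ℝ) : (B.obsLaw p).map Prod.fst = B.saLaw p := by
  rw [obsLaw]; exact Measure.fst_compProd _ _

lemma map_fst_saLaw (π : Policy S A ν) : (B.saLaw π.dens).map Prod.fst = B.stateLaw := by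
  rw [saLaw]; exact Measure.fst_compProd _ _

lemma measurePreserving_fst_obsLaw (p : S → A → ℝ) :
    MeasurePreserving Prod.fst (B.obsLaw p) (B.saLaw p) :=
  ⟨measurable_fst, B.map_fst_obsLaw p⟩

lemma measurePreserving_fst_saLaw (π : Policy S A ν) :
    MeasurePreserving Prod.fst (B.saLaw π.dens) B.stateLaw :=
  ⟨measurable_fst, B.map_fst_saLaw π⟩

lemma measurePreserving_state (π : Policy S A ν) :
    MeasurePreserving (fun o : Obs S A => o.1.1) (B.obsLaw π.dens) B.stateLaw :=
  (B.measurePreserving_fst_saLaw π).comp (B.measurePreserving_fst_obsLaw π.dens)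

lemma ae_reward_mem (p : S → A → ℝ) : ∀ᵐ o ∂(B.obsLaw p), o.2 ∈ Set.Icc 0 Rmax := by
  rw [obsLaw]
  exact Measure.ae_compProd_of_ae_ae (measurableSet_Icc.preimage measurable_snd)
    (Eventually.of_forall fun x => B.reward_mem x)

/-- Change of measure for state-action pairs. -/
lemma saLaw_eq_withDensity_div {p p' : S → A → ℝ} (hp : Measurable (Function.uncurry p))
    (hp' : Measurable (Function.uncurry p')) (h0' : ∀ s a, 0 ≤ p' s a)
    (hac : ∀ᵐ x ∂(B.stateLaw.prod ν), p' x.1 x.2 = 0 → p x.1 x.2 = 0) :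
    B.saLaw p = (B.saLaw p').withDensity (fun x => ENNReal.ofReal (p x.1 x.2 / p' x.1 x.2)) := by
  have hm : Measurable fun x : S × A => p x.1 x.2 / p' x.1 x.2 := hp.div hp'
  have hp'' : Measurable fun x : S × A => ENNReal.ofReal (p' x.1 x.2) := hp'.ennreal_ofReal
  rw [B.saLaw_eq_withDensity hp, B.saLaw_eq_withDensity hp',
    ← withDensity_mul _ hp'' hm.ennreal_ofReal]
  refine withDensity_congr_ae ?_
  filter_upwards [hac] with x hx
  rw [Pi.mul_apply, ← ENNReal.ofReal_mul (h0' _ _)]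
  by_cases h : p' x.1 x.2 = 0
  · simp [h, hx h]
  · congr 1; field_simp

/-- Change of measure for observations. -/
lemma obsLaw_eq_withDensity_div {p p' : S → A → ℝ} (hp : Measurable (Function.uncurry p))
    (hp' : Measurable (Function.uncurry p')) (h0' : ∀ s a, 0 ≤ p' s a)
    (hac : ∀ᵐ x ∂(B.stateLaw.prod ν), p' x.1 x.2 = 0 → p x.1 x.2 = 0) :
    B.obsLaw p = (B.obsLaw p').withDensity
      (fun o => ENNReal.ofReal (p o.1.1 o.1.2 / p' o.1.1 o.1.2)) := by
  have hm : Measurable fun x : S × A => p x.1 x.2 / p' x.1 x.2 := hp.div hp'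
  have h := B.saLaw_eq_withDensity_div hp hp' h0' hac
  have : SFinite ((B.saLaw p').withDensity
      (fun x => ENNReal.ofReal (p x.1 x.2 / p' x.1 x.2))) := h ▸ inferInstance
  rw [obsLaw, h, withDensity_compProd _ _ hm.ennreal_ofReal, obsLaw]

lemma ae_dens_pos {p : S → A → ℝ} (hp : Measurable (Function.uncurry p)) :
    ∀ᵐ x ∂(B.saLaw p), 0 < p x.1 x.2 := by
  have hp' : Measurable fun x : S × A => ENNReal.ofReal (p x.1 x.2) := hp.ennreal_ofReal
  rw [B.saLaw_eq_withDensity hp, ae_withDensity_iff hp']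
  refine Eventually.of_forall fun x hx => ?_
  simpa using hx

lemma ae_dens_pos_obs {p : S → A → ℝ} (hp : Measurable (Function.uncurry p)) :
    ∀ᵐ o ∂(B.obsLaw p), 0 < p o.1.1 o.1.2 :=
  (B.measurePreserving_fst_obsLaw p).quasiMeasurePreserving.ae (B.ae_dens_pos hp)

variable {B} {n : Fin K → ℕ}

lemma measurable_mix (hn : 0 < ∑ k, n k) : Measurable (Function.uncurry (B.mix n)) :=
  (B.mixPolicy n hn).measurable_dens

lemma mix_nonneg (hn : 0 < ∑ k, n k) (s : S) (a : A) : 0 ≤ B.mix n s a :=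
  (B.mixPolicy n hn).dens_nonneg s a

/-- Weak overlap in terms of densities. -/
lemma WeakOverlap.ae_dens {πe : Policy S A ν} (h : B.WeakOverlap n πe) (hn : 0 < ∑ k, n k) :
    ∀ᵐ x ∂(B.stateLaw.prod ν), B.mix n x.1 x.2 = 0 → πe.dens x.1 x.2 = 0 := by
  have hm := measurable_mix (B := B) hn
  have hset : MeasurableSet {x : S × A | B.mix n x.1 x.2 = 0 → πe.dens x.1 x.2 = 0} :=
    (hm (measurableSet_singleton 0)).himp (πe.measurable_dens (measurableSet_singleton 0))
  rw [Measure.ae_prod_iff_ae_ae hset]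
  refine Eventually.of_forall fun s => ?_
  have hs := h s
  rw [densKernel_apply hm, densKernel_apply πe.measurable_dens] at hs
  have h1 : ∀ᵐ a ∂(ν.withDensity fun a => ENNReal.ofReal (B.mix n s a)), B.mix n s a ≠ 0 := by
    rw [ae_withDensity_iff (by exact (hm.comp measurable_prodMk_left).ennreal_ofReal)]
    refine Eventually.of_forall fun a ha h0 => ha (by simp [h0])
  have h2 : ∀ᵐ a ∂(ν.withDensity fun a => ENNReal.ofReal (πe.dens s a)), B.mix n s a ≠ 0 :=
    hs.ae_le h1
  rw [ae_withDensity_iff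
    (by exact (πe.measurable_dens.comp measurable_prodMk_left).ennreal_ofReal)] at h2
  filter_upwards [h2] with a ha h0
  by_contra hne
  refine ha ?_ h0
  simpa using lt_of_le_of_ne (πe.dens_nonneg s a) (Ne.symm hne)

lemma logging_le_mul_mix (hn : 0 < ∑ k, n k) {k : Fin K} (hk : 0 < n k) (s : S) (a : A) :
    (B.logging k).dens s a ≤ ((∑ j, n j : ℕ) : ℝ) * B.mix n s a := by
  have hN : (0 : ℝ) < ((∑ j, n j : ℕ) : ℝ) := by exact_mod_cast hn
  have h1 : (n k : ℝ) / ((∑ j, n j : ℕ) : ℝ) * (B.logging k).dens s a ≤ B.mix n s a :=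
    Finset.single_le_sum (f := fun k => (n k : ℝ) / ((∑ j, n j : ℕ) : ℝ) *
      (B.logging k).dens s a)
      (fun k _ => mul_nonneg (by positivity) ((B.logging k).dens_nonneg s a)) (Finset.mem_univ k)
  have h2 : (1 : ℝ) ≤ n k := by exact_mod_cast hk
  calc (B.logging k).dens s a ≤ n k * (B.logging k).dens s a :=
        le_mul_of_one_le_left ((B.logging k).dens_nonneg s a) h2
    _ = ((∑ j, n j : ℕ) : ℝ) * ((n k : ℝ) / ((∑ j, n j : ℕ) : ℝ) * (B.logging k).dens s a) := by
        field_simp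
    _ ≤ _ := by gcongr

lemma logging_eq_zero (hn : 0 < ∑ k, n k) {k : Fin K} (hk : 0 < n k) {s : S} {a : A}
    (h : B.mix n s a = 0) : (B.logging k).dens s a = 0 :=
  le_antisymm (by simpa [h] using logging_le_mul_mix (B := B) hn hk s a)
    ((B.logging k).dens_nonneg s a)

/-- The law of an observation under a policy dominated by `π_*`. -/
lemma integral_obsLaw_of_ac (hn : 0 < ∑ k, n k) (π : Policy S A ν)
    (hac : ∀ᵐ x ∂(B.stateLaw.prod ν), B.mix n x.1 x.2 = 0 → π.dens x.1 x.2 = 0)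
    (f : Obs S A → ℝ) :
    ∫ o, f o ∂(B.obsLaw π.dens)
      = ∫ o, π.dens o.1.1 o.1.2 / B.mix n o.1.1 o.1.2 * f o ∂(B.obsLaw (B.mix n)) := by
  have hm := measurable_mix (B := B) hn
  rw [B.obsLaw_eq_withDensity_div π.measurable_dens hm (mix_nonneg hn) hac,
    integral_withDensity_ofReal]
  · exact (show Measurable fun x : S × A => π.dens x.1 x.2 / B.mix n x.1 x.2 from
      π.measurable_dens.div hm).comp measurable_fst
  · exact fun o => div_nonneg (π.dens_nonneg _ _) (mix_nonneg hn _ _)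

lemma integral_saLaw_of_ac (hn : 0 < ∑ k, n k) (π : Policy S A ν)
    (hac : ∀ᵐ x ∂(B.stateLaw.prod ν), B.mix n x.1 x.2 = 0 → π.dens x.1 x.2 = 0)
    (f : S × A → ℝ) :
    ∫ x, f x ∂(B.saLaw π.dens)
      = ∫ x, π.dens x.1 x.2 / B.mix n x.1 x.2 * f x ∂(B.saLaw (B.mix n)) := by
  have hm := measurable_mix (B := B) hn
  rw [B.saLaw_eq_withDensity_div π.measurable_dens hm (mix_nonneg hn) hac,
    integral_withDensity_ofReal]
  · exact π.measurable_dens.div hm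
  · exact fun o => div_nonneg (π.dens_nonneg _ _) (mix_nonneg hn _ _)

lemma ac_logging (hn : 0 < ∑ k, n k) {k : Fin K} (hk : 0 < n k) :
    ∀ᵐ x ∂(B.stateLaw.prod ν), B.mix n x.1 x.2 = 0 → (B.logging k).dens x.1 x.2 = 0 :=
  Eventually.of_forall fun _ => logging_eq_zero hn hk

/-- Each stratum that is present is dominated by the mixture. -/
lemma obsLaw_logging_le (hn : 0 < ∑ k, n k) {k : Fin K} (hk : 0 < n k) :
    B.obsLaw (B.logging k).dens ≤ ((∑ j, n j : ℕ) : ℝ≥0∞) • B.obsLaw (B.mix n) := by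
  have hm := measurable_mix (B := B) hn
  rw [B.obsLaw_eq_withDensity_div (B.logging k).measurable_dens hm (mix_nonneg hn)
    (ac_logging hn hk), ← withDensity_const]
  refine withDensity_mono (Eventually.of_forall fun o => ?_)
  rw [← ENNReal.ofReal_natCast]
  refine ENNReal.ofReal_le_ofReal (div_le_of_le_mul₀ (mix_nonneg hn _ _) (by positivity) ?_)
  exact logging_le_mul_mix hn hk _ _

/-- Expectation under the mixture is the average of the expectations over the strata. -/
lemma integral_obsLaw_mix (hn : 0 < ∑ k, n k) {f : Obs S A → ℝ}
    (hf : Integrable f (B.obsLaw (B.mix n))) :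
    ∫ o, f o ∂(B.obsLaw (B.mix n)) = ∑ k, ((n k : ℝ) / ((∑ j, n j : ℕ) : ℝ)) *
      ∫ o, f o ∂(B.obsLaw (B.logging k).dens) := by
  have hm := measurable_mix (B := B) hn
  set u : Fin K → Obs S A → ℝ := fun k o =>
    (n k : ℝ) / ((∑ j, n j : ℕ) : ℝ) * ((B.logging k).dens o.1.1 o.1.2 / B.mix n o.1.1 o.1.2)
  have hsum : ∀ᵐ o ∂(B.obsLaw (B.mix n)), f o = ∑ k, u k o * f o := by
    filter_upwards [B.ae_dens_pos_obs hm] with o ho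
    rw [← Finset.sum_mul]
    have : ∑ k, u k o = B.mix n o.1.1 o.1.2 / B.mix n o.1.1 o.1.2 := by
      simp only [u, ← mul_div_assoc]
      rw [← Finset.sum_div]
      rfl
    rw [this, div_self ho.ne', one_mul]
  have hu (k : Fin K) (o : Obs S A) : ‖u k o‖ ≤ 1 := by
    have h0 := mix_nonneg (B := B) hn o.1.1 o.1.2
    have hk0 (k : Fin K) : 0 ≤ (n k : ℝ) / ((∑ j, n j : ℕ) : ℝ) * (B.logging k).dens o.1.1 o.1.2 :=
      mul_nonneg (by positivity) ((B.logging k).dens_nonneg _ _)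
    have h1 : (n k : ℝ) / ((∑ j, n j : ℕ) : ℝ) * (B.logging k).dens o.1.1 o.1.2
        ≤ B.mix n o.1.1 o.1.2 :=
      Finset.single_le_sum (f := fun k => (n k : ℝ) / ((∑ j, n j : ℕ) : ℝ) *
        (B.logging k).dens o.1.1 o.1.2) (fun k _ => hk0 k) (Finset.mem_univ k)
    have h2 : u k o = (n k : ℝ) / ((∑ j, n j : ℕ) : ℝ) * (B.logging k).dens o.1.1 o.1.2
        / B.mix n o.1.1 o.1.2 := by simp only [u, mul_div_assoc]
    rw [h2, Real.norm_of_nonneg (div_nonneg (hk0 k) h0)]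
    exact div_le_one_of_le₀ h1 h0
  have hint (k : Fin K) : Integrable (fun o => u k o * f o) (B.obsLaw (B.mix n)) := by
    refine hf.bdd_mul (c := 1) ?_ (Eventually.of_forall (hu k))
    exact ((((show Measurable fun x : S × A => (B.logging k).dens x.1 x.2 / B.mix n x.1 x.2 from
      (B.logging k).measurable_dens.div hm).comp measurable_fst).const_mul _)).aestronglyMeasurable
  rw [integral_congr_ae hsum, integral_finsetSum _ fun k _ => hint k]
  refine Finset.sum_congr rfl fun k _ => ?_
  rcases Nat.eq_zero_or_pos (n k) with hk | hk
  · simp [u, hk]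
  · rw [integral_obsLaw_of_ac hn (B.logging k) (ac_logging hn hk), ← integral_const_mul]
    simp only [u, mul_assoc]

end Bandit

end Laws

end OPE

namespace OPE

/-! ### The efficient influence function of a single observation -/

section Influence

variable {S A : Type*} [MeasurableSpace S] [MeasurableSpace A] {ν : Measure A} [SFinite ν]
  {Rmax : ℝ} {K : ℕ}

namespace Bandit

variable (B : Bandit S A ν Rmax K)

lemma nonneg_of_policy (B : Bandit S A ν Rmax K) (π : Policy S A ν) : 0 ≤ Rmax := by
  obtain ⟨o, ho⟩ := (B.ae_reward_mem π.dens).exists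
  exact ho.1.trans ho.2

lemma measurable_uncurry_q : Measurable (Function.uncurry B.q) :=
  (StronglyMeasurable.integral_kernel (κ := B.rewardLaw) (f := fun r : ℝ => r)
    measurable_id.stronglyMeasurable).measurable

lemma integrable_reward (x : S × A) : Integrable (fun r : ℝ => r) (B.rewardLaw x) :=
  Integrable.of_mem_Icc 0 Rmax measurable_id.aemeasurable (B.reward_mem x)

lemma q_mem (s : S) (a : A) : B.q s a ∈ Set.Icc 0 Rmax := by
  refine ⟨integral_nonneg_of_ae ((B.reward_mem (s, a)).mono fun r hr => hr.1), ?_⟩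
  calc B.q s a ≤ ∫ _, Rmax ∂(B.rewardLaw (s, a)) :=
        integral_mono_ae (B.integrable_reward _) (integrable_const _)
          ((B.reward_mem (s, a)).mono fun r hr => hr.2)
    _ = Rmax := by simp

lemma abs_q_le (s : S) (a : A) : |B.q s a| ≤ Rmax := by
  rw [abs_of_nonneg (B.q_mem s a).1]; exact (B.q_mem s a).2

/-- The average of a measurable function of `(s, a)` over the actions of a policy is measurable. -/
lemma measurable_integral_policy (π : Policy S A ν) {g : S → A → ℝ}
    (hg : Measurable (Function.uncurry g)) :
    Measurable fun s => ∫ a, g s a ∂(densKernel ν π.dens s) :=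
  (StronglyMeasurable.integral_kernel_prod_right (κ := densKernel ν π.dens)
    hg.stronglyMeasurable).measurable

lemma abs_integral_policy_le (π : Policy S A ν) {g : S → A → ℝ} {M : ℝ}
    (hg : ∀ s a, |g s a| ≤ M) (s : S) : |∫ a, g s a ∂(densKernel ν π.dens s)| ≤ M := by
  simpa using norm_integral_le_of_norm_le_const (μ := densKernel ν π.dens s)
    (Eventually.of_forall fun a => (Real.norm_eq_abs (g s a)).le.trans (hg s a))

lemma measurable_v (πe : Policy S A ν) : Measurable (B.v πe) :=
  measurable_integral_policy πe B.measurable_uncurry_q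

lemma abs_v_le (πe : Policy S A ν) (s : S) : |B.v πe s| ≤ Rmax :=
  abs_integral_policy_le πe B.abs_q_le s

lemma integrable_saLaw_of_bdd (π : Policy S A ν) {g : S × A → ℝ} (hg : Measurable g) {M : ℝ}
    (hb : ∀ x, |g x| ≤ M) : Integrable g (B.saLaw π.dens) :=
  Integrable.of_bound hg.aestronglyMeasurable M (Eventually.of_forall hb)

lemma integral_saLaw (π : Policy S A ν) {g : S × A → ℝ} (hg : Integrable g (B.saLaw π.dens)) :
    ∫ x, g x ∂(B.saLaw π.dens) = ∫ s, ∫ a, g (s, a) ∂(densKernel ν π.dens s) ∂B.stateLaw := by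
  rw [saLaw] at hg ⊢
  exact Measure.integral_compProd hg

lemma integrable_reward_obs (π : Policy S A ν) :
    Integrable (fun o : Obs S A => o.2) (B.obsLaw π.dens) :=
  Integrable.of_mem_Icc 0 Rmax measurable_snd.aemeasurable (B.ae_reward_mem π.dens)

lemma value_eq_integral_v (πe : Policy S A ν) : B.value πe = ∫ s, B.v πe s ∂B.stateLaw := by
  rw [value, obsLaw, Measure.integral_compProd (by exact B.integrable_reward_obs πe)]
  exact B.integral_saLaw πe (g := fun x => B.q x.1 x.2)
    (B.integrable_saLaw_of_bdd πe B.measurable_uncurry_q fun x => B.abs_q_le _ _)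

lemma ae_abs_reward_sub_le (π : Policy S A ν) :
    ∀ᵐ o ∂(B.obsLaw π.dens), |o.2 - B.q o.1.1 o.1.2| ≤ Rmax := by
  filter_upwards [B.ae_reward_mem π.dens] with o ho
  have hq := B.q_mem o.1.1 o.1.2
  rw [abs_le]
  constructor <;> linarith [ho.1, ho.2, hq.1, hq.2]

lemma measurable_reward_sub : Measurable fun o : Obs S A => o.2 - B.q o.1.1 o.1.2 :=
  measurable_snd.sub (B.measurable_uncurry_q.comp measurable_fst)

lemma integrable_mul_reward_sub (π : Policy S A ν) {F : S × A → ℝ}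
    (hF : Integrable F (B.saLaw π.dens)) :
    Integrable (fun o : Obs S A => F o.1 * (o.2 - B.q o.1.1 o.1.2)) (B.obsLaw π.dens) := by
  have h1 : Integrable (fun o : Obs S A => F o.1) (B.obsLaw π.dens) :=
    (B.measurePreserving_fst_obsLaw π.dens).integrable_comp_of_integrable hF
  exact h1.mul_bdd (c := Rmax) (B.measurable_reward_sub).aestronglyMeasurable
    (B.ae_abs_reward_sub_le π)

/-- The centred reward is orthogonal to every function of state and action. -/
lemma integral_mul_reward_sub (π : Policy S A ν) {F : S × A → ℝ}
    (hF : Integrable F (B.saLaw π.dens)) :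
    ∫ o, F o.1 * (o.2 - B.q o.1.1 o.1.2) ∂(B.obsLaw π.dens) = 0 := by
  have h := B.integrable_mul_reward_sub π hF
  rw [obsLaw] at h ⊢
  rw [Measure.integral_compProd h]
  refine integral_eq_zero_of_ae (Eventually.of_forall fun x => ?_)
  change ∫ r, F x * (r - B.q x.1 x.2) ∂(B.rewardLaw x) = 0
  rw [integral_const_mul, integral_sub (B.integrable_reward x) (integrable_const _)]
  simp [q]

variable (n : Fin K → ℕ) (πe : Policy S A ν)

/-- The importance weight `π^e(a ∣ s) / π_*(a ∣ s)`. -/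
noncomputable def weight (x : S × A) : ℝ := πe.dens x.1 x.2 / B.mix n x.1 x.2

/-- The uncentred efficient influence function
`{π^e(a ∣ s) / π_*(a ∣ s)} (r - q(s, a)) + v(s)` of one observation. -/
noncomputable def drScore (o : Obs S A) : ℝ :=
  B.weight n πe o.1 * (o.2 - B.q o.1.1 o.1.2) + B.v πe o.1.1

variable {B n πe}

lemma measurable_weight (hn : 0 < ∑ k, n k) : Measurable (B.weight n πe) :=
  πe.measurable_dens.div (measurable_mix hn)

lemma weight_nonneg (hn : 0 < ∑ k, n k) (x : S × A) : 0 ≤ B.weight n πe x :=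
  div_nonneg (πe.dens_nonneg _ _) (mix_nonneg hn _ _)

lemma abs_weight_le (hn : 0 < ∑ k, n k) {C : ℝ} (hC : 0 ≤ C)
    (hw : ∀ s a, 0 < B.mix n s a → πe.dens s a / B.mix n s a ≤ C) (x : S × A) :
    |B.weight n πe x| ≤ C := by
  rw [abs_of_nonneg (weight_nonneg hn x), weight]
  rcases (mix_nonneg (B := B) hn x.1 x.2).eq_or_lt with h | h
  · simpa [← h] using hC
  · exact hw _ _ h

lemma measurable_drScore (hn : 0 < ∑ k, n k) : Measurable (B.drScore n πe) :=
  (((measurable_weight hn).comp measurable_fst).mul B.measurable_reward_sub).add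
    ((B.measurable_v πe).comp (measurable_fst.comp measurable_fst))

lemma ae_abs_drScore_le {C : ℝ} (hC : ∀ x, |B.weight n πe x| ≤ C)
    (π : Policy S A ν) :
    ∀ᵐ o ∂(B.obsLaw π.dens), |B.drScore n πe o| ≤ C * Rmax + Rmax := by
  filter_upwards [B.ae_abs_reward_sub_le π] with o ho
  refine (abs_add_le _ _).trans (add_le_add ?_ (B.abs_v_le πe _))
  rw [abs_mul]
  exact mul_le_mul (hC _) ho (abs_nonneg _) ((abs_nonneg _).trans (hC o.1))

lemma memLp_drScore (hn : 0 < ∑ k, n k) {C : ℝ} (hC : ∀ x, |B.weight n πe x| ≤ C)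
    (π : Policy S A ν) (p : ℝ≥0∞) : MemLp (B.drScore n πe) p (B.obsLaw π.dens) :=
  MemLp.of_bound (measurable_drScore hn).aestronglyMeasurable _ (ae_abs_drScore_le hC π)

lemma integrable_weight (hn : 0 < ∑ k, n k) {C : ℝ} (hC : ∀ x, |B.weight n πe x| ≤ C)
    (π : Policy S A ν) : Integrable (B.weight n πe) (B.saLaw π.dens) :=
  B.integrable_saLaw_of_bdd π (measurable_weight hn) hC

lemma integral_state (π : Policy S A ν) {f : S → ℝ} (hf : Measurable f) :
    ∫ o, f o.1.1 ∂(B.obsLaw π.dens) = ∫ s, f s ∂B.stateLaw := by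
  rw [← (B.measurePreserving_state π).map_eq, integral_map
    (B.measurePreserving_state π).measurable.aemeasurable hf.aestronglyMeasurable]

lemma integrable_v_obs (π : Policy S A ν) :
    Integrable (fun o : Obs S A => B.v πe o.1.1) (B.obsLaw π.dens) :=
  Integrable.of_bound ((B.measurable_v πe).comp
    (measurable_fst.comp measurable_fst)).aestronglyMeasurable Rmax
    (Eventually.of_forall fun _ => B.abs_v_le πe _)

/-- The mean of the influence function is the estimand, whatever the logging policy. -/
lemma integral_drScore (hn : 0 < ∑ k, n k) {C : ℝ} (hC : ∀ x, |B.weight n πe x| ≤ C)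
    (π : Policy S A ν) : ∫ o, B.drScore n πe o ∂(B.obsLaw π.dens) = B.value πe := by
  unfold drScore
  rw [integral_add (B.integrable_mul_reward_sub π (integrable_weight hn hC π))
    (integrable_v_obs π), B.integral_mul_reward_sub π (integrable_weight hn hC π), zero_add,
    integral_state π (B.measurable_v πe), B.value_eq_integral_v πe]

lemma measurable_rewardVar : Measurable fun x : S × A => B.rewardVar x.1 x.2 := by
  have h : (fun x : S × A => B.rewardVar x.1 x.2)
      = fun x => ∫ r, (r - B.q x.1 x.2) ^ 2 ∂(B.rewardLaw x) := by
    ext x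
    rw [rewardVar, variance_eq_integral measurable_id.aemeasurable]
    rfl
  rw [h]
  exact (StronglyMeasurable.integral_kernel_prod_right (κ := B.rewardLaw)
    (f := fun x r => (r - B.q x.1 x.2) ^ 2)
    ((B.measurable_reward_sub).pow_const 2).stronglyMeasurable).measurable

lemma integral_sq_mul_reward_sub (hn : 0 < ∑ k, n k) {C : ℝ}
    (hC : ∀ x, |B.weight n πe x| ≤ C) (π : Policy S A ν) :
    ∫ o, (B.weight n πe o.1 * (o.2 - B.q o.1.1 o.1.2)) ^ 2 ∂(B.obsLaw π.dens)
      = ∫ x, B.weight n πe x ^ 2 * B.rewardVar x.1 x.2 ∂(B.saLaw π.dens) := by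
  have hm : Measurable fun o : Obs S A => B.weight n πe o.1 * (o.2 - B.q o.1.1 o.1.2) :=
    ((measurable_weight hn).comp measurable_fst).mul B.measurable_reward_sub
  have hint : Integrable (fun o : Obs S A =>
      (B.weight n πe o.1 * (o.2 - B.q o.1.1 o.1.2)) ^ 2) (B.obsLaw π.dens) := by
    refine Integrable.of_bound (hm.pow_const 2).aestronglyMeasurable ((C * Rmax) ^ 2) ?_
    filter_upwards [B.ae_abs_reward_sub_le π] with o ho
    rw [norm_pow, Real.norm_eq_abs, abs_mul]
    gcongr
    · exact (abs_nonneg _).trans (hC o.1)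
    · exact hC _
  rw [obsLaw] at hint ⊢
  rw [Measure.integral_compProd hint]
  refine integral_congr_ae (Eventually.of_forall fun x => ?_)
  change ∫ r, (B.weight n πe x * (r - B.q x.1 x.2)) ^ 2 ∂(B.rewardLaw x) = _
  simp_rw [mul_pow]
  rw [integral_const_mul, rewardVar, variance_eq_integral measurable_id.aemeasurable]
  rfl

/-- The variance of the influence function under one logging policy. -/
lemma variance_drScore (hn : 0 < ∑ k, n k) {C : ℝ} (hC : ∀ x, |B.weight n πe x| ≤ C)
    (π : Policy S A ν) :
    Var[B.drScore n πe; B.obsLaw π.dens]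
      = (∫ x, B.weight n πe x ^ 2 * B.rewardVar x.1 x.2 ∂(B.saLaw π.dens))
        + Var[B.v πe; B.stateLaw] := by
  set U : Obs S A → ℝ := fun o => B.weight n πe o.1 * (o.2 - B.q o.1.1 o.1.2) with hU
  set W : Obs S A → ℝ := fun o => B.v πe o.1.1 with hW
  have hUm : Measurable U :=
    ((measurable_weight hn).comp measurable_fst).mul B.measurable_reward_sub
  have hWm : Measurable W := (B.measurable_v πe).comp (measurable_fst.comp measurable_fst)
  have hU2 : MemLp U 2 (B.obsLaw π.dens) := by
    refine MemLp.of_bound hUm.aestronglyMeasurable (C * Rmax) ?_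
    filter_upwards [B.ae_abs_reward_sub_le π] with o ho
    rw [Real.norm_eq_abs, abs_mul]
    gcongr
    · exact (abs_nonneg _).trans (hC o.1)
    · exact hC _
  have hW2 : MemLp W 2 (B.obsLaw π.dens) :=
    MemLp.of_bound hWm.aestronglyMeasurable Rmax (Eventually.of_forall fun _ => B.abs_v_le πe _)
  have hU0 : ∫ o, U o ∂(B.obsLaw π.dens) = 0 :=
    B.integral_mul_reward_sub π (integrable_weight hn hC π)
  have hcov : cov[U, W; B.obsLaw π.dens] = 0 := by
    rw [covariance_eq_sub hU2 hW2, hU0, zero_mul, sub_zero]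
    have : (fun o => (U * W) o) = fun o : Obs S A =>
        (fun x : S × A => B.weight n πe x * B.v πe x.1) o.1 * (o.2 - B.q o.1.1 o.1.2) := by
      ext o; simp only [U, W, Pi.mul_apply]; ring
    change ∫ o, (fun o => (U * W) o) o ∂(B.obsLaw π.dens) = 0
    rw [this]
    refine B.integral_mul_reward_sub π ((integrable_weight hn hC π).mul_bdd (c := Rmax)
      ((B.measurable_v πe).comp measurable_fst).aestronglyMeasurable
      (Eventually.of_forall fun _ => B.abs_v_le πe _))
  have hadd : B.drScore n πe = U + W := rfl
  rw [hadd, variance_add hU2 hW2, hcov, variance_eq_integral hUm.aemeasurable, hU0]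
  simp only [sub_zero, mul_zero, add_zero]
  rw [integral_sq_mul_reward_sub hn hC π]
  congr 1
  have h := (B.measurePreserving_state π)
  have h2 : Var[B.v πe; (B.obsLaw π.dens).map fun o : Obs S A => o.1.1]
      = Var[W; B.obsLaw π.dens] :=
    variance_map (B.measurable_v πe).aemeasurable h.measurable.aemeasurable
  rw [← h2, h.map_eq]

/-- The average over the strata of the variances of the influence function is `V*`. -/
lemma sum_variance_drScore (hn : 0 < ∑ k, n k) {C : ℝ} (hC : ∀ x, |B.weight n πe x| ≤ C) :
    ∑ k, (n k : ℝ) * Var[B.drScore n πe; B.obsLaw (B.logging k).dens]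
      = ((∑ j, n j : ℕ) : ℝ) * B.Vstar n πe := by
  have hN : (0 : ℝ) < ((∑ j, n j : ℕ) : ℝ) := by exact_mod_cast hn
  have hm : Measurable fun o : Obs S A => B.weight n πe o.1 ^ 2 * B.rewardVar o.1.1 o.1.2 :=
    (((measurable_weight hn).pow_const 2).mul measurable_rewardVar).comp measurable_fst
  have hmap (p : S → A → ℝ) : ∫ x, B.weight n πe x ^ 2 * B.rewardVar x.1 x.2 ∂(B.saLaw p)
      = ∫ o, B.weight n πe o.1 ^ 2 * B.rewardVar o.1.1 o.1.2 ∂(B.obsLaw p) := by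
    have hm' : Measurable fun x : S × A => B.weight n πe x ^ 2 * B.rewardVar x.1 x.2 :=
      ((measurable_weight hn).pow_const 2).mul measurable_rewardVar
    rw [← B.map_fst_obsLaw p, integral_map measurable_fst.aemeasurable hm'.aestronglyMeasurable]
  have hvar (x : S × A) : |B.rewardVar x.1 x.2| ≤ Rmax ^ 2 := by
    have h := variance_le_sq_of_bounded (μ := B.rewardLaw x) (X := id) (a := 0) (b := Rmax)
      (B.reward_mem x) measurable_id.aemeasurable
    rw [rewardVar, abs_of_nonneg (variance_nonneg _ _)]
    exact h.trans (by nlinarith [sq_nonneg Rmax])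
  have hint : Integrable (fun o : Obs S A => B.weight n πe o.1 ^ 2 * B.rewardVar o.1.1 o.1.2)
      (B.obsLaw (B.mixPolicy n hn).dens) := by
    refine Integrable.of_bound hm.aestronglyMeasurable (C ^ 2 * Rmax ^ 2)
      (Eventually.of_forall fun o => ?_)
    rw [norm_mul, norm_pow, Real.norm_eq_abs, Real.norm_eq_abs]
    exact mul_le_mul (pow_le_pow_left₀ (abs_nonneg _) (hC _) 2) (hvar _) (abs_nonneg _)
      (sq_nonneg _)
  have hV : B.Vstar n πe = (∫ x, B.weight n πe x ^ 2 * B.rewardVar x.1 x.2 ∂(B.saLaw (B.mix n)))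
    + Var[B.v πe; B.stateLaw] := rfl
  rw [hV, hmap, integral_obsLaw_mix hn hint]
  simp_rw [variance_drScore hn hC, hmap, mul_add]
  rw [Finset.sum_add_distrib, Finset.mul_sum, ← Finset.sum_mul, Nat.cast_sum]
  congr 1
  refine Finset.sum_congr rfl fun k _ => ?_
  rw [← Nat.cast_sum]
  field_simp

end Bandit

end Influence

end OPE

namespace OPE

/-! ### Differentiability in quadratic mean -/

section QuadraticMean

variable {α : Type*} [MeasurableSpace α] {μ : Measure α} {p : ℝ → α → ℝ} {g : α → ℝ}

lemma memLp_sqrt_of_lintegral {f : α → ℝ} (hf : Measurable f)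
    (hfin : ∫⁻ x, ENNReal.ofReal (f x) ∂μ ≠ ∞) (h0 : ∀ x, 0 ≤ f x) :
    MemLp (fun x => √(f x)) 2 μ := by
  rw [memLp_two_iff_integrable_sq hf.sqrt.aestronglyMeasurable]
  simp_rw [Real.sq_sqrt (h0 _)]
  exact ⟨hf.aestronglyMeasurable, by
    rwa [hasFiniteIntegral_iff_ofReal (Eventually.of_forall h0), lt_top_iff_ne_top]⟩

lemma integrable_of_lintegral_ofReal {f : α → ℝ} (hf : Measurable f)
    (hfin : ∫⁻ x, ENNReal.ofReal (f x) ∂μ ≠ ∞) (h0 : ∀ x, 0 ≤ f x) : Integrable f μ :=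
  ⟨hf.aestronglyMeasurable, by
    rwa [hasFiniteIntegral_iff_ofReal (Eventually.of_forall h0), lt_top_iff_ne_top]⟩

/-- The Cauchy–Schwarz inequality. -/
lemma sq_integral_mul_le {f h : α → ℝ} (hf : MemLp f 2 μ) (hh : MemLp h 2 μ) :
    (∫ x, f x * h x ∂μ) ^ 2 ≤ (∫ x, f x ^ 2 ∂μ) * ∫ x, h x ^ 2 ∂μ := by
  have hfh : Integrable (fun x => f x * h x) μ := hf.integrable_mul hh
  have key (t : ℝ) : 0 ≤ (∫ x, f x ^ 2 ∂μ) * (t * t) + 2 * (∫ x, f x * h x ∂μ) * t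
      + ∫ x, h x ^ 2 ∂μ := by
    have h1 : ∫ x, (t * f x + h x) ^ 2 ∂μ = (∫ x, f x ^ 2 ∂μ) * (t * t)
        + 2 * (∫ x, f x * h x ∂μ) * t + ∫ x, h x ^ 2 ∂μ := by
      have : (fun x => (t * f x + h x) ^ 2)
          = fun x => ((t * t) * f x ^ 2 + (2 * t) * (f x * h x)) + h x ^ 2 := by
        ext x; ring
      have hi : Integrable (fun x => (t * t) * f x ^ 2 + (2 * t) * (f x * h x)) μ :=
        (hf.integrable_sq.const_mul _).add (hfh.const_mul _)
      rw [this, integral_add hi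
        hh.integrable_sq, integral_add (hf.integrable_sq.const_mul _) (hfh.const_mul _),
        integral_const_mul, integral_const_mul]
      ring
    rw [← h1]
    exact integral_nonneg fun x => sq_nonneg _
  have := discrim_le_zero key
  rw [discrim] at this
  nlinarith

/-- The half-score `g √p₀ / 2` is square integrable, being within an `L²` remainder of a
difference quotient of square roots of densities. -/
lemma HasQMScore.memLp_half (hm : ∀ t, Measurable (p t)) (h0 : ∀ t x, 0 ≤ p t x)
    (hfin : ∀ t, ∫⁻ x, ENNReal.ofReal (p t x) ∂μ ≠ ∞) (hqm : HasQMScore μ p g) :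
    MemLp (fun x => g x * √(p 0 x) / 2) 2 μ := by
  have hs (t : ℝ) := memLp_sqrt_of_lintegral (hm t) (hfin t) (h0 t)
  obtain ⟨t, ht⟩ := (hqm.2.eventually_lt_const ENNReal.zero_lt_top).exists
  have hg := hqm.1
  have hR : MemLp (fun x => (√(p t x) - √(p 0 x)) / t - g x * √(p 0 x) / 2) 2 μ :=
    ⟨(((((hm t).sqrt.sub (hm 0).sqrt).div_const t).sub
      ((hg.mul (hm 0).sqrt).div_const 2))).aestronglyMeasurable, ht⟩
  have hD : MemLp (fun x => (√(p t x) - √(p 0 x)) / t) 2 μ := by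
    simpa [div_eq_mul_inv, mul_comm] using ((hs t).sub (hs 0)).const_mul t⁻¹
  convert! hD.sub hR using 1
  ext x
  simp

/-- A family of densities differentiable in quadratic mean is differentiable in `L¹`. -/
lemma HasQMScore.tendsto_eLpNorm_one (hm : ∀ t, Measurable (p t)) (h0 : ∀ t x, 0 ≤ p t x)
    (hfin : ∀ t, ∫⁻ x, ENNReal.ofReal (p t x) ∂μ ≠ ∞) (hqm : HasQMScore μ p g) :
    Tendsto (fun t : ℝ => eLpNorm (fun x => (p t x - p 0 x) / t - g x * p 0 x) 1 μ)
      (𝓝[≠] 0) (𝓝 0) := by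
  have hs := memLp_sqrt_of_lintegral (hm 0) (hfin 0) (h0 0)
  have hh := hqm.memLp_half hm h0 hfin
  set e : ℝ → α → ℝ := fun t x => (√(p t x) - √(p 0 x)) / t - g x * √(p 0 x) / 2 with he
  set h : α → ℝ := fun x => g x * √(p 0 x) / 2 with hh'
  have hem (t : ℝ) : AEStronglyMeasurable (e t) μ :=
    (((((hm t).sqrt.sub (hm 0).sqrt).div_const t).sub
      ((hqm.1.mul (hm 0).sqrt).div_const 2))).aestronglyMeasurable
  have hE : Tendsto (fun t => eLpNorm (e t) 2 μ) (𝓝[≠] 0) (𝓝 0) := hqm.2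
  set N : ℝ≥0∞ := eLpNorm (fun x => √(p 0 x)) 2 μ
  set H : ℝ≥0∞ := eLpNorm h 2 μ
  have hmul {u v : α → ℝ} (hu : AEStronglyMeasurable u μ) (hv : AEStronglyMeasurable v μ) :
      eLpNorm (fun x => u x * v x) 1 μ ≤ eLpNorm u 2 μ * eLpNorm v 2 μ := by
    have := eLpNorm_le_eLpNorm_mul_eLpNorm_of_nnnorm (p := 2) (q := 2) (r := 1) hu hv
      (fun a b => a * b) 1 (Eventually.of_forall fun x => by simp)
    simpa using this
  have hbound : ∀ᶠ t : ℝ in 𝓝[≠] 0,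
      eLpNorm (fun x => (p t x - p 0 x) / t - g x * p 0 x) 1 μ
        ≤ 2 * (eLpNorm (e t) 2 μ * N)
          + ‖t‖ₑ * ((eLpNorm (e t) 2 μ + H) * (eLpNorm (e t) 2 μ + H)) := by
    filter_upwards [self_mem_nhdsWithin] with t ht
    have ht0 : t ≠ 0 := ht
    -- `(p_t - p_0) / t - g p_0 = 2 e_t √p_0 + t (e_t + h)²`
    have heq : (fun x => (p t x - p 0 x) / t - g x * p 0 x)
        = (fun x => (2 : ℝ) * (e t x * √(p 0 x)))
          + fun x => t * ((e t x + h x) * (e t x + h x)) := by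
      ext x
      have h1 := Real.mul_self_sqrt (h0 t x)
      have h2 := Real.mul_self_sqrt (h0 0 x)
      simp only [Pi.add_apply, he, hh']
      generalize √(p t x) = a at *
      generalize √(p 0 x) = b at *
      rw [← h1, ← h2]
      field_simp
      ring
    rw [heq]
    refine (eLpNorm_add_le ?_ ?_ le_rfl).trans (add_le_add ?_ ?_)
    · exact ((hem t).mul hs.1).const_mul 2
    · exact (((hem t).add hh.1).mul ((hem t).add hh.1)).const_mul t
    · have := eLpNorm_const_smul (2 : ℝ) (fun x => e t x * √(p 0 x)) 1 μ
      rw [show (fun x => (2 : ℝ) * (e t x * √(p 0 x)))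
          = (2 : ℝ) • fun x => e t x * √(p 0 x) from rfl,
        this]
      have h2 : ‖(2 : ℝ)‖ₑ = 2 := by simp [enorm_eq_nnnorm]
      rw [h2]
      gcongr
      exact hmul (hem t) hs.1
    · rw [show (fun x => t * ((e t x + h x) * (e t x + h x)))
        = t • fun x => (e t x + h x) * (e t x + h x) from rfl, eLpNorm_const_smul]
      gcongr
      refine (hmul ((hem t).add hh.1) ((hem t).add hh.1)).trans ?_
      gcongr <;> exact eLpNorm_add_le (hem t) hh.1 (by norm_num)
  refine tendsto_of_tendsto_of_tendsto_of_le_of_le' tendsto_const_nhds ?_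
    (Eventually.of_forall fun _ => zero_le) hbound
  have ht : Tendsto (fun t : ℝ => ‖t‖ₑ) (𝓝[≠] 0) (𝓝 0) := by
    have : Tendsto (fun t : ℝ => ‖t‖ₑ) (𝓝 0) (𝓝 ‖(0 : ℝ)‖ₑ) := continuous_enorm.tendsto 0
    simpa using this.mono_left nhdsWithin_le_nhds
  have hHtop : H ≠ ∞ := hh.2.ne
  have hNtop : N ≠ ∞ := hs.2.ne
  have hEH : Tendsto (fun t => eLpNorm (e t) 2 μ + H) (𝓝[≠] 0) (𝓝 H) := by
    simpa using hE.add_const H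
  have h1 : Tendsto (fun t => 2 * (eLpNorm (e t) 2 μ * N)) (𝓝[≠] 0) (𝓝 (2 * (0 * N))) :=
    ENNReal.Tendsto.const_mul (ENNReal.Tendsto.mul_const hE (Or.inr hNtop)) (by simp)
  have h2 : Tendsto (fun t => (eLpNorm (e t) 2 μ + H) * (eLpNorm (e t) 2 μ + H)) (𝓝[≠] 0)
      (𝓝 (H * H)) := ENNReal.Tendsto.mul hEH (by simp [hHtop]) hEH (by simp [hHtop])
  have h3 : Tendsto (fun t : ℝ => ‖t‖ₑ * ((eLpNorm (e t) 2 μ + H) * (eLpNorm (e t) 2 μ + H)))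
      (𝓝[≠] 0) (𝓝 (0 * (H * H))) :=
    ENNReal.Tendsto.mul ht (by simp [ENNReal.mul_eq_top, hHtop]) h2 (by simp)
  simpa using h1.add h3

/-- The score is square integrable under the distribution at `t = 0`. -/
lemma HasQMScore.memLp_score (hm : ∀ t, Measurable (p t)) (h0 : ∀ t x, 0 ≤ p t x)
    (hfin : ∀ t, ∫⁻ x, ENNReal.ofReal (p t x) ∂μ ≠ ∞) (hqm : HasQMScore μ p g) :
    MemLp g 2 (μ.withDensity fun x => ENNReal.ofReal (p 0 x)) := by
  have h := hqm.memLp_half hm h0 hfin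
  have h' : MemLp (fun x => g x * √(p 0 x)) 2 μ := by
    convert! h.const_mul 2 using 2 with x
    ring
  rw [memLp_two_iff_integrable_sq hqm.1.aestronglyMeasurable,
    integrable_withDensity_ofReal (hm 0) (h0 0)]
  have := h'.integrable_sq
  simp_rw [mul_pow, Real.sq_sqrt (h0 _ _)] at this
  simpa [mul_comm] using this

lemma HasQMScore.integrable_score_mul (hm : ∀ t, Measurable (p t)) (h0 : ∀ t x, 0 ≤ p t x)
    (hfin : ∀ t, ∫⁻ x, ENNReal.ofReal (p t x) ∂μ ≠ ∞) (hqm : HasQMScore μ p g) :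
    Integrable (fun x => g x * p 0 x) μ := by
  have h := hqm.memLp_score hm h0 hfin
  have hf : IsFiniteMeasure (μ.withDensity fun x => ENNReal.ofReal (p 0 x)) :=
    isFiniteMeasure_withDensity (hfin 0)
  have h1 : Integrable g _ := h.integrable (by norm_num)
  rw [integrable_withDensity_ofReal (hm 0) (h0 0)] at h1
  simpa [mul_comm] using h1

/-- Averages of a uniformly bounded family of functions against the `L¹` remainder vanish. -/
lemma HasQMScore.tendsto_integral_sub (hm : ∀ t, Measurable (p t)) (h0 : ∀ t x, 0 ≤ p t x)
    (hfin : ∀ t, ∫⁻ x, ENNReal.ofReal (p t x) ∂μ ≠ ∞) (hqm : HasQMScore μ p g)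
    {φ : ℝ → α → ℝ} {M : ℝ} (hφb : ∀ t x, |φ t x| ≤ M) :
    Tendsto (fun t : ℝ => ∫ x, φ t x * ((p t x - p 0 x) / t - g x * p 0 x) ∂μ)
      (𝓝[≠] 0) (𝓝 0) := by
  have h1 := hqm.tendsto_eLpNorm_one hm h0 hfin
  rw [tendsto_zero_iff_enorm_tendsto_zero]
  have h2 : Tendsto (fun t : ℝ => ENNReal.ofReal M *
      eLpNorm (fun x => (p t x - p 0 x) / t - g x * p 0 x) 1 μ) (𝓝[≠] 0) (𝓝 0) := by
    simpa using ENNReal.Tendsto.const_mul h1 (Or.inr ENNReal.ofReal_ne_top)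
  refine tendsto_of_tendsto_of_tendsto_of_le_of_le tendsto_const_nhds h2
    (fun _ => zero_le) fun t => ?_
  refine (enorm_integral_le_lintegral_enorm _).trans ?_
  rw [eLpNorm_one_eq_lintegral_enorm, ← lintegral_const_mul' _ _ ENNReal.ofReal_ne_top]
  refine lintegral_mono fun x => ?_
  rw [enorm_mul]
  gcongr
  rw [Real.enorm_eq_ofReal_abs]
  exact ENNReal.ofReal_le_ofReal (hφb t x)

/-- Differentiation under the integral sign for a family differentiable in quadratic mean. -/
lemma HasQMScore.hasDerivAt_integral (hm : ∀ t, Measurable (p t)) (h0 : ∀ t x, 0 ≤ p t x)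
    (hfin : ∀ t, ∫⁻ x, ENNReal.ofReal (p t x) ∂μ ≠ ∞) (hqm : HasQMScore μ p g)
    {φ : α → ℝ} (hφ : Measurable φ) {M : ℝ} (hφb : ∀ x, |φ x| ≤ M) :
    HasDerivAt (fun t => ∫ x, φ x * p t x ∂μ) (∫ x, φ x * (g x * p 0 x) ∂μ) 0 := by
  have hint (t : ℝ) : Integrable (fun x => φ x * p t x) μ :=
    (integrable_of_lintegral_ofReal (hm t) (hfin t) (h0 t)).bdd_mul (c := M)
      hφ.aestronglyMeasurable (Eventually.of_forall hφb)
  have hg : Integrable (fun x => φ x * (g x * p 0 x)) μ :=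
    (hqm.integrable_score_mul hm h0 hfin).bdd_mul (c := M)
      hφ.aestronglyMeasurable (Eventually.of_forall hφb)
  rw [hasDerivAt_iff_tendsto_slope]
  have h := hqm.tendsto_integral_sub hm h0 hfin (φ := fun _ => φ) (fun _ => hφb)
  have h' := h.add_const (∫ x, φ x * (g x * p 0 x) ∂μ)
  rw [zero_add] at h'
  refine h'.congr fun t => ?_
  rw [slope_def_field, ← integral_sub (hint t) (hint 0), ← integral_div, ← integral_add _ hg]
  · refine integral_congr_ae (Eventually.of_forall fun x => ?_)
    simp only [sub_zero]
    ring
  · have := (((hint t).sub (hint 0)).div_const t).sub hg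
    refine this.congr (Eventually.of_forall fun x => ?_)
    simp only [Pi.sub_apply]
    ring

/-- If the mean of a bounded function does not depend on the parameter, then that function is
orthogonal to the score. -/
lemma HasQMScore.integral_mul_score_eq_zero (hm : ∀ t, Measurable (p t)) (h0 : ∀ t x, 0 ≤ p t x)
    (hfin : ∀ t, ∫⁻ x, ENNReal.ofReal (p t x) ∂μ ≠ ∞) (hqm : HasQMScore μ p g)
    {φ : α → ℝ} (hφ : Measurable φ) {M : ℝ} (hφb : ∀ x, |φ x| ≤ M) {c : ℝ}
    (hc : ∀ t, ∫ x, φ x ∂(μ.withDensity fun x => ENNReal.ofReal (p t x)) = c) :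
    ∫ x, φ x * g x ∂(μ.withDensity fun x => ENNReal.ofReal (p 0 x)) = 0 := by
  have h1 := hqm.hasDerivAt_integral hm h0 hfin hφ hφb
  have h2 : (fun t => ∫ x, φ x * p t x ∂μ) = fun _ => c := by
    ext t
    rw [← hc t, integral_withDensity_ofReal (hm t) (h0 t)]
    simp_rw [mul_comm]
  rw [h2] at h1
  rw [integral_withDensity_ofReal (hm 0) (h0 0)]
  refine Eq.trans ?_ (h1.unique (hasDerivAt_const 0 c))
  refine integral_congr_ae (Eventually.of_forall fun x => ?_)
  simp only
  ring

lemma HasQMScore.tendsto_integral_abs_sub (hm : ∀ t, Measurable (p t)) (h0 : ∀ t x, 0 ≤ p t x)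
    (hfin : ∀ t, ∫⁻ x, ENNReal.ofReal (p t x) ∂μ ≠ ∞) (hqm : HasQMScore μ p g) :
    Tendsto (fun t : ℝ => ∫ x, |p t x - p 0 x| ∂μ) (𝓝[≠] 0) (𝓝 0) := by
  have hI (t : ℝ) := integrable_of_lintegral_ofReal (hm t) (hfin t) (h0 t)
  have hg := hqm.integrable_score_mul hm h0 hfin
  have h1 := hqm.tendsto_eLpNorm_one hm h0 hfin
  have h2 : Tendsto (fun t : ℝ => ∫ x, ‖(p t x - p 0 x) / t - g x * p 0 x‖ ∂μ)
      (𝓝[≠] 0) (𝓝 0) := by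
    have := (ENNReal.tendsto_toReal ENNReal.zero_ne_top).comp h1
    refine this.congr fun t => ?_
    rw [Function.comp_apply, eLpNorm_one_eq_lintegral_enorm, ← integral_norm_eq_lintegral_enorm]
    exact (((hm t).sub (hm 0)).div_const t |>.sub (hqm.1.mul (hm 0))).aestronglyMeasurable
  have h3 : Tendsto (fun t : ℝ => |t|) (𝓝[≠] 0) (𝓝 0) := by
    have : Tendsto (fun t : ℝ => |t|) (𝓝 0) (𝓝 |(0 : ℝ)|) := continuous_abs.tendsto 0
    simpa using this.mono_left nhdsWithin_le_nhds
  have h4 := h3.mul (h2.add_const (∫ x, |g x * p 0 x| ∂μ))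
  rw [zero_mul] at h4
  refine tendsto_of_tendsto_of_tendsto_of_le_of_le' tendsto_const_nhds h4
    (Eventually.of_forall fun t => integral_nonneg fun x => abs_nonneg _) ?_
  filter_upwards [self_mem_nhdsWithin] with t ht
  have ht0 : t ≠ 0 := ht
  have hd : Integrable (fun x => (p t x - p 0 x) / t - g x * p 0 x) μ :=
    (((hI t).sub (hI 0)).div_const t).sub hg
  rw [← integral_add hd.norm hg.abs, ← integral_const_mul]
  refine integral_mono ((hI t).sub (hI 0)).abs ((hd.norm.add hg.abs).const_mul _) fun x => ?_
  have : p t x - p 0 x = t * ((p t x - p 0 x) / t - g x * p 0 x + g x * p 0 x) := by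
    field_simp; ring
  simp only [Real.norm_eq_abs]
  calc |p t x - p 0 x| = |t| * |(p t x - p 0 x) / t - g x * p 0 x + g x * p 0 x| := by
        rw [← abs_mul, ← this]
    _ ≤ _ := by gcongr; exact abs_add_le _ _

end QuadraticMean

end OPE

namespace OPE

/-! ### Scores of a regular submodel -/

section Scores

variable {S A : Type*} [MeasurableSpace S] [MeasurableSpace A] {ν : Measure A} [SFinite ν]
  {Rmax : ℝ} {K : ℕ} {B : Bandit S A ν Rmax K} {n : Fin K → ℕ} {πe : Policy S A ν}

namespace Submodel

variable (M : Submodel B n πe)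

instance : IsSFiniteKernel M.baseR := M.isSFiniteKernel_baseR

lemma stateLaw_zero : B.stateLaw = M.baseS.withDensity fun s => ENNReal.ofReal (M.densS 0 s) := by
  have h := M.stateLaw_eq 0
  rwa [M.inst_zero] at h

lemma lintegral_densS (t : ℝ) : ∫⁻ s, ENNReal.ofReal (M.densS t s) ∂M.baseS ≠ ∞ := by
  have h := measure_univ (μ := (M.inst t).stateLaw)
  rw [M.stateLaw_eq t, withDensity_apply _ MeasurableSet.univ, Measure.restrict_univ] at h
  simp [h]

lemma memLp_scoreS : MemLp M.scoreS 2 B.stateLaw := by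
  rw [M.stateLaw_zero]
  exact M.qm_S.memLp_score M.measurable_densS M.densS_nonneg M.lintegral_densS

lemma integral_scoreS : ∫ s, M.scoreS s ∂B.stateLaw = 0 := by
  rw [M.stateLaw_zero]
  have h := M.qm_S.integral_mul_score_eq_zero M.measurable_densS M.densS_nonneg M.lintegral_densS
    (φ := fun _ => 1) measurable_const (M := 1) (by simp) (c := 1) fun t => by
      rw [← M.stateLaw_eq t]; simp
  simpa using h

/-- The density of the logging policy of stratum `k` along the submodel. -/
noncomputable def densA (k : Fin K) (t : ℝ) (x : S × A) : ℝ :=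
  ((M.inst t).logging k).dens x.1 x.2

lemma measurable_densA (k : Fin K) (t : ℝ) : Measurable (M.densA k t) :=
  ((M.inst t).logging k).measurable_dens

lemma densA_nonneg (k : Fin K) (t : ℝ) (x : S × A) : 0 ≤ M.densA k t x :=
  ((M.inst t).logging k).dens_nonneg _ _

lemma saLaw_logging (k : Fin K) (t : ℝ) : B.saLaw ((M.inst t).logging k).dens
    = (B.stateLaw.prod ν).withDensity fun x => ENNReal.ofReal (M.densA k t x) :=
  B.saLaw_eq_withDensity ((M.inst t).logging k).measurable_dens

lemma saLaw_logging_zero (k : Fin K) : B.saLaw (B.logging k).dens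
    = (B.stateLaw.prod ν).withDensity fun x => ENNReal.ofReal (M.densA k 0 x) := by
  rw [← M.saLaw_logging k 0, M.inst_zero]

lemma lintegral_densA (k : Fin K) (t : ℝ) :
    ∫⁻ x, ENNReal.ofReal (M.densA k t x) ∂(B.stateLaw.prod ν) ≠ ∞ := by
  have h := measure_univ (μ := B.saLaw ((M.inst t).logging k).dens)
  rw [M.saLaw_logging k t, withDensity_apply _ MeasurableSet.univ, Measure.restrict_univ] at h
  simp [h]

lemma memLp_scoreA (k : Fin K) : MemLp (M.scoreA k) 2 (B.saLaw (B.logging k).dens) := by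
  rw [M.saLaw_logging_zero k]
  exact HasQMScore.memLp_score (M.measurable_densA k) (M.densA_nonneg k) (M.lintegral_densA k)
    (M.qm_A k)

/-- The score of a logging policy is orthogonal to every bounded function of the state. -/
lemma integral_mul_scoreA (k : Fin K) {h : S → ℝ} (hh : Measurable h) {b : ℝ}
    (hb : ∀ s, |h s| ≤ b) : ∫ x, h x.1 * M.scoreA k x ∂(B.saLaw (B.logging k).dens) = 0 := by
  have hm : Measurable fun x : S × A => h x.1 := hh.comp measurable_fst
  have hc (t : ℝ) : ∫ x, h x.1 ∂((B.stateLaw.prod ν).withDensity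
      fun x => ENNReal.ofReal (M.densA k t x)) = ∫ s, h s ∂B.stateLaw := by
    rw [← M.saLaw_logging k t, ← (B.measurePreserving_fst_saLaw ((M.inst t).logging k)).map_eq,
      integral_map measurable_fst.aemeasurable hh.aestronglyMeasurable]
  rw [M.saLaw_logging_zero k]
  exact HasQMScore.integral_mul_score_eq_zero (M.measurable_densA k) (M.densA_nonneg k)
    (M.lintegral_densA k) (M.qm_A k) hm (fun x => hb x.1) hc

/-- The dominating measure of the laws of observations generated by `π_*`. -/
noncomputable def obsBase : Measure (Obs S A) := B.saLaw (B.mix n) ⊗ₘ M.baseR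

/-- The instance in which only the law of rewards moves along the submodel. -/
noncomputable def rewardInst (t : ℝ) : Bandit S A ν Rmax K :=
  { B with
    rewardLaw := (M.inst t).rewardLaw
    isMarkov_rewardLaw := (M.inst t).isMarkov_rewardLaw
    reward_mem := (M.inst t).reward_mem }

lemma obsLaw_rewardInst (t : ℝ) : (M.rewardInst t).obsLaw (B.mix n)
    = M.obsBase.withDensity fun o => ENNReal.ofReal (M.densR t o) :=
  compProd_eq_withDensity (B.saLaw (B.mix n)) M.baseR (M.inst t).rewardLaw
    (M.measurable_densR t).ennreal_ofReal (M.rewardLaw_eq t)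

lemma rewardInst_zero : M.rewardInst 0 = B := by
  have h : ∀ B' : Bandit S A ν Rmax K, B' = B → ({ B with
    rewardLaw := B'.rewardLaw
    isMarkov_rewardLaw := B'.isMarkov_rewardLaw
    reward_mem := B'.reward_mem } : Bandit S A ν Rmax K) = B := by
    rintro _ rfl
    rfl
  exact h _ M.inst_zero

lemma obsLaw_zero : B.obsLaw (B.mix n)
    = M.obsBase.withDensity fun o => ENNReal.ofReal (M.densR 0 o) := by
  have h := M.obsLaw_rewardInst 0
  rwa [M.rewardInst_zero] at h

lemma lintegral_densR (hn : 0 < ∑ k, n k) (t : ℝ) :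
    ∫⁻ o, ENNReal.ofReal (M.densR t o) ∂M.obsBase ≠ ∞ := by
  have h := measure_univ (μ := (M.rewardInst t).obsLaw (B.mixPolicy n hn).dens)
  rw [B.mixPolicy_dens, M.obsLaw_rewardInst t, withDensity_apply _ MeasurableSet.univ,
    Measure.restrict_univ] at h
  simp [h]

lemma memLp_scoreR (hn : 0 < ∑ k, n k) : MemLp M.scoreR 2 (B.obsLaw (B.mix n)) := by
  rw [M.obsLaw_zero]
  exact HasQMScore.memLp_score M.measurable_densR M.densR_nonneg (M.lintegral_densR hn) M.qm_R

lemma memLp_scoreR_logging (hn : 0 < ∑ k, n k) {k : Fin K} (hk : 0 < n k) :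
    MemLp M.scoreR 2 (B.obsLaw (B.logging k).dens) :=
  (M.memLp_scoreR hn).of_measure_le_smul (by simp) (Bandit.obsLaw_logging_le hn hk)

/-- The score of the rewards is orthogonal to every bounded function of state and action. -/
lemma integral_mul_scoreR (hn : 0 < ∑ k, n k) {h : S × A → ℝ} (hh : Measurable h) {b : ℝ}
    (hb : ∀ x, |h x| ≤ b) : ∫ o, h o.1 * M.scoreR o ∂(B.obsLaw (B.mix n)) = 0 := by
  rw [M.obsLaw_zero]
  refine HasQMScore.integral_mul_score_eq_zero M.measurable_densR M.densR_nonneg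
    (M.lintegral_densR hn) M.qm_R (hh.comp measurable_fst) (M := b) (fun x => hb _)
    (c := ∫ x, h x ∂B.saLaw (B.mix n)) fun t => ?_
  rw [← M.obsLaw_rewardInst t]
  have hmp : MeasurePreserving Prod.fst ((M.rewardInst t).obsLaw (B.mix n)) (B.saLaw (B.mix n)) :=
    (M.rewardInst t).measurePreserving_fst_obsLaw (B.mix n)
  rw [← hmp.map_eq, integral_map measurable_fst.aemeasurable hh.aestronglyMeasurable]

lemma integral_mul_scoreR_logging (hn : 0 < ∑ k, n k) {k : Fin K} (hk : 0 < n k)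
    {h : S × A → ℝ} (hh : Measurable h) {b : ℝ} (hb : ∀ x, |h x| ≤ b) :
    ∫ o, h o.1 * M.scoreR o ∂(B.obsLaw (B.logging k).dens) = 0 := by
  have hm := Bandit.measurable_mix (B := B) hn
  rw [Bandit.integral_obsLaw_of_ac hn _ (Bandit.ac_logging hn hk)]
  simp_rw [← mul_assoc]
  refine M.integral_mul_scoreR hn
    (h := fun x => (B.logging k).dens x.1 x.2 / B.mix n x.1 x.2 * h x)
    (((B.logging k).measurable_dens.div hm).mul hh) (b := ((∑ j, n j : ℕ) : ℝ) * b) fun x => ?_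
  rw [abs_mul]
  refine mul_le_mul ?_ (hb x) (abs_nonneg _) (by positivity)
  rw [abs_of_nonneg (div_nonneg ((B.logging k).dens_nonneg _ _) (Bandit.mix_nonneg hn _ _))]
  exact div_le_of_le_mul₀ (Bandit.mix_nonneg hn _ _) (by positivity)
    (Bandit.logging_le_mul_mix hn hk _ _)

end Submodel

end Scores

end OPE

namespace OPE

/-! ### Pathwise derivative of the estimand -/

section Derivative

variable {S A : Type*} [MeasurableSpace S] [MeasurableSpace A] {ν : Measure A} [SFinite ν]
  {Rmax : ℝ} {K : ℕ} {B : Bandit S A ν Rmax K} {n : Fin K → ℕ} {πe : Policy S A ν}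

/-- Averages of `v` as importance-weighted averages of the reward. -/
lemma Bandit.integral_mul_v (hn : 0 < ∑ k, n k) (hov : B.WeakOverlap n πe) {h : S → ℝ}
    (hh : Measurable h) {b : ℝ} (hb : ∀ s, |h s| ≤ b) :
    ∫ s, h s * B.v πe s ∂B.stateLaw
      = ∫ o, B.weight n πe o.1 * (h o.1.1 * o.2) ∂(B.obsLaw (B.mix n)) := by
  have h1 : ∫ o, h o.1.1 * o.2 ∂(B.obsLaw πe.dens)
      = ∫ o, B.weight n πe o.1 * (h o.1.1 * o.2) ∂(B.obsLaw (B.mix n)) :=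
    integral_obsLaw_of_ac hn πe (hov.ae_dens hn) _
  have hint : Integrable (fun o : Obs S A => h o.1.1 * o.2) (B.obsLaw πe.dens) :=
    (B.integrable_reward_obs πe).bdd_mul (c := b)
      (hh.comp (measurable_fst.comp measurable_fst)).aestronglyMeasurable
      (Eventually.of_forall fun o => hb _)
  have h2 : ∫ o, h o.1.1 * o.2 ∂(B.obsLaw πe.dens)
      = ∫ x, h x.1 * B.q x.1 x.2 ∂(B.saLaw πe.dens) := by
    rw [obsLaw] at hint ⊢
    rw [Measure.integral_compProd hint]
    refine integral_congr_ae (Eventually.of_forall fun x => ?_)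
    exact integral_const_mul (h x.1) (fun r : ℝ => r)
  have h3 : ∫ x, h x.1 * B.q x.1 x.2 ∂(B.saLaw πe.dens) = ∫ s, h s * B.v πe s ∂B.stateLaw := by
    rw [B.integral_saLaw πe]
    · refine integral_congr_ae (Eventually.of_forall fun s => ?_)
      exact integral_const_mul (h s) (fun a => B.q s a)
    · refine (B.integrable_saLaw_of_bdd πe B.measurable_uncurry_q (M := Rmax)
        fun x => B.abs_q_le _ _).bdd_mul (c := b) (hh.comp measurable_fst).aestronglyMeasurable
        (Eventually.of_forall fun o => hb _)
  rw [← h1, h2, h3]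

/-- The reward, clipped to `[0, R]`. -/
noncomputable def clipReward (R r : ℝ) : ℝ := max 0 (min r R)

lemma measurable_clipReward (R : ℝ) : Measurable (clipReward R) :=
  measurable_const.max (measurable_id.min measurable_const)

lemma clipReward_of_mem {R r : ℝ} (h : r ∈ Set.Icc 0 R) : clipReward R r = r := by
  rw [clipReward, min_eq_left h.2, max_eq_right h.1]

lemma abs_clipReward_le {R : ℝ} (hR : 0 ≤ R) (r : ℝ) : |clipReward R r| ≤ R := by
  rw [clipReward, abs_of_nonneg (le_max_left _ _)]
  exact max_le hR (min_le_right _ _)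

namespace Submodel

variable (M : Submodel B n πe)

/-- The value function `v` along the submodel. -/
noncomputable def vAt (t : ℝ) : S → ℝ := (M.inst t).v πe

lemma measurable_vAt (t : ℝ) : Measurable (M.vAt t) := (M.inst t).measurable_v πe

lemma abs_vAt_le (t : ℝ) (s : S) : |M.vAt t s| ≤ Rmax := (M.inst t).abs_v_le πe s

lemma vAt_zero : M.vAt 0 = B.v πe := by rw [vAt, M.inst_zero]

lemma integral_mul_vAt (hn : 0 < ∑ k, n k) (hov : B.WeakOverlap n πe) {h : S → ℝ}
    (hh : Measurable h) {b : ℝ} (hb : ∀ s, |h s| ≤ b) (t : ℝ) :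
    ∫ s, h s * M.vAt t s ∂B.stateLaw
      = ∫ o, B.weight n πe o.1 * (h o.1.1 * clipReward Rmax o.2) * M.densR t o ∂M.obsBase := by
  have h1 : ∫ s, h s * M.vAt t s ∂B.stateLaw
      = ∫ o, B.weight n πe o.1 * (h o.1.1 * o.2) ∂((M.rewardInst t).obsLaw (B.mix n)) :=
    Bandit.integral_mul_v (B := M.rewardInst t) hn hov hh hb
  have h2 : ∀ᵐ o ∂((M.rewardInst t).obsLaw (B.mix n)), o.2 ∈ Set.Icc 0 Rmax :=
    (M.rewardInst t).ae_reward_mem _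
  have h3 : ∫ o, B.weight n πe o.1 * (h o.1.1 * o.2) ∂((M.rewardInst t).obsLaw (B.mix n))
      = ∫ o, B.weight n πe o.1 * (h o.1.1 * clipReward Rmax o.2)
        ∂((M.rewardInst t).obsLaw (B.mix n)) := by
    refine integral_congr_ae ?_
    filter_upwards [h2] with o ho
    rw [clipReward_of_mem ho]
  rw [h1, h3, M.obsLaw_rewardInst, integral_withDensity_ofReal (M.measurable_densR t)
    (M.densR_nonneg t)]
  simp_rw [mul_comm]

variable {M}

lemma tendsto_integral_abs_vAt_sub (M : Submodel B n πe) (hn : 0 < ∑ k, n k)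
    (hov : B.WeakOverlap n πe) {C : ℝ}
    (hC : ∀ x, |B.weight n πe x| ≤ C) :
    Tendsto (fun t => ∫ s, |M.vAt t s - M.vAt 0 s| ∂B.stateLaw) (𝓝[≠] 0) (𝓝 0) := by
  have hR : 0 ≤ Rmax := B.nonneg_of_policy πe
  have hC0 : 0 ≤ C := by
    obtain ⟨o, -⟩ := (B.ae_reward_mem πe.dens).exists
    exact (abs_nonneg _).trans (hC o.1)
  have h1 := HasQMScore.tendsto_integral_abs_sub M.measurable_densR M.densR_nonneg
    (M.lintegral_densR hn) M.qm_R
  have h2 := h1.const_mul (C * Rmax)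
  rw [mul_zero] at h2
  refine tendsto_of_tendsto_of_tendsto_of_le_of_le tendsto_const_nhds h2
    (fun t => integral_nonneg fun _ => abs_nonneg _) fun t => ?_
  -- test the difference against its sign
  set h : S → ℝ := fun s => SignType.sign (M.vAt t s - M.vAt 0 s) with hh
  have hhm : Measurable h := by
    have : Measurable fun x : ℝ => ((SignType.sign x : SignType) : ℝ) := by
      have : (fun x : ℝ => ((SignType.sign x : SignType) : ℝ))
          = fun x => if 0 < x then 1 else if x < 0 then -1 else 0 := by
        ext x
        rw [sign_apply]
        split_ifs <;> simp
      rw [this]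
      exact Measurable.ite measurableSet_Ioi measurable_const
        (Measurable.ite measurableSet_Iio measurable_const measurable_const)
    exact this.comp ((M.measurable_vAt t).sub (M.measurable_vAt 0))
  have hhb (s : S) : |h s| ≤ 1 := by
    rcases lt_trichotomy (M.vAt t s - M.vAt 0 s) 0 with h' | h' | h' <;> simp [h, h']
  have hvi (t : ℝ) : Integrable (fun s => h s * M.vAt t s) B.stateLaw := by
    refine Integrable.of_bound (hhm.mul (M.measurable_vAt t)).aestronglyMeasurable (1 * Rmax)
      (Eventually.of_forall fun s => ?_)
    rw [norm_mul]
    exact mul_le_mul (hhb s) (M.abs_vAt_le t s) (norm_nonneg _) zero_le_one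
  have hdi (t : ℝ) : Integrable (M.densR t) M.obsBase :=
    integrable_of_lintegral_ofReal (M.measurable_densR t) (M.lintegral_densR hn t)
      (M.densR_nonneg t)
  set φ : Obs S A → ℝ := fun o => B.weight n πe o.1 * (h o.1.1 * clipReward Rmax o.2) with hφ
  have hφm : Measurable φ := ((Bandit.measurable_weight hn).comp measurable_fst).mul
    ((hhm.comp (measurable_fst.comp measurable_fst)).mul
      ((measurable_clipReward Rmax).comp measurable_snd))
  have hφb (o : Obs S A) : |φ o| ≤ C * Rmax := by
    rw [hφ, abs_mul, abs_mul]
    refine mul_le_mul (hC _) ?_ (by positivity) hC0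
    simpa using mul_le_mul (hhb o.1.1) (abs_clipReward_le hR o.2) (abs_nonneg _) zero_le_one
  have hφi (t : ℝ) : Integrable (fun o => φ o * M.densR t o) M.obsBase :=
    (hdi t).bdd_mul (c := C * Rmax) hφm.aestronglyMeasurable (Eventually.of_forall hφb)
  calc ∫ s, |M.vAt t s - M.vAt 0 s| ∂B.stateLaw
      = ∫ s, (h s * M.vAt t s - h s * M.vAt 0 s) ∂B.stateLaw := by
        refine integral_congr_ae (Eventually.of_forall fun s => ?_)
        simp only [h]
        rw [← mul_sub, sign_mul_self]
    _ = ∫ o, (φ o * M.densR t o - φ o * M.densR 0 o) ∂M.obsBase := by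
        rw [integral_sub (hvi t) (hvi 0), M.integral_mul_vAt hn hov hhm hhb,
          M.integral_mul_vAt hn hov hhm hhb, integral_sub (hφi t) (hφi 0)]
    _ ≤ ∫ o, C * Rmax * |M.densR t o - M.densR 0 o| ∂M.obsBase := by
        refine integral_mono ((hφi t).sub (hφi 0)) (((hdi t).sub (hdi 0)).abs.const_mul _)
          fun o => ?_
        simp only
        rw [← mul_sub]
        refine (le_abs_self _).trans ?_
        rw [abs_mul]
        gcongr
        exact hφb o
    _ = C * Rmax * ∫ o, |M.densR t o - M.densR 0 o| ∂M.obsBase := integral_const_mul _ _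

lemma tendsto_integral_vAt_mul_score (M : Submodel B n πe) (hn : 0 < ∑ k, n k)
    (hov : B.WeakOverlap n πe) {C : ℝ} (hC : ∀ x, |B.weight n πe x| ≤ C) :
    Tendsto (fun t => ∫ s, M.vAt t s * M.scoreS s ∂B.stateLaw) (𝓝[≠] 0)
      (𝓝 (∫ s, M.vAt 0 s * M.scoreS s ∂B.stateLaw)) := by
  have hS := M.memLp_scoreS
  have hv2 (t : ℝ) : MemLp (M.vAt t) 2 B.stateLaw :=
    MemLp.of_bound (M.measurable_vAt t).aestronglyMeasurable Rmax
      (Eventually.of_forall (M.abs_vAt_le t))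
  have hd (t : ℝ) : MemLp (fun s => M.vAt t s - M.vAt 0 s) 2 B.stateLaw := (hv2 t).sub (hv2 0)
  rw [tendsto_iff_norm_sub_tendsto_zero]
  have h1 := M.tendsto_integral_abs_vAt_sub hn hov hC
  have h2 : Tendsto (fun t => √((2 * Rmax * ∫ s, |M.vAt t s - M.vAt 0 s| ∂B.stateLaw)
      * ∫ s, M.scoreS s ^ 2 ∂B.stateLaw)) (𝓝[≠] 0) (𝓝 0) := by
    have := ((h1.const_mul (2 * Rmax)).mul_const (∫ s, M.scoreS s ^ 2 ∂B.stateLaw)).sqrt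
    simpa using this
  refine tendsto_of_tendsto_of_tendsto_of_le_of_le tendsto_const_nhds h2
    (fun t => norm_nonneg _) fun t => ?_
  have h3 : ∫ s, M.vAt t s * M.scoreS s ∂B.stateLaw - ∫ s, M.vAt 0 s * M.scoreS s ∂B.stateLaw
      = ∫ s, (M.vAt t s - M.vAt 0 s) * M.scoreS s ∂B.stateLaw := by
    have hi (t : ℝ) : Integrable (fun s => M.vAt t s * M.scoreS s) B.stateLaw :=
      (hv2 t).integrable_mul hS
    rw [← integral_sub (hi t) (hi 0)]
    refine integral_congr_ae (Eventually.of_forall fun s => ?_)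
    simp only
    ring
  rw [h3, Real.norm_eq_abs, ← Real.sqrt_sq_eq_abs]
  refine Real.sqrt_le_sqrt ((sq_integral_mul_le (hd t) hS).trans ?_)
  refine mul_le_mul_of_nonneg_right ?_ (integral_nonneg fun _ => sq_nonneg _)
  rw [← integral_const_mul]
  refine integral_mono (hd t).integrable_sq
    (((hd t).integrable (by norm_num)).abs.const_mul _) fun s => ?_
  simp only
  rw [← sq_abs, sq]
  refine mul_le_mul_of_nonneg_right ?_ (abs_nonneg _)
  calc |M.vAt t s - M.vAt 0 s| ≤ |M.vAt t s| + |M.vAt 0 s| := abs_sub _ _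
    _ ≤ 2 * Rmax := by linarith [M.abs_vAt_le t s, M.abs_vAt_le 0 s]

/-- The estimand is differentiable along every regular submodel. -/
lemma hasDerivAt_value (M : Submodel B n πe) (hn : 0 < ∑ k, n k)
    (hov : B.WeakOverlap n πe) {C : ℝ} (hC : ∀ x, |B.weight n πe x| ≤ C) :
    HasDerivAt (fun t => (M.inst t).value πe)
      (∫ s, B.v πe s * M.scoreS s ∂B.stateLaw
        + ∫ o, B.weight n πe o.1 * o.2 * M.scoreR o ∂(B.obsLaw (B.mix n))) 0 := by
  have hR : 0 ≤ Rmax := B.nonneg_of_policy πe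
  have hC0 : 0 ≤ C := by
    obtain ⟨o, -⟩ := (B.ae_reward_mem πe.dens).exists
    exact (abs_nonneg _).trans (hC o.1)
  -- the part of the derivative due to the rewards
  set F : ℝ → ℝ := fun t => ∫ s, M.vAt t s ∂B.stateLaw with hF
  set φ : Obs S A → ℝ := fun o => B.weight n πe o.1 * clipReward Rmax o.2 with hφ
  have hφm : Measurable φ := ((Bandit.measurable_weight hn).comp measurable_fst).mul
    ((measurable_clipReward Rmax).comp measurable_snd)
  have hφb (o : Obs S A) : |φ o| ≤ C * Rmax := by
    rw [hφ, abs_mul]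
    exact mul_le_mul (hC _) (abs_clipReward_le hR o.2) (abs_nonneg _) hC0
  have hF' : F = fun t => ∫ o, φ o * M.densR t o ∂M.obsBase := by
    ext t
    have := M.integral_mul_vAt hn hov (h := fun _ => 1) measurable_const (b := 1) (by simp) t
    simpa [hF, hφ] using this
  have hFd : HasDerivAt F (∫ o, B.weight n πe o.1 * o.2 * M.scoreR o ∂(B.obsLaw (B.mix n))) 0 := by
    rw [hF']
    have h1 := HasQMScore.hasDerivAt_integral M.measurable_densR M.densR_nonneg
      (M.lintegral_densR hn) M.qm_R hφm hφb
    convert! h1 using 1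
    have h2 : ∫ o, B.weight n πe o.1 * o.2 * M.scoreR o ∂(B.obsLaw (B.mix n))
        = ∫ o, φ o * M.scoreR o ∂(B.obsLaw (B.mix n)) := by
      refine integral_congr_ae ?_
      filter_upwards [B.ae_reward_mem (B.mix n)] with o ho
      rw [hφ]
      simp only [clipReward_of_mem ho]
    rw [h2, M.obsLaw_zero, integral_withDensity_ofReal (M.measurable_densR 0) (M.densR_nonneg 0)]
    refine integral_congr_ae (Eventually.of_forall fun x => ?_)
    simp only
    ring
  -- the part due to the states
  have hS1 := HasQMScore.tendsto_integral_sub M.measurable_densS M.densS_nonneg M.lintegral_densS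
    M.qm_S (φ := M.vAt) M.abs_vAt_le
  have hS2 := M.tendsto_integral_vAt_mul_score hn hov hC
  rw [hasDerivAt_iff_tendsto_slope] at hFd ⊢
  have hsum := (hS1.add hS2).add hFd
  rw [zero_add, M.vAt_zero] at hsum
  refine hsum.congr fun t => ?_
  have hpi (t : ℝ) : Integrable (M.densS t) M.baseS :=
    integrable_of_lintegral_ofReal (M.measurable_densS t) (M.lintegral_densS t) (M.densS_nonneg t)
  have hgi : Integrable (fun s => M.scoreS s * M.densS 0 s) M.baseS :=
    HasQMScore.integrable_score_mul M.measurable_densS M.densS_nonneg M.lintegral_densS M.qm_S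
  have hvp (t u : ℝ) : Integrable (fun s => M.vAt t s * M.densS u s) M.baseS :=
    (hpi u).bdd_mul (c := Rmax) (M.measurable_vAt t).aestronglyMeasurable
      (Eventually.of_forall (M.abs_vAt_le t))
  have hvg : Integrable (fun s => M.vAt t s * (M.scoreS s * M.densS 0 s)) M.baseS :=
    hgi.bdd_mul (c := Rmax) (M.measurable_vAt t).aestronglyMeasurable
      (Eventually.of_forall (M.abs_vAt_le t))
  have hJ (t : ℝ) : (M.inst t).value πe = ∫ s, M.vAt t s * M.densS t s ∂M.baseS := by
    rw [(M.inst t).value_eq_integral_v πe, M.stateLaw_eq t,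
      integral_withDensity_ofReal (M.measurable_densS t) (M.densS_nonneg t)]
    simp_rw [mul_comm]
    rfl
  have hFt (t : ℝ) : F t = ∫ s, M.vAt t s * M.densS 0 s ∂M.baseS := by
    rw [hF]
    simp only
    rw [M.stateLaw_zero, integral_withDensity_ofReal (M.measurable_densS 0) (M.densS_nonneg 0)]
    simp_rw [mul_comm]
  have hg : ∫ s, M.vAt t s * M.scoreS s ∂B.stateLaw
      = ∫ s, M.vAt t s * (M.scoreS s * M.densS 0 s) ∂M.baseS := by
    rw [M.stateLaw_zero, integral_withDensity_ofReal (M.measurable_densS 0) (M.densS_nonneg 0)]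
    refine integral_congr_ae (Eventually.of_forall fun x => ?_)
    simp only
    ring
  have hd : ∫ s, M.vAt t s * ((M.densS t s - M.densS 0 s) / t - M.scoreS s * M.densS 0 s) ∂M.baseS
      = (∫ s, M.vAt t s * M.densS t s ∂M.baseS - ∫ s, M.vAt t s * M.densS 0 s ∂M.baseS) / t
        - ∫ s, M.vAt t s * (M.scoreS s * M.densS 0 s) ∂M.baseS := by
    have hi : Integrable (fun s => (M.vAt t s * M.densS t s - M.vAt t s * M.densS 0 s) / t)
      M.baseS := ((hvp t t).sub (hvp t 0)).div_const t
    rw [← integral_sub (hvp t t) (hvp t 0), ← integral_div, ← integral_sub hi hvg]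
    refine integral_congr_ae (Eventually.of_forall fun x => ?_)
    simp only
    ring
  rw [slope_def_field, slope_def_field, hJ t, hJ 0, hFt t, hFt 0, hg, hd]
  ring

end Submodel

end Derivative

end OPE

namespace OPE

/-! ### The efficient influence function of a stratified data set -/

section Gradient

/-- The mixed second moment of two sums of functions of independent variables, when the terms of
the second sum are centred. -/
lemma integral_sum_mul_sum_pi {ι E : Type*} [Fintype ι] [MeasurableSpace E] {μ : ι → Measure E}
    [∀ i, IsProbabilityMeasure (μ i)] {f g : ι → E → ℝ} (hf : ∀ i, MemLp (f i) 2 (μ i))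
    (hg : ∀ i, MemLp (g i) 2 (μ i)) (hg0 : ∀ i, ∫ x, g i x ∂(μ i) = 0) :
    ∫ x, (∑ i, f i (x i)) * (∑ j, g j (x j)) ∂(Measure.pi μ) = ∑ i, ∫ x, f i x * g i x ∂(μ i) := by
  classical
  have hf' (i : ι) : MemLp (fun x : ι → E => f i (x i)) 2 (Measure.pi μ) :=
    (hf i).comp_measurePreserving (measurePreserving_eval μ i)
  have hg' (i : ι) : MemLp (fun x : ι → E => g i (x i)) 2 (Measure.pi μ) :=
    (hg i).comp_measurePreserving (measurePreserving_eval μ i)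
  have hint (i j : ι) : Integrable (fun x : ι → E => f i (x i) * g j (x j)) (Measure.pi μ) :=
    (hf' i).integrable_mul (hg' j)
  have heval (i : ι) {h : E → ℝ} (hh : AEStronglyMeasurable h (μ i)) :
      ∫ x, h (x i) ∂(Measure.pi μ) = ∫ y, h y ∂(μ i) := by
    have hmp := measurePreserving_eval μ i
    rw [← hmp.map_eq] at hh ⊢
    exact (integral_map hmp.measurable.aemeasurable hh).symm
  have hoff (i j : ι) (hij : i ≠ j) : ∫ x, f i (x i) * g j (x j) ∂(Measure.pi μ) = 0 := by
    have hi : iIndepFun (fun i (x : ι → E) => x i) (Measure.pi μ) :=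
      iIndepFun_pi (X := fun _ => id) fun i => aemeasurable_id
    have hF : AEMeasurable (f i) (Measure.map (fun x : ι → E => x i) (Measure.pi μ)) := by
      rw [(measurePreserving_eval μ i).map_eq]; exact (hf i).aemeasurable
    have hG : AEMeasurable (g j) (Measure.map (fun x : ι → E => x j) (Measure.pi μ)) := by
      rw [(measurePreserving_eval μ j).map_eq]; exact (hg j).aemeasurable
    have := ((hi.indepFun hij).comp₀ (measurable_pi_apply i).aemeasurable
      (measurable_pi_apply j).aemeasurable hF hG).integral_fun_mul_eq_mul_integral
      (hf' i).1 (hg' j).1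
    simp only [Function.comp_def] at this
    rw [this, heval j (hg j).1, hg0 j, mul_zero]
  simp_rw [Finset.sum_mul_sum]
  rw [integral_finsetSum _ fun i _ => integrable_finsetSum _ fun j _ => hint i j]
  refine Finset.sum_congr rfl fun i _ => ?_
  rw [integral_finsetSum _ fun j _ => hint i j, Finset.sum_eq_single i]
  · exact heval i ((hf i).1.mul (hg i).1)
  · exact fun j _ hj => hoff i j hj.symm
  · simp

variable {S A : Type*} [MeasurableSpace S] [MeasurableSpace A] {ν : Measure A} [SFinite ν]
  {Rmax : ℝ} {K : ℕ} {B : Bandit S A ν Rmax K} {n : Fin K → ℕ} {πe : Policy S A ν}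

lemma sum_idx_eq {N : Fin K → ℕ} (c : Fin K → ℝ) :
    ∑ p : Idx N, c p.1 = ∑ k, (N k : ℝ) * c k := by
  rw [Fintype.sum_sigma]
  simp

lemma idx_pos {N : Fin K → ℕ} (p : Idx N) : 0 < N p.1 := p.2.pos

lemma Bandit.measurePreserving_eval_dataLaw (B : Bandit S A ν Rmax K) {N : Fin K → ℕ}
    (p : Idx N) : MeasurePreserving (fun x : Dataset S A N => x p) (B.dataLaw N)
      (B.obsLaw (B.logging p.1).dens) :=
  measurePreserving_eval (fun p : Idx N => B.obsLaw (B.logging p.1).dens) p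

/-- The (uncentred) efficient influence function of a stratified data set: the average over the
observations of the influence function of one observation. -/
noncomputable def Bandit.effScore (B : Bandit S A ν Rmax K) (n : Fin K → ℕ) (πe : Policy S A ν)
    (x : Dataset S A n) : ℝ :=
  ((∑ k, n k : ℕ) : ℝ)⁻¹ * ∑ p, B.drScore n πe (x p)

lemma Bandit.memLp_effScore (hn : 0 < ∑ k, n k) {C : ℝ} (hC : ∀ x, |B.weight n πe x| ≤ C) :
    MemLp (B.effScore n πe) 2 (B.dataLaw n) := by
  have h (p : Idx n) : MemLp (fun x : Dataset S A n => B.drScore n πe (x p)) 2 (B.dataLaw n) :=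
    (memLp_drScore hn hC (B.logging p.1) 2).comp_measurePreserving
      (B.measurePreserving_eval_dataLaw p)
  exact (memLp_finsetSum Finset.univ fun p _ => h p).const_mul _

lemma Bandit.integral_effScore (hn : 0 < ∑ k, n k) {C : ℝ} (hC : ∀ x, |B.weight n πe x| ≤ C) :
    ∫ x, B.effScore n πe x ∂(B.dataLaw n) = B.value πe := by
  have hN : ((∑ k, n k : ℕ) : ℝ) ≠ 0 := by exact_mod_cast hn.ne'
  have hmp (p : Idx n) := B.measurePreserving_eval_dataLaw p
  have hi (p : Idx n) : Integrable (fun x : Dataset S A n => B.drScore n πe (x p))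
      (B.dataLaw n) :=
    (hmp p).integrable_comp_of_integrable ((memLp_drScore hn hC (B.logging p.1) 2).integrable
      (by norm_num))
  unfold effScore
  rw [integral_const_mul, integral_finsetSum _ fun p _ => hi p]
  have h (p : Idx n) : ∫ x, B.drScore n πe (x p) ∂(B.dataLaw n) = B.value πe := by
    rw [← integral_drScore hn hC (B.logging p.1), ← (hmp p).map_eq,
      integral_map (hmp p).measurable.aemeasurable (measurable_drScore hn).aestronglyMeasurable]
  simp_rw [h]
  rw [sum_idx_eq (fun _ => B.value πe), ← Finset.sum_mul, ← Nat.cast_sum, inv_mul_cancel_left₀ hN]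

/-- `n` times the variance of the efficient influence function is `V*`. -/
lemma Bandit.variance_effScore (hn : 0 < ∑ k, n k) {C : ℝ} (hC : ∀ x, |B.weight n πe x| ≤ C) :
    ((∑ k, n k : ℕ) : ℝ) * Var[B.effScore n πe; B.dataLaw n] = B.Vstar n πe := by
  have hN : ((∑ k, n k : ℕ) : ℝ) ≠ 0 := by exact_mod_cast hn.ne'
  have h1 : Var[fun x => ∑ p, B.drScore n πe (x p); B.dataLaw n]
      = ((∑ k, n k : ℕ) : ℝ) * B.Vstar n πe := by
    have := variance_sum_pi (μ := fun p : Idx n => B.obsLaw (B.logging p.1).dens)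
      (X := fun _ => B.drScore n πe) fun p => memLp_drScore hn hC (B.logging p.1) 2
    rw [← sum_variance_drScore hn hC,
      ← sum_idx_eq (fun k => Var[B.drScore n πe; B.obsLaw (B.logging k).dens]), ← this]
    congr 1
    ext x
    simp
  unfold effScore
  rw [variance_const_mul, h1]
  field_simp

namespace Submodel

variable (M : Submodel B n πe)

/-- The score of one observation of stratum `k`. -/
noncomputable def obsScore (k : Fin K) (o : Obs S A) : ℝ :=
  M.scoreS o.1.1 + M.scoreA k o.1 + M.scoreR o

lemma memLp_scoreS_obs (π : Policy S A ν) :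
    MemLp (fun o : Obs S A => M.scoreS o.1.1) 2 (B.obsLaw π.dens) :=
  M.memLp_scoreS.comp_measurePreserving (B.measurePreserving_state π)

lemma memLp_scoreA_obs (k : Fin K) :
    MemLp (fun o : Obs S A => M.scoreA k o.1) 2 (B.obsLaw (B.logging k).dens) :=
  (M.memLp_scoreA k).comp_measurePreserving (B.measurePreserving_fst_obsLaw _)

lemma memLp_obsScore (hn : 0 < ∑ k, n k) {k : Fin K} (hk : 0 < n k) :
    MemLp (M.obsScore k) 2 (B.obsLaw (B.logging k).dens) :=
  ((M.memLp_scoreS_obs _).add (M.memLp_scoreA_obs k)).add (M.memLp_scoreR_logging hn hk)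

lemma integral_mul_scoreA_obs (k : Fin K) {h : S → ℝ} (hh : Measurable h) {b : ℝ}
    (hb : ∀ s, |h s| ≤ b) :
    ∫ o, h o.1.1 * M.scoreA k o.1 ∂(B.obsLaw (B.logging k).dens) = 0 := by
  rw [← M.integral_mul_scoreA k hh hb, ← B.map_fst_obsLaw, integral_map measurable_fst.aemeasurable]
  exact ((hh.comp measurable_fst).mul (M.qm_A k).1).aestronglyMeasurable

/-- The product of the influence function with the score, within one stratum. -/
lemma integral_drScore_mul_obsScore (hn : 0 < ∑ k, n k) {C : ℝ}
    (hC : ∀ x, |B.weight n πe x| ≤ C) {k : Fin K} (hk : 0 < n k) :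
    ∫ o, B.drScore n πe o * M.obsScore k o ∂(B.obsLaw (B.logging k).dens)
      = ∫ s, B.v πe s * M.scoreS s ∂B.stateLaw
        + ∫ o, B.weight n πe o.1 * (o.2 - B.q o.1.1 o.1.2) * M.scoreR o
          ∂(B.obsLaw (B.logging k).dens) := by
  set π := B.logging k with hπ
  have hS := M.memLp_scoreS_obs π
  have hA := M.memLp_scoreA_obs k
  have hR := M.memLp_scoreR_logging hn hk
  have hvm : Measurable fun o : Obs S A => B.v πe o.1.1 :=
    (B.measurable_v πe).comp (measurable_fst.comp measurable_fst)
  have hv2 : MemLp (fun o : Obs S A => B.v πe o.1.1) 2 (B.obsLaw π.dens) :=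
    MemLp.of_bound hvm.aestronglyMeasurable Rmax (Eventually.of_forall fun _ => B.abs_v_le πe _)
  have hUm : Measurable fun o : Obs S A => B.weight n πe o.1 * (o.2 - B.q o.1.1 o.1.2) :=
    ((Bandit.measurable_weight hn).comp measurable_fst).mul B.measurable_reward_sub
  have hU2 : MemLp (fun o : Obs S A => B.weight n πe o.1 * (o.2 - B.q o.1.1 o.1.2)) 2
      (B.obsLaw π.dens) := by
    have := (Bandit.memLp_drScore (B := B) hn hC π 2).sub hv2
    convert! this using 1
    ext o
    simp [Bandit.drScore]
  -- the centred reward does not see the scores of the states and of the actions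
  have h1 : ∫ o, B.weight n πe o.1 * (o.2 - B.q o.1.1 o.1.2) * (M.scoreS o.1.1 + M.scoreA k o.1)
      ∂(B.obsLaw π.dens) = 0 := by
    have hF : Integrable (fun x : S × A => B.weight n πe x * (M.scoreS x.1 + M.scoreA k x))
        (B.saLaw π.dens) := by
      refine Integrable.bdd_mul (c := C) ?_ (Bandit.measurable_weight hn).aestronglyMeasurable
        (Eventually.of_forall hC)
      exact ((M.memLp_scoreS.comp_measurePreserving (B.measurePreserving_fst_saLaw π)).add
        (M.memLp_scoreA k)).integrable (by norm_num)
    rw [← B.integral_mul_reward_sub π hF]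
    refine integral_congr_ae (Eventually.of_forall fun o => ?_)
    simp only
    ring
  have h2 : ∫ o, B.v πe o.1.1 * M.scoreS o.1.1 ∂(B.obsLaw π.dens)
      = ∫ s, B.v πe s * M.scoreS s ∂B.stateLaw :=
    Bandit.integral_state π ((B.measurable_v πe).mul M.qm_S.1)
  have h3 : ∫ o, B.v πe o.1.1 * M.scoreA k o.1 ∂(B.obsLaw π.dens) = 0 :=
    M.integral_mul_scoreA_obs k (B.measurable_v πe) (B.abs_v_le πe)
  have h4 : ∫ o, B.v πe o.1.1 * M.scoreR o ∂(B.obsLaw π.dens) = 0 :=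
    M.integral_mul_scoreR_logging hn hk (h := fun x => B.v πe x.1)
      ((B.measurable_v πe).comp measurable_fst) fun x => B.abs_v_le πe x.1
  have i1 : Integrable (fun o : Obs S A => B.weight n πe o.1 * (o.2 - B.q o.1.1 o.1.2)
      * (M.scoreS o.1.1 + M.scoreA k o.1)) (B.obsLaw π.dens) := hU2.integrable_mul (hS.add hA)
  have i2 : Integrable (fun o : Obs S A => B.weight n πe o.1 * (o.2 - B.q o.1.1 o.1.2)
      * M.scoreR o) (B.obsLaw π.dens) := hU2.integrable_mul hR
  have i3 : Integrable (fun o : Obs S A => B.v πe o.1.1 * M.scoreS o.1.1) (B.obsLaw π.dens) :=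
    hv2.integrable_mul hS
  have i4 : Integrable (fun o : Obs S A => B.v πe o.1.1 * M.scoreA k o.1) (B.obsLaw π.dens) :=
    hv2.integrable_mul hA
  have i5 : Integrable (fun o : Obs S A => B.v πe o.1.1 * M.scoreR o) (B.obsLaw π.dens) :=
    hv2.integrable_mul hR
  have hsplit : (fun o => B.drScore n πe o * M.obsScore k o)
      = fun o => (((B.weight n πe o.1 * (o.2 - B.q o.1.1 o.1.2)
          * (M.scoreS o.1.1 + M.scoreA k o.1)
        + B.weight n πe o.1 * (o.2 - B.q o.1.1 o.1.2) * M.scoreR o)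
        + B.v πe o.1.1 * M.scoreS o.1.1) + B.v πe o.1.1 * M.scoreA k o.1)
        + B.v πe o.1.1 * M.scoreR o := by
    ext o
    simp only [Bandit.drScore, obsScore]
    ring
  rw [hsplit, integral_add _ i5, integral_add _ i4, integral_add _ i3, integral_add i1 i2,
    h1, h2, h3, h4]
  · ring
  · exact i1.add i2
  · exact (i1.add i2).add i3
  · exact ((i1.add i2).add i3).add i4

lemma integral_obsScore (hn : 0 < ∑ k, n k) {k : Fin K} (hk : 0 < n k) :
    ∫ o, M.obsScore k o ∂(B.obsLaw (B.logging k).dens) = 0 := by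
  have hS := (M.memLp_scoreS_obs (B.logging k)).integrable (by norm_num)
  have hA := (M.memLp_scoreA_obs k).integrable (by norm_num)
  have hR := (M.memLp_scoreR_logging hn hk).integrable (by norm_num)
  unfold obsScore
  rw [integral_add (by exact hS.add hA) hR, integral_add hS hA]
  have h2 := Bandit.integral_state (B := B) (B.logging k) M.qm_S.1
  have h3 := M.integral_mul_scoreA_obs k (h := fun _ => 1) measurable_const (b := 1) (by simp)
  have h4 := M.integral_mul_scoreR_logging hn hk (h := fun _ => 1) measurable_const (b := 1)
    (by simp)
  simp only [one_mul] at h3 h4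
  rw [h2, h3, h4, M.integral_scoreS]
  simp

end Submodel

/-- The efficient influence function is a gradient of the estimand. -/
lemma Bandit.isGradient_effScore (hn : 0 < ∑ k, n k) (hov : B.WeakOverlap n πe) {C : ℝ}
    (hC : ∀ x, |B.weight n πe x| ≤ C) : IsGradient B n πe (B.effScore n πe) := by
  refine ⟨memLp_effScore hn hC, fun M => ?_⟩
  have hN : ((∑ k, n k : ℕ) : ℝ) ≠ 0 := by exact_mod_cast hn.ne'
  convert! M.hasDerivAt_value hn hov hC using 1
  have h1 : ∫ x, (∑ p, B.drScore n πe (x p)) * M.score x ∂(B.dataLaw n)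
      = ∑ p : Idx n, ∫ o, B.drScore n πe o * M.obsScore p.1 o ∂(B.obsLaw (B.logging p.1).dens) :=
    integral_sum_mul_sum_pi (f := fun _ => B.drScore n πe) (g := fun p : Idx n => M.obsScore p.1)
      (fun p => memLp_drScore hn hC _ 2) (fun p => M.memLp_obsScore hn (idx_pos p))
      fun p => M.integral_obsScore hn (idx_pos p)
  have h2 : ∫ x, B.effScore n πe x * M.score x ∂(B.dataLaw n)
      = ((∑ k, n k : ℕ) : ℝ)⁻¹ * ∫ x, (∑ p, B.drScore n πe (x p)) * M.score x ∂(B.dataLaw n) := by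
    rw [← integral_const_mul]
    refine integral_congr_ae (Eventually.of_forall fun x => ?_)
    simp only [effScore]
    ring
  -- the reward term, averaged over the strata
  have hwm : Measurable fun o : Obs S A => B.weight n πe o.1 :=
    (measurable_weight hn).comp measurable_fst
  have hR : MemLp M.scoreR 2 (B.obsLaw (B.mixPolicy n hn).dens) := M.memLp_scoreR hn
  have hRi : Integrable M.scoreR (B.obsLaw (B.mixPolicy n hn).dens) := hR.integrable (by norm_num)
  have i1 : Integrable (fun o => B.weight n πe o.1 * (o.2 - B.q o.1.1 o.1.2) * M.scoreR o)
      (B.obsLaw (B.mix n)) := by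
    refine hRi.bdd_mul (c := C * Rmax) (hwm.mul B.measurable_reward_sub).aestronglyMeasurable ?_
    filter_upwards [B.ae_abs_reward_sub_le (B.mixPolicy n hn)] with o ho
    rw [norm_mul]
    exact mul_le_mul (hC _) ho (norm_nonneg _) ((abs_nonneg _).trans (hC o.1))
  have i2 : Integrable (fun o => B.weight n πe o.1 * B.q o.1.1 o.1.2 * M.scoreR o)
      (B.obsLaw (B.mix n)) := by
    refine hRi.bdd_mul (c := C * Rmax)
      (hwm.mul (B.measurable_uncurry_q.comp measurable_fst)).aestronglyMeasurable
      (Eventually.of_forall fun o => ?_)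
    rw [norm_mul]
    exact mul_le_mul (hC _) (B.abs_q_le _ _) (norm_nonneg _) ((abs_nonneg _).trans (hC o.1))
  have h3 : ∫ o, B.weight n πe o.1 * B.q o.1.1 o.1.2 * M.scoreR o ∂(B.obsLaw (B.mix n)) = 0 :=
    M.integral_mul_scoreR hn (h := fun x => B.weight n πe x * B.q x.1 x.2)
      ((measurable_weight hn).mul B.measurable_uncurry_q) (b := C * Rmax) fun x => by
        rw [abs_mul]
        exact mul_le_mul (hC _) (B.abs_q_le _ _) (abs_nonneg _) ((abs_nonneg _).trans (hC x))
  have h4 : ∫ o, B.weight n πe o.1 * (o.2 - B.q o.1.1 o.1.2) * M.scoreR o ∂(B.obsLaw (B.mix n))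
      = ∫ o, B.weight n πe o.1 * o.2 * M.scoreR o ∂(B.obsLaw (B.mix n)) := by
    have : (fun o : Obs S A => B.weight n πe o.1 * o.2 * M.scoreR o)
        = fun o => B.weight n πe o.1 * (o.2 - B.q o.1.1 o.1.2) * M.scoreR o
          + B.weight n πe o.1 * B.q o.1.1 o.1.2 * M.scoreR o := by
      ext o; ring
    rw [this, integral_add i1 i2, h3, add_zero]
  rw [h2, h1, ← h4, integral_obsLaw_mix hn i1]
  simp_rw [M.integral_drScore_mul_obsScore hn hC (idx_pos _)]
  rw [Finset.sum_add_distrib, sum_idx_eq (fun _ => ∫ s, B.v πe s * M.scoreS s ∂B.stateLaw),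
    sum_idx_eq (fun k => ∫ o, B.weight n πe o.1 * (o.2 - B.q o.1.1 o.1.2) * M.scoreR o
          ∂(B.obsLaw (B.logging k).dens)), ← Finset.sum_mul, ← Nat.cast_sum, mul_add,
    inv_mul_cancel_left₀ hN, Finset.mul_sum]
  congr 1
  refine Finset.sum_congr rfl fun k _ => ?_
  ring

end Gradient

end OPE

namespace OPE

/-! ### The least favourable submodel and the efficiency bound -/

section Bound

/-- Truncation of the parameter to `[-1 / (2 b), 1 / (2 b)]`, which keeps `1 + t g` positive when
`|g| ≤ b`. -/
noncomputable def clampParam (b t : ℝ) : ℝ := max (-(1 / (2 * b))) (min t (1 / (2 * b)))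

lemma clampParam_zero {b : ℝ} (hb : 0 < b) : clampParam b 0 = 0 := by
  have : 0 < 1 / (2 * b) := by positivity
  rw [clampParam, min_eq_left this.le, max_eq_right (by linarith)]

lemma abs_clampParam_le {b : ℝ} (hb : 0 < b) (t : ℝ) : |clampParam b t| ≤ 1 / (2 * b) := by
  have : 0 < 1 / (2 * b) := by positivity
  rw [abs_le, clampParam]
  exact ⟨le_max_left _ _, max_le (by linarith) (min_le_right _ _)⟩

lemma clampParam_eq {b t : ℝ} (ht : |t| ≤ 1 / (2 * b)) : clampParam b t = t := by
  rw [abs_le] at ht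
  rw [clampParam, min_eq_left ht.2, max_eq_right ht.1]

lemma abs_clampParam_mul_le {b : ℝ} (hb : 0 < b) (t : ℝ) {y : ℝ} (hy : |y| ≤ b) :
    |clampParam b t * y| ≤ 1 / 2 := by
  rw [abs_mul]
  calc |clampParam b t| * |y| ≤ 1 / (2 * b) * b :=
        mul_le_mul (abs_clampParam_le hb t) hy (abs_nonneg _) (by positivity)
    _ = 1 / 2 := by field_simp

lemma one_add_clampParam_mul_nonneg {b : ℝ} (hb : 0 < b) (t : ℝ) {y : ℝ} (hy : |y| ≤ b) :
    0 ≤ 1 + clampParam b t * y := by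
  have := (abs_le.1 (abs_clampParam_mul_le hb t hy)).1
  linarith

lemma abs_sqrt_one_add_sub_le {x : ℝ} (hx : 0 ≤ 1 + x) : |√(1 + x) - 1 - x / 2| ≤ x ^ 2 / 2 := by
  have h1 : √(1 + x) - 1 - x / 2 = -((√(1 + x) - 1) ^ 2 / 2) := by
    have := Real.sq_sqrt hx
    linear_combination (1 / 2) * this
  have h2 : x = (√(1 + x) - 1) * (√(1 + x) + 1) := by
    have := Real.sq_sqrt hx
    linear_combination -this
  have h3 : (√(1 + x) - 1) ^ 2 ≤ x ^ 2 := by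
    conv_rhs => rw [h2, mul_pow]
    refine le_mul_of_one_le_right (sq_nonneg _) ?_
    nlinarith [Real.sqrt_nonneg (1 + x)]
  rw [h1, abs_neg, abs_of_nonneg (by positivity)]
  linarith

/-- The linear family `1 + t g`, with bounded `g`, has score `g`. -/
lemma hasQMScore_linear {α : Type*} [MeasurableSpace α] {μ : Measure α} [IsFiniteMeasure μ]
    {g : α → ℝ} (hg : Measurable g) {b : ℝ} (hb : 0 < b) (hgb : ∀ x, |g x| ≤ b) :
    HasQMScore μ (fun t x => 1 + clampParam b t * g x) g := by
  refine ⟨hg, ?_⟩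
  have hlim : Tendsto (fun t : ℝ => μ Set.univ ^ ((2 : ℝ≥0∞).toReal)⁻¹ *
      ENNReal.ofReal (|t| * (b ^ 2 / 2))) (𝓝[≠] 0) (𝓝 0) := by
    have h1 : Tendsto (fun t : ℝ => |t| * (b ^ 2 / 2)) (𝓝 0) (𝓝 (|0| * (b ^ 2 / 2))) :=
      ((continuous_abs.mul continuous_const).tendsto 0)
    rw [abs_zero, zero_mul] at h1
    have h2 := ENNReal.tendsto_ofReal (h1.mono_left (nhdsWithin_le_nhds (s := {0}ᶜ)))
    rw [ENNReal.ofReal_zero] at h2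
    have h3 := ENNReal.Tendsto.const_mul (a := μ Set.univ ^ ((2 : ℝ≥0∞).toReal)⁻¹) h2
      (Or.inr (ENNReal.rpow_ne_top_of_nonneg (by positivity) (measure_ne_top _ _)))
    simpa using h3
  refine tendsto_of_tendsto_of_tendsto_of_le_of_le' tendsto_const_nhds hlim
    (Eventually.of_forall fun _ => zero_le) ?_
  have hev : ∀ᶠ t : ℝ in 𝓝[≠] 0, |t| ≤ 1 / (2 * b) := by
    refine nhdsWithin_le_nhds ?_
    have : Tendsto (fun t : ℝ => |t|) (𝓝 0) (𝓝 |(0 : ℝ)|) := continuous_abs.tendsto 0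
    rw [abs_zero] at this
    exact this.eventually (eventually_le_nhds (by positivity))
  filter_upwards [hev, self_mem_nhdsWithin] with t ht ht'
  have ht0 : t ≠ 0 := ht'
  refine eLpNorm_le_of_ae_bound (Eventually.of_forall fun x => ?_)
  simp only [clampParam_zero hb, zero_mul, add_zero, Real.sqrt_one, mul_one]
  have h0 := one_add_clampParam_mul_nonneg hb t (hgb x)
  rw [clampParam_eq ht] at h0 ⊢
  have h1 := abs_sqrt_one_add_sub_le h0
  have h2 : (√(1 + t * g x) - 1) / t - g x / 2 = (√(1 + t * g x) - 1 - t * g x / 2) / t := by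
    field_simp
  have hg2 : g x ^ 2 ≤ b ^ 2 := by
    rw [← sq_abs]; exact pow_le_pow_left₀ (abs_nonneg _) (hgb x) 2
  rw [h2, Real.norm_eq_abs, abs_div, div_le_iff₀ (abs_pos.2 ht0)]
  calc _ ≤ (t * g x) ^ 2 / 2 := h1
    _ = |t| * |t| * (g x ^ 2 / 2) := by rw [abs_mul_abs_self]; ring
    _ ≤ |t| * |t| * (b ^ 2 / 2) := by gcongr
    _ = _ := by ring

lemma isProbabilityMeasure_linear {α : Type*} [MeasurableSpace α] {μ : Measure α}
    [IsProbabilityMeasure μ] {g : α → ℝ} (hg : Measurable g) {b : ℝ} (hb : 0 < b)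
    (hgb : ∀ x, |g x| ≤ b) (hg0 : ∫ x, g x ∂μ = 0) (t : ℝ) :
    IsProbabilityMeasure
      (μ.withDensity fun x => ENNReal.ofReal (1 + clampParam b t * g x)) := by
  have hi : Integrable g μ := Integrable.of_bound hg.aestronglyMeasurable b
    (Eventually.of_forall hgb)
  refine ⟨?_⟩
  rw [withDensity_apply _ MeasurableSet.univ, Measure.restrict_univ,
    ← ofReal_integral_eq_lintegral_ofReal (by fun_prop)
      (Eventually.of_forall fun x => one_add_clampParam_mul_nonneg hb t (hgb x)),
    integral_add (integrable_const _) (hi.const_mul _), integral_const_mul, hg0]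
  simp

variable {S A : Type*} [MeasurableSpace S] [MeasurableSpace A] {ν : Measure A} [SFinite ν]
  {Rmax : ℝ} {K : ℕ}

lemma Bandit.eq_of_laws_eq {B B' : Bandit S A ν Rmax K} (h1 : B.stateLaw = B'.stateLaw)
    (h2 : B.rewardLaw = B'.rewardLaw) (h3 : B.logging = B'.logging) : B = B' := by
  cases B
  cases B'
  cases h1
  cases h2
  cases h3
  rfl

variable (B : Bandit S A ν Rmax K) (n : Fin K → ℕ) (πe : Policy S A ν)

/-- The state component `v - J` of the centred influence function. -/
noncomputable def Bandit.dirS (s : S) : ℝ := B.v πe s - B.value πe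

/-- The reward component of the influence function; clipping makes it bounded off the support of
the rewards. -/
noncomputable def Bandit.dirR (o : Obs S A) : ℝ :=
  B.weight n πe o.1 * (clipReward Rmax o.2 - B.q o.1.1 o.1.2)

variable {B n πe}

namespace Bandit

lemma abs_value_le : |B.value πe| ≤ Rmax := by
  rw [value_eq_integral_v]
  simpa using norm_integral_le_of_norm_le_const (μ := B.stateLaw)
    (Eventually.of_forall fun s => (Real.norm_eq_abs _).le.trans (B.abs_v_le πe s))

lemma measurable_dirS : Measurable (B.dirS πe) := (B.measurable_v πe).sub_const _

lemma abs_dirS_le (s : S) : |B.dirS πe s| ≤ 2 * Rmax := by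
  calc |B.dirS πe s| ≤ |B.v πe s| + |B.value πe| := abs_sub _ _
    _ ≤ 2 * Rmax := by linarith [B.abs_v_le πe s, B.abs_value_le (πe := πe)]

lemma integral_dirS : ∫ s, B.dirS πe s ∂B.stateLaw = 0 := by
  have hi : Integrable (B.v πe) B.stateLaw :=
    Integrable.of_bound (B.measurable_v πe).aestronglyMeasurable Rmax
      (Eventually.of_forall (B.abs_v_le πe))
  unfold dirS
  rw [integral_sub hi (integrable_const _), ← value_eq_integral_v]
  simp

lemma measurable_dirR (hn : 0 < ∑ k, n k) : Measurable (B.dirR n πe) :=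
  ((measurable_weight hn).comp measurable_fst).mul
    (((measurable_clipReward Rmax).comp measurable_snd).sub
      (B.measurable_uncurry_q.comp measurable_fst))

lemma abs_dirR_le {C : ℝ} (hC : ∀ x, |B.weight n πe x| ≤ C) (o : Obs S A) :
    |B.dirR n πe o| ≤ C * (2 * Rmax) := by
  have hR : 0 ≤ Rmax := B.nonneg_of_policy πe
  rw [dirR, abs_mul]
  refine mul_le_mul (hC _) ?_ (abs_nonneg _) ((abs_nonneg _).trans (hC o.1))
  calc _ ≤ |clipReward Rmax o.2| + |B.q o.1.1 o.1.2| := abs_sub _ _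
    _ ≤ 2 * Rmax := by linarith [abs_clipReward_le hR o.2, B.abs_q_le o.1.1 o.1.2]

lemma integral_dirR (x : S × A) : ∫ r, B.dirR n πe (x, r) ∂(B.rewardLaw x) = 0 := by
  have h : ∫ r, B.dirR n πe (x, r) ∂(B.rewardLaw x)
      = ∫ r, B.weight n πe x * (r - B.q x.1 x.2) ∂(B.rewardLaw x) := by
    refine integral_congr_ae ?_
    filter_upwards [B.reward_mem x] with r hr
    simp only [dirR, clipReward_of_mem hr]
  rw [h, integral_const_mul, integral_sub (B.integrable_reward x) (integrable_const _)]
  simp [q]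

/-- The law of rewards tilted in the direction of the influence function. -/
noncomputable def tiltReward (B : Bandit S A ν Rmax K) (n : Fin K → ℕ) (πe : Policy S A ν)
    (b t : ℝ) : Kernel (S × A) ℝ :=
  B.rewardLaw.withDensity fun x r => ENNReal.ofReal (1 + clampParam b t * B.dirR n πe (x, r))

lemma tiltReward_apply (hn : 0 < ∑ k, n k) (b t : ℝ) (x : S × A) :
    B.tiltReward n πe b t x = (B.rewardLaw x).withDensity
      fun r => ENNReal.ofReal (1 + clampParam b t * B.dirR n πe (x, r)) := by
  rw [tiltReward, Kernel.withDensity_apply]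
  exact ((measurable_dirR hn).const_mul _ |>.const_add 1).ennreal_ofReal

/-- The instance obtained by tilting the laws of states and rewards in the direction of the
influence function, the logging policies being fixed. -/
noncomputable def tilt (B : Bandit S A ν Rmax K) (πe : Policy S A ν) (hn : 0 < ∑ k, n k) {b : ℝ}
    (hb : 0 < b) (hS : ∀ s, |B.dirS πe s| ≤ b) (hR : ∀ o, |B.dirR n πe o| ≤ b) (t : ℝ) :
    Bandit S A ν Rmax K where
  stateLaw := B.stateLaw.withDensity fun s => ENNReal.ofReal (1 + clampParam b t * B.dirS πe s)
  isProb_stateLaw := isProbabilityMeasure_linear measurable_dirS hb hS integral_dirS t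
  rewardLaw := B.tiltReward n πe b t
  isMarkov_rewardLaw := ⟨fun x => by
    rw [tiltReward_apply hn]
    exact isProbabilityMeasure_linear ((measurable_dirR hn).comp measurable_prodMk_left) hb
      (fun r => hR _) (integral_dirR x) t⟩
  reward_mem x := by
    rw [tiltReward_apply hn]
    exact (withDensity_absolutelyContinuous _ _).ae_le (B.reward_mem x)
  logging := B.logging

lemma tilt_zero (hn : 0 < ∑ k, n k) {b : ℝ} (hb : 0 < b) (hS : ∀ s, |B.dirS πe s| ≤ b)
    (hR : ∀ o, |B.dirR n πe o| ≤ b) : B.tilt πe hn hb hS hR 0 = B := by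
  refine eq_of_laws_eq ?_ ?_ rfl
  · simp [tilt, clampParam_zero hb]
  · simp [tilt, tiltReward, clampParam_zero hb]

/-- The submodel that tilts in the direction of the efficient influence function. -/
noncomputable def tiltModel (B : Bandit S A ν Rmax K) (πe : Policy S A ν) (hn : 0 < ∑ k, n k)
    (hov : B.WeakOverlap n πe) {b : ℝ} (hb : 0 < b) (hS : ∀ s, |B.dirS πe s| ≤ b)
    (hR : ∀ o, |B.dirR n πe o| ≤ b) : Submodel B n πe where
  inst := B.tilt πe hn hb hS hR
  inst_zero := tilt_zero hn hb hS hR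
  overlap _ := hov
  baseS := B.stateLaw
  sigmaFinite_baseS := inferInstance
  densS t s := 1 + clampParam b t * B.dirS πe s
  measurable_densS t := (measurable_dirS.const_mul _).const_add 1
  densS_nonneg t s := one_add_clampParam_mul_nonneg hb t (hS s)
  stateLaw_eq _ := rfl
  baseR := B.rewardLaw
  isSFiniteKernel_baseR := inferInstance
  densR t o := 1 + clampParam b t * B.dirR n πe o
  measurable_densR t := ((measurable_dirR hn).const_mul _).const_add 1
  densR_nonneg t o := one_add_clampParam_mul_nonneg hb t (hR o)
  rewardLaw_eq t x := tiltReward_apply hn b t x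
  scoreS := B.dirS πe
  scoreA _ _ := 0
  scoreR := B.dirR n πe
  qm_S := hasQMScore_linear measurable_dirS hb hS
  qm_A k := by
    refine ⟨measurable_const, ?_⟩
    have : ∀ t : ℝ, (fun x : S × A => (√(((B.tilt πe hn hb hS hR t).logging k).dens x.1 x.2)
        - √(((B.tilt πe hn hb hS hR 0).logging k).dens x.1 x.2)) / t
        - 0 * √(((B.tilt πe hn hb hS hR 0).logging k).dens x.1 x.2) / 2) = fun _ => 0 := by
      intro t
      ext x
      simp [tilt]
    simp only [this, eLpNorm_zero']
    exact tendsto_const_nhds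
  qm_R := by
    have : IsFiniteMeasure (B.saLaw (B.mix n) ⊗ₘ B.rewardLaw) :=
      inferInstanceAs (IsFiniteMeasure (B.obsLaw (B.mixPolicy n hn).dens))
    exact hasQMScore_linear (measurable_dirR hn) hb hR

lemma ae_reward_mem_dataLaw (B : Bandit S A ν Rmax K) (N : Fin K → ℕ) :
    ∀ᵐ x ∂(B.dataLaw N), ∀ p, (x p).2 ∈ Set.Icc 0 Rmax :=
  ae_all_iff.2 fun p => (B.measurePreserving_eval_dataLaw p).quasiMeasurePreserving.ae
    (B.ae_reward_mem (B.logging p.1).dens)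

/-- The score of the tilted submodel is `n` times the centred efficient influence function. -/
lemma score_tiltModel (hn : 0 < ∑ k, n k)
    (hov : B.WeakOverlap n πe) {b : ℝ} (hb : 0 < b) (hS : ∀ s, |B.dirS πe s| ≤ b)
    (hR : ∀ o, |B.dirR n πe o| ≤ b) :
    ∀ᵐ x ∂(B.dataLaw n), (B.tiltModel πe hn hov hb hS hR).score x
      = ((∑ k, n k : ℕ) : ℝ) * (B.effScore n πe x - B.value πe) := by
  have hN : ((∑ k, n k : ℕ) : ℝ) ≠ 0 := by exact_mod_cast hn.ne'
  filter_upwards [B.ae_reward_mem_dataLaw n] with x hx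
  have h1 (p : Idx n) : B.dirS πe (x p).1.1 + 0 + B.dirR n πe (x p)
      = B.drScore n πe (x p) - B.value πe := by
    simp only [dirS, dirR, drScore, clipReward_of_mem (hx p)]
    ring
  have h2 : (B.tiltModel πe hn hov hb hS hR).score x
      = ∑ p : Idx n, (B.drScore n πe (x p) - B.value πe) := Finset.sum_congr rfl fun p _ => h1 p
  rw [h2, Finset.sum_sub_distrib, sum_idx_eq (fun _ => B.value πe), ← Finset.sum_mul,
    ← Nat.cast_sum, effScore, mul_sub, mul_inv_cancel_left₀ hN]

/-- `V*` is the efficiency bound: any gradient has the same covariance with the efficient influence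
function as the latter has with itself, since the tilted submodel has the latter as its score. -/
theorem isEfficiencyBound_Vstar (hn : 0 < ∑ k, n k) (hov : B.WeakOverlap n πe) {C : ℝ}
    (hC : ∀ x, |B.weight n πe x| ≤ C) : IsEfficiencyBound B n πe (B.Vstar n πe) := by
  have hN : (0 : ℝ) < ((∑ k, n k : ℕ) : ℝ) := by exact_mod_cast hn
  have hgrad := isGradient_effScore hn hov hC
  refine ⟨⟨B.effScore n πe, hgrad, (variance_effScore hn hC).symm⟩, ?_⟩
  rintro W ⟨f, hf, rfl⟩
  rw [← variance_effScore hn hC]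
  refine mul_le_mul_of_nonneg_left ?_ hN.le
  have hR0 : 0 ≤ Rmax := B.nonneg_of_policy πe
  have hC0 : 0 ≤ C := by
    obtain ⟨o, -⟩ := (B.ae_reward_mem πe.dens).exists
    exact (abs_nonneg _).trans (hC o.1)
  set b : ℝ := 2 * Rmax + C * (2 * Rmax) + 1 with hbdef
  have hCR : 0 ≤ C * (2 * Rmax) := by positivity
  have hb : 0 < b := by positivity
  have hS (s : S) : |B.dirS πe s| ≤ b := (B.abs_dirS_le s).trans (by linarith)
  have hR (o : Obs S A) : |B.dirR n πe o| ≤ b := (abs_dirR_le hC o).trans (by linarith)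
  set M := B.tiltModel πe hn hov hb hS hR
  have hscore := score_tiltModel hn hov hb hS hR
  set e := B.effScore n πe with he
  have he2 : MemLp e 2 (B.dataLaw n) := memLp_effScore hn hC
  have hei := he2.integrable (by norm_num)
  have heq : ∫ x, f x * M.score x ∂(B.dataLaw n) = ∫ x, e x * M.score x ∂(B.dataLaw n) :=
    (hf.2 M).unique (hgrad.2 M)
  have hmean : ∫ x, e x ∂(B.dataLaw n) = B.value πe := integral_effScore hn hC
  have hcov (g : Dataset S A n → ℝ) (hg : MemLp g 2 (B.dataLaw n)) :
      ∫ x, g x * M.score x ∂(B.dataLaw n)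
        = ((∑ k, n k : ℕ) : ℝ) * cov[g, e; B.dataLaw n] := by
    have hge : Integrable (fun x => g x * e x) (B.dataLaw n) := hg.integrable_mul he2
    rw [covariance_eq_sub hg he2, hmean]
    have h1 : ∫ x, g x * M.score x ∂(B.dataLaw n)
        = ∫ x, ((∑ k, n k : ℕ) : ℝ) * (g x * e x - g x * B.value πe) ∂(B.dataLaw n) := by
      refine integral_congr_ae ?_
      filter_upwards [hscore] with x hx
      rw [hx]
      ring
    rw [h1, integral_const_mul, integral_sub hge
      ((hg.integrable (by norm_num)).mul_const _), integral_mul_const]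
    rfl
  rw [hcov f hf.1, hcov e he2] at heq
  have hfe : cov[f, e; B.dataLaw n] = Var[e; B.dataLaw n] := by
    rw [← covariance_self he2.aemeasurable]
    exact mul_left_cancel₀ hN.ne' heq
  have hvar := variance_sub hf.1 he2
  have hnn := variance_nonneg (f - e) (B.dataLaw n)
  rw [hvar, hfe] at hnn
  linarith

end Bandit

end Bound

end OPE

namespace OPE

/-! ### Sums of independent terms with estimated summands -/

section Conditional

variable {ι E : Type*} [Fintype ι] [DecidableEq ι] [MeasurableSpace E] (μ : ι → Measure E)
  [∀ i, IsProbabilityMeasure (μ i)]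

/-- Resampling the coordinates in `s` independently preserves a product measure. -/
lemma measurePreserving_finset_piecewise (s : Finset ι) :
    MeasurePreserving (fun z : (ι → E) × (ι → E) => s.piecewise z.2 z.1)
      ((Measure.pi μ).prod (Measure.pi μ)) (Measure.pi μ) := by
  have hm : Measurable fun z : (ι → E) × (ι → E) => s.piecewise z.2 z.1 := by
    refine measurable_pi_iff.2 fun i => ?_
    by_cases hi : i ∈ s
    · simp only [Finset.piecewise, hi, if_true]
      fun_prop
    · simp only [Finset.piecewise, hi, if_false]
      fun_prop
  refine ⟨hm, (Measure.pi_eq fun B hB => ?_).symm⟩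
  rw [Measure.map_apply hm (MeasurableSet.univ_pi hB)]
  have hset : (fun z : (ι → E) × (ι → E) => s.piecewise z.2 z.1) ⁻¹' Set.univ.pi B
      = (Set.univ.pi fun i => if i ∈ s then Set.univ else B i) ×ˢ
        (Set.univ.pi fun i => if i ∈ s then B i else Set.univ) := by
    ext z
    simp only [Set.mem_preimage, Set.mem_univ_pi, Set.mem_prod, ← forall_and]
    refine forall_congr' fun i => ?_
    by_cases hi : i ∈ s <;> simp [hi]
  rw [hset, Measure.prod_prod, Measure.pi_pi, Measure.pi_pi, ← Finset.prod_mul_distrib]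
  refine Finset.prod_congr rfl fun i _ => ?_
  by_cases hi : i ∈ s <;> simp [hi]

/-- The second moment of a sum of independent terms. -/
lemma integral_sq_sum_pi_le {s : Finset ι} {d : ι → E → ℝ} (hd : ∀ i ∈ s, MemLp (d i) 2 (μ i)) :
    Integrable (fun y : ι → E => (∑ i ∈ s, d i (y i)) ^ 2) (Measure.pi μ) ∧
    ∫ y, (∑ i ∈ s, d i (y i)) ^ 2 ∂(Measure.pi μ)
      ≤ (∑ i ∈ s, ∫ x, d i x ∂(μ i)) ^ 2 + ∑ i ∈ s, ∫ x, d i x ^ 2 ∂(μ i) := by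
  set g : ι → E → ℝ := fun i x => if i ∈ s then d i x else 0 with hg
  have hg2 (i : ι) : MemLp (g i) 2 (μ i) := by
    by_cases hi : i ∈ s
    · simpa [hg, hi] using hd i hi
    · simp [hg, hi]
  have hg2' (i : ι) : MemLp (fun y : ι → E => g i (y i)) 2 (Measure.pi μ) :=
    (hg2 i).comp_measurePreserving (measurePreserving_eval μ i)
  have hsum : (fun y : ι → E => ∑ i ∈ s, d i (y i)) = ∑ i, fun y : ι → E => g i (y i) := by
    ext y; simp [hg]
  have heval (i : ι) : ∫ y, g i (y i) ∂(Measure.pi μ) = ∫ x, g i x ∂(μ i) := by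
    have hmp := measurePreserving_eval μ i
    have hm : AEStronglyMeasurable (g i) ((Measure.pi μ).map (Function.eval i)) := by
      rw [hmp.map_eq]; exact (hg2 i).1
    conv_rhs => rw [← hmp.map_eq]
    exact (integral_map hmp.measurable.aemeasurable hm).symm
  have hS2 : MemLp (fun y : ι → E => ∑ i ∈ s, d i (y i)) 2 (Measure.pi μ) := by
    rw [hsum]
    exact memLp_finsetSum' _ fun i _ => hg2' i
  refine ⟨hS2.integrable_sq, ?_⟩
  have hvar := variance_sum_pi (μ := μ) hg2
  rw [← hsum, variance_eq_sub hS2] at hvar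
  have hmean : ∫ y, ∑ i ∈ s, d i (y i) ∂(Measure.pi μ) = ∑ i ∈ s, ∫ x, d i x ∂(μ i) := by
    have h1 : ∫ y, ∑ i ∈ s, d i (y i) ∂(Measure.pi μ)
        = ∫ y, ∑ i, g i (y i) ∂(Measure.pi μ) := by simp [hg]
    rw [h1, integral_finsetSum _ fun i _ => (hg2' i).integrable (by norm_num)]
    simp_rw [heval]
    rw [← Finset.sum_filter_add_sum_filter_not Finset.univ (· ∈ s) (fun i => ∫ x, g i x ∂(μ i)),
      Finset.sum_eq_zero (s := Finset.univ.filter (· ∉ s)), add_zero]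
    · simp only [Finset.filter_mem_eq_inter, Finset.univ_inter]
      exact Finset.sum_congr rfl fun i hi => by simp [hg, hi]
    · intro i hi
      simp [hg, (Finset.mem_filter.1 hi).2]
  have hle : ∑ i, Var[g i; μ i] ≤ ∑ i ∈ s, ∫ x, d i x ^ 2 ∂(μ i) := by
    rw [← Finset.sum_filter_add_sum_filter_not Finset.univ (· ∈ s) (fun i => Var[g i; μ i]),
      Finset.sum_eq_zero (s := Finset.univ.filter (· ∉ s)), add_zero]
    · simp only [Finset.filter_mem_eq_inter, Finset.univ_inter]
      refine Finset.sum_le_sum fun i hi => ?_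
      have : g i = d i := by ext x; simp [hg, hi]
      rw [this]
      exact variance_le_expectation_sq (hd i hi).1
    · intro i hi
      have : g i = 0 := by ext x; simp [hg, (Finset.mem_filter.1 hi).2]
      rw [this, variance_zero]
  have h2 : ∫ y, ((fun y : ι → E => ∑ i ∈ s, d i (y i)) ^ 2) y ∂(Measure.pi μ)
      = ∫ y, (∑ i ∈ s, d i (y i)) ^ 2 ∂(Measure.pi μ) := rfl
  rw [hmean] at hvar
  linarith

/-- A conditional form of Chebyshev's inequality. The summands `D i x` for `i ∈ s` may depend on
the coordinates of `x` outside `s`, as does the event `G`; given these, the sum has independent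
terms. -/
lemma measure_inter_sum_ge_le {s : Finset ι} {G : Set (ι → E)} (hG : MeasurableSet G)
    {D : ι → (ι → E) → E → ℝ} (hDm : ∀ i, Measurable fun y : (ι → E) × E => D i y.1 y.2)
    (hGs : ∀ x y : ι → E, (∀ i ∉ s, x i = y i) → x ∈ G → y ∈ G)
    (hDs : ∀ i ∈ s, ∀ x y : ι → E, (∀ j ∉ s, x j = y j) → D i x = D i y) {η ε : ℝ} (hε : 0 < ε)
    (hbound : ∀ x ∈ G, (∀ i ∈ s, MemLp (D i x) 2 (μ i)) ∧
      (∑ i ∈ s, ∫ o, D i x o ∂(μ i)) ^ 2 + ∑ i ∈ s, ∫ o, D i x o ^ 2 ∂(μ i) ≤ η) :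
    Measure.pi μ (G ∩ {x | ε ≤ |∑ i ∈ s, D i x (x i)|}) ≤ ENNReal.ofReal (η / ε ^ 2) := by
  have hT : Measurable fun x : ι → E => ∑ i ∈ s, D i x (x i) :=
    Finset.measurable_fun_sum _ fun i _ =>
      (hDm i).comp (measurable_id.prodMk (measurable_pi_apply i))
  have hE : MeasurableSet (G ∩ {x | ε ≤ |∑ i ∈ s, D i x (x i)|}) :=
    hG.inter (measurableSet_le measurable_const hT.abs)
  have hmp := measurePreserving_finset_piecewise μ s
  rw [← hmp.measure_preimage hE.nullMeasurableSet, Measure.prod_apply (hmp.measurable hE)]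
  refine (lintegral_mono (g := fun _ => ENNReal.ofReal (η / ε ^ 2)) fun x => ?_).trans (by simp)
  have hout (y : ι → E) : ∀ i ∉ s, s.piecewise y x i = x i := fun i hi => by simp [hi]
  by_cases hx : x ∈ G
  · obtain ⟨hL, hle⟩ := hbound x hx
    obtain ⟨hint, hsq⟩ := integral_sq_sum_pi_le μ hL
    refine (measure_mono (t := {y | ε ^ 2 ≤ (∑ i ∈ s, D i x (y i)) ^ 2}) ?_).trans ?_
    · intro y hy
      have hy2 : ε ≤ |∑ i ∈ s, D i (s.piecewise y x) (s.piecewise y x i)| := hy.2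
      have heq : ∑ i ∈ s, D i (s.piecewise y x) (s.piecewise y x i)
          = ∑ i ∈ s, D i x (y i) := by
        refine Finset.sum_congr rfl fun i hi => ?_
        rw [hDs i hi _ x (hout y)]
        simp [hi]
      rw [heq] at hy2
      change ε ^ 2 ≤ _
      rw [← sq_abs (∑ i ∈ s, D i x (y i))]
      exact pow_le_pow_left₀ hε.le hy2 2
    · have hM := mul_meas_ge_le_integral_of_nonneg (μ := Measure.pi μ)
        (Eventually.of_forall fun y => sq_nonneg _) hint (ε ^ 2)
      rw [← ofReal_measureReal]
      refine ENNReal.ofReal_le_ofReal ((le_div_iff₀ (by positivity)).2 ?_)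
      rw [mul_comm]
      exact hM.trans (hsq.trans hle)
  · have : Prod.mk x ⁻¹' ((fun z : (ι → E) × (ι → E) => s.piecewise z.2 z.1) ⁻¹'
        (G ∩ {x | ε ≤ |∑ i ∈ s, D i x (x i)|})) = ∅ := by
      rw [Set.eq_empty_iff_forall_notMem]
      intro y hy
      exact hx (hGs _ x (hout y) hy.1)
    rw [this, measure_empty]
    exact zero_le

end Conditional

/-! ### Blocks of independent variables -/

section Blocks

/-- Disjoint blocks of independent variables are independent. -/
lemma iIndepFun_blocks {Ω ι κ E : Type*} [MeasurableSpace Ω] [MeasurableSpace E] [Countable ι]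
    [Countable κ] {P : Measure Ω} [IsProbabilityMeasure P] {X : ι × κ → Ω → E}
    (hX : ∀ p, AEMeasurable (X p) P) (h : iIndepFun X P) :
    iIndepFun (fun (i : ι) ω (j : κ) => X (i, j) ω) P := by
  have hp (p : ι × κ) : IsProbabilityMeasure (P.map (X p)) :=
    Measure.isProbabilityMeasure_map (hX p)
  have hp' (i : ι) (j : κ) : IsProbabilityMeasure (P.map (X (i, j))) := hp (i, j)
  have hrow (i : ι) : AEMeasurable (fun ω (j : κ) => X (i, j) ω) P :=
    aemeasurable_pi_iff.2 fun j => hX (i, j)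
  rw [iIndepFun_iff_map_fun_eq_infinitePi_map₀' hrow]
  have h1 := h.map_fun_eq_infinitePi_map₀' hX
  have h2 (i : ι) : P.map (fun ω (j : κ) => X (i, j) ω)
      = Measure.infinitePi fun j => P.map (X (i, j)) :=
    (h.precomp (g := fun j => (i, j)) (Prod.mk_right_injective i)).map_fun_eq_infinitePi_map₀'
      fun j => hX (i, j)
  simp_rw [h2]
  rw [← Measure.infinitePi_map_curry (fun (i : ι) (j : κ) => P.map (X (i, j))), ← h1,
    AEMeasurable.map_map_of_aemeasurable (by fun_prop) (aemeasurable_pi_iff.2 hX)]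
  rfl

end Blocks

end OPE

namespace OPE

/-! ### The effect of estimating the nuisance functions on one summand -/

section Remainder

variable {S A : Type*} [MeasurableSpace S] [MeasurableSpace A] {ν : Measure A} [SFinite ν]
  {Rmax : ℝ} {K : ℕ} {B : Bandit S A ν Rmax K} {n : Fin K → ℕ} {πe : Policy S A ν}

/-- A summand of the doubly robust estimator, with nuisance functions `g` for `q` and `p` for
`π_*`. -/
noncomputable def drTerm (πe : Policy S A ν) (p g : S → A → ℝ) (o : Obs S A) : ℝ :=
  1 / p o.1.1 o.1.2 * πe.dens o.1.1 o.1.2 * (o.2 - g o.1.1 o.1.2)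
    + ∫ a, g o.1.1 a ∂(densKernel ν πe.dens o.1.1)

namespace Bandit

/-- The error of a summand of the doubly robust estimator due to the nuisance functions. -/
noncomputable def drError (B : Bandit S A ν Rmax K) (n : Fin K → ℕ) (πe : Policy S A ν)
    (p g : S → A → ℝ) (o : Obs S A) : ℝ :=
  drTerm πe p g o - B.drScore n πe o

variable (B n πe) in
/-- The error of the estimated importance weight. -/
noncomputable def weightError (p : S → A → ℝ) (x : S × A) : ℝ :=
  1 / p x.1 x.2 * πe.dens x.1 x.2 - B.weight n πe x

variable {p g : S → A → ℝ} {C : ℝ}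

lemma integral_fst_obs (p : S → A → ℝ) {F : S × A → ℝ} (hF : Measurable F) :
    ∫ o, F o.1 ∂(B.obsLaw p) = ∫ x, F x ∂(B.saLaw p) := by
  rw [← B.map_fst_obsLaw p, integral_map measurable_fst.aemeasurable hF.aestronglyMeasurable]

lemma measurable_drTerm (hp : Measurable (Function.uncurry p))
    (hg : Measurable (Function.uncurry g)) : Measurable (drTerm πe p g) := by
  have hp' : Measurable fun x : S × A => p x.1 x.2 := hp
  have hg' : Measurable fun x : S × A => g x.1 x.2 := hg
  have hd : Measurable fun x : S × A => πe.dens x.1 x.2 := πe.measurable_dens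
  exact ((((measurable_const.div hp').mul hd).comp measurable_fst).mul
    (measurable_snd.sub (hg'.comp measurable_fst))).add
    ((measurable_integral_policy πe hg).comp (measurable_fst.comp measurable_fst))

lemma measurable_drError (hn : 0 < ∑ k, n k) (hp : Measurable (Function.uncurry p))
    (hg : Measurable (Function.uncurry g)) : Measurable (B.drError n πe p g) :=
  (measurable_drTerm hp hg).sub (measurable_drScore hn)

lemma measurable_weightError (hn : 0 < ∑ k, n k) (hp : Measurable (Function.uncurry p)) :
    Measurable (B.weightError n πe p) := by
  have hp' : Measurable fun x : S × A => p x.1 x.2 := hp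
  have hd : Measurable fun x : S × A => πe.dens x.1 x.2 := πe.measurable_dens
  exact ((measurable_const.div hp').mul hd).sub (measurable_weight hn)

/-- Decomposition of the error: a term that is centred given the state and the action, a product of
the two estimation errors, and a term that is centred under `π_*`. -/
lemma drError_eq (hgb : ∀ s a, |g s a| ≤ C) (hg : Measurable (Function.uncurry g)) (o : Obs S A) :
    B.drError n πe p g o = B.weightError n πe p o.1 * (o.2 - B.q o.1.1 o.1.2)
      - B.weightError n πe p o.1 * (g o.1.1 o.1.2 - B.q o.1.1 o.1.2)
      - B.weight n πe o.1 * (g o.1.1 o.1.2 - B.q o.1.1 o.1.2)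
      + ∫ a, (g o.1.1 a - B.q o.1.1 a) ∂(densKernel ν πe.dens o.1.1) := by
  have h1 : Integrable (fun a => g o.1.1 a) (densKernel ν πe.dens o.1.1) :=
    Integrable.of_bound (hg.comp measurable_prodMk_left).aestronglyMeasurable C
      (Eventually.of_forall fun a => hgb _ _)
  have h2 : Integrable (fun a => B.q o.1.1 a) (densKernel ν πe.dens o.1.1) :=
    Integrable.of_bound (B.measurable_uncurry_q.comp measurable_prodMk_left).aestronglyMeasurable
      Rmax (Eventually.of_forall fun a => B.abs_q_le _ _)
  rw [integral_sub h1 h2, drError, drTerm, drScore, weightError, v]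
  ring

/-- Where `π_*` is positive, the error of the weight is bounded by the error of its denominator. -/
lemma abs_weightError_le (hw : ∀ x, |B.weight n πe x| ≤ C)
    (hp : ∀ s a, 0 < B.mix n s a → 0 < p s a ∧ 1 / p s a ≤ C) {x : S × A}
    (hx : 0 < B.mix n x.1 x.2) :
    |B.weightError n πe p x| ≤ C ^ 2 * |p x.1 x.2 - B.mix n x.1 x.2| := by
  obtain ⟨hp0, hpC⟩ := hp _ _ hx
  have hpC0 : 0 ≤ 1 / p x.1 x.2 := by positivity
  have h1 : B.weightError n πe p x
      = -(B.weight n πe x * (1 / p x.1 x.2) * (p x.1 x.2 - B.mix n x.1 x.2)) := by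
    rw [weightError, weight]
    field_simp
    ring
  rw [h1, abs_neg, abs_mul, abs_mul, abs_of_nonneg hpC0, sq]
  gcongr
  · exact hpC0.trans hpC
  · exact hw x

lemma abs_sub_q_le (hgb : ∀ s a, |g s a| ≤ C) (s : S) (a : A) : |g s a - B.q s a| ≤ C + Rmax :=
  (abs_sub _ _).trans (add_le_add (hgb s a) (B.abs_q_le s a))

section Bounds

variable (hn : 0 < ∑ k, n k) (hov : B.WeakOverlap n πe) (hC1 : 1 ≤ C)
  (hw : ∀ x, |B.weight n πe x| ≤ C) (hpm : Measurable (Function.uncurry p))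
  (hgm : Measurable (Function.uncurry g)) (hgb : ∀ s a, |g s a| ≤ C)
  (hp : ∀ s a, 0 < B.mix n s a → 0 < p s a ∧ 1 / p s a ≤ C)
  (hpL : MemLp (fun x : S × A => p x.1 x.2 - B.mix n x.1 x.2) 2 (B.saLaw (B.mix n)))

lemma memLp_sub_q (hgm : Measurable (Function.uncurry g)) (hgb : ∀ s a, |g s a| ≤ C)
    (π : Policy S A ν) :
    MemLp (fun x : S × A => g x.1 x.2 - B.q x.1 x.2) 2 (B.saLaw π.dens) :=
  MemLp.of_bound (hgm.sub B.measurable_uncurry_q).aestronglyMeasurable (C + Rmax)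
    (Eventually.of_forall fun x => abs_sub_q_le hgb x.1 x.2)

include hn hw hpm hp hpL in
lemma memLp_weightError : MemLp (B.weightError n πe p) 2 (B.saLaw (B.mix n)) := by
  refine hpL.of_le_mul (c := C ^ 2) (measurable_weightError hn hpm).aestronglyMeasurable ?_
  filter_upwards [B.ae_dens_pos (measurable_mix hn)] with x hx
  exact abs_weightError_le hw hp hx

include hn hw hp hpm hpL in
lemma integral_sq_weightError_le :
    ∫ x, B.weightError n πe p x ^ 2 ∂(B.saLaw (B.mix n))
      ≤ C ^ 4 * ∫ x, (p x.1 x.2 - B.mix n x.1 x.2) ^ 2 ∂(B.saLaw (B.mix n)) := by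
  rw [← integral_const_mul]
  refine integral_mono_ae (memLp_weightError hn hw hpm hp hpL).integrable_sq
    (hpL.integrable_sq.const_mul _) ?_
  filter_upwards [B.ae_dens_pos (measurable_mix hn)] with x hx
  have := pow_le_pow_left₀ (abs_nonneg _) (abs_weightError_le hw hp hx) 2
  rw [sq_abs, mul_pow, sq_abs] at this
  calc _ ≤ _ := this
    _ = _ := by ring

include hn hov hw hgm hgb in
/-- Averaging over the actions of `π^e` is bounded from `L²(π_*)` to `L²` of the states. -/
lemma integral_sq_integral_policy_le :
    ∫ s, (∫ a, (g s a - B.q s a) ∂(densKernel ν πe.dens s)) ^ 2 ∂B.stateLaw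
      ≤ C * ∫ x, (g x.1 x.2 - B.q x.1 x.2) ^ 2 ∂(B.saLaw (B.mix n)) := by
  have hdm : Measurable fun x : S × A => g x.1 x.2 - B.q x.1 x.2 := hgm.sub B.measurable_uncurry_q
  have hVe := (memLp_sub_q (B := B) hgm hgb πe).integrable_sq
  have hVm := (memLp_sub_q (B := B) hgm hgb (B.mixPolicy n hn)).integrable_sq
  have h1 : ∫ x, (g x.1 x.2 - B.q x.1 x.2) ^ 2 ∂(B.saLaw πe.dens)
      ≤ C * ∫ x, (g x.1 x.2 - B.q x.1 x.2) ^ 2 ∂(B.saLaw (B.mix n)) := by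
    rw [integral_saLaw_of_ac hn πe (hov.ae_dens hn), ← integral_const_mul]
    refine integral_mono (hVm.bdd_mul (c := C) (measurable_weight hn).aestronglyMeasurable
      (Eventually.of_forall hw)) (hVm.const_mul _) fun x => ?_
    exact mul_le_mul_of_nonneg_right ((le_abs_self _).trans (hw x)) (sq_nonneg _)
  refine le_trans ?_ h1
  rw [B.integral_saLaw πe hVe]
  have hbs (s : S) : MemLp (fun a => g s a - B.q s a) 2 (densKernel ν πe.dens s) :=
    MemLp.of_bound (hdm.comp measurable_prodMk_left).aestronglyMeasurable (C + Rmax)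
      (Eventually.of_forall fun a => abs_sub_q_le hgb s a)
  refine integral_mono ?_ ?_ fun s => ?_
  · refine Integrable.of_bound ((measurable_integral_policy πe
      (g := fun s a => g s a - B.q s a) hdm).pow_const 2).aestronglyMeasurable ((C + Rmax) ^ 2)
      (Eventually.of_forall fun s => ?_)
    rw [norm_pow]
    exact pow_le_pow_left₀ (norm_nonneg _)
      (abs_integral_policy_le πe (g := fun s a => g s a - B.q s a) (abs_sub_q_le hgb) s) 2
  · refine Integrable.of_bound (measurable_integral_policy πe
      (g := fun s a => (g s a - B.q s a) ^ 2) (hdm.pow_const 2)).aestronglyMeasurable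
      ((C + Rmax) ^ 2) (Eventually.of_forall fun s => ?_)
    refine abs_integral_policy_le πe (g := fun s a => (g s a - B.q s a) ^ 2) (fun s a => ?_) s
    rw [abs_pow]
    exact pow_le_pow_left₀ (abs_nonneg _) (abs_sub_q_le hgb s a) 2
  · have := sq_integral_mul_le (hbs s) (memLp_const (1 : ℝ))
    simpa using this

include hn hov hC1 hw hpm hgm hgb hp hpL in
/-- The second moment of the error is controlled by the errors of the nuisance functions. -/
lemma integral_sq_drError_le : MemLp (B.drError n πe p g) 2 (B.obsLaw (B.mix n)) ∧
    ∫ o, B.drError n πe p g o ^ 2 ∂(B.obsLaw (B.mix n))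
      ≤ 3 * (C ^ 4 * (Rmax + C) ^ 2 + 2 * C ^ 2)
        * (∫ x, (p x.1 x.2 - B.mix n x.1 x.2) ^ 2 ∂(B.saLaw (B.mix n))
          + ∫ x, (g x.1 x.2 - B.q x.1 x.2) ^ 2 ∂(B.saLaw (B.mix n))) := by
  have hR : 0 ≤ Rmax := B.nonneg_of_policy πe
  have hC0 : 0 ≤ C := zero_le_one.trans hC1
  have hdm : Measurable fun x : S × A => g x.1 x.2 - B.q x.1 x.2 := hgm.sub B.measurable_uncurry_q
  have hmpo := B.measurePreserving_fst_obsLaw (B.mix n)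
  have hmps : MeasurePreserving (fun o : Obs S A => o.1.1) (B.obsLaw (B.mix n)) B.stateLaw :=
    B.measurePreserving_state (B.mixPolicy n hn)
  have hW := memLp_weightError hn hw hpm hp hpL
  have hV : MemLp (fun x : S × A => g x.1 x.2 - B.q x.1 x.2) 2 (B.saLaw (B.mix n)) :=
    memLp_sub_q (B := B) hgm hgb (B.mixPolicy n hn)
  set v' : S → ℝ := fun s => ∫ a, (g s a - B.q s a) ∂(densKernel ν πe.dens s) with hv'
  have hv'm : Measurable v' := measurable_integral_policy πe (g := fun s a => g s a - B.q s a) hdm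
  have hv'2 : MemLp v' 2 B.stateLaw := MemLp.of_bound hv'm.aestronglyMeasurable (C + Rmax)
    (Eventually.of_forall fun s => abs_integral_policy_le πe (g := fun s a => g s a - B.q s a)
      (abs_sub_q_le hgb) s)
  set U : Obs S A → ℝ := fun o => 3 * ((Rmax + C) ^ 2 * B.weightError n πe p o.1 ^ 2
    + C ^ 2 * (g o.1.1 o.1.2 - B.q o.1.1 o.1.2) ^ 2 + v' o.1.1 ^ 2) with hU
  have iW : Integrable (fun o : Obs S A => B.weightError n πe p o.1 ^ 2) (B.obsLaw (B.mix n)) :=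
    hmpo.integrable_comp_of_integrable hW.integrable_sq
  have iV : Integrable (fun o : Obs S A => (g o.1.1 o.1.2 - B.q o.1.1 o.1.2) ^ 2)
      (B.obsLaw (B.mix n)) := hmpo.integrable_comp_of_integrable hV.integrable_sq
  have iv : Integrable (fun o : Obs S A => v' o.1.1 ^ 2) (B.obsLaw (B.mix n)) :=
    hmps.integrable_comp_of_integrable hv'2.integrable_sq
  have hUi : Integrable U (B.obsLaw (B.mix n)) :=
    (((iW.const_mul _).add (iV.const_mul _)).add iv).const_mul 3
  have hle : ∀ᵐ o ∂(B.obsLaw (B.mix n)), B.drError n πe p g o ^ 2 ≤ U o := by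
    filter_upwards [B.ae_reward_mem (B.mix n)] with o ho
    rw [drError_eq hgb hgm]
    set a := B.weightError n πe p o.1
    set d := g o.1.1 o.1.2 - B.q o.1.1 o.1.2
    have h1 : a * (o.2 - B.q o.1.1 o.1.2) - a * d - B.weight n πe o.1 * d + v' o.1.1
        = a * (o.2 - g o.1.1 o.1.2) + -(B.weight n πe o.1 * d) + v' o.1.1 := by
      simp only [d]; ring
    have h2 : (o.2 - g o.1.1 o.1.2) ^ 2 ≤ (Rmax + C) ^ 2 := by
      rw [← sq_abs]
      refine pow_le_pow_left₀ (abs_nonneg _) ((abs_sub _ _).trans (add_le_add ?_ (hgb _ _))) 2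
      rw [abs_of_nonneg ho.1]; exact ho.2
    have h3 : B.weight n πe o.1 ^ 2 ≤ C ^ 2 := by
      rw [← sq_abs]; exact pow_le_pow_left₀ (abs_nonneg _) (hw _) 2
    have h4 (x y z : ℝ) : (x + y + z) ^ 2 ≤ 3 * (x ^ 2 + y ^ 2 + z ^ 2) := by
      nlinarith [sq_nonneg (x - y), sq_nonneg (y - z), sq_nonneg (x - z)]
    change (a * (o.2 - B.q o.1.1 o.1.2) - a * d - B.weight n πe o.1 * d + v' o.1.1) ^ 2 ≤ _
    rw [h1]
    refine (h4 _ _ _).trans ?_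
    simp only [hU]
    have h5 : (a * (o.2 - g o.1.1 o.1.2)) ^ 2 ≤ (Rmax + C) ^ 2 * a ^ 2 := by
      rw [mul_pow, mul_comm]; exact mul_le_mul_of_nonneg_right h2 (sq_nonneg _)
    have h6 : (-(B.weight n πe o.1 * d)) ^ 2 ≤ C ^ 2 * d ^ 2 := by
      rw [neg_sq, mul_pow]; exact mul_le_mul_of_nonneg_right h3 (sq_nonneg _)
    linarith
  have hDm : Measurable (B.drError n πe p g) := measurable_drError hn hpm hgm
  have hDi : Integrable (fun o => B.drError n πe p g o ^ 2) (B.obsLaw (B.mix n)) := by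
    refine hUi.mono' (hDm.pow_const 2).aestronglyMeasurable ?_
    filter_upwards [hle] with o ho
    rwa [Real.norm_of_nonneg (sq_nonneg _)]
  refine ⟨(memLp_two_iff_integrable_sq hDm.aestronglyMeasurable).2 hDi,
    (integral_mono_ae hDi hUi hle).trans ?_⟩
  have e1 : ∫ o, B.weightError n πe p o.1 ^ 2 ∂(B.obsLaw (B.mix n))
      = ∫ x, B.weightError n πe p x ^ 2 ∂(B.saLaw (B.mix n)) := by
    rw [← hmpo.map_eq, integral_map measurable_fst.aemeasurable
      ((measurable_weightError hn hpm).pow_const 2).aestronglyMeasurable]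
  have e2 : ∫ o, (g o.1.1 o.1.2 - B.q o.1.1 o.1.2) ^ 2 ∂(B.obsLaw (B.mix n))
      = ∫ x, (g x.1 x.2 - B.q x.1 x.2) ^ 2 ∂(B.saLaw (B.mix n)) := by
    rw [← hmpo.map_eq, integral_map measurable_fst.aemeasurable
      (hdm.pow_const 2).aestronglyMeasurable]
  have e3 : ∫ o, v' o.1.1 ^ 2 ∂(B.obsLaw (B.mix n)) = ∫ s, v' s ^ 2 ∂B.stateLaw := by
    rw [← hmps.map_eq, integral_map hmps.measurable.aemeasurable
      (hv'm.pow_const 2).aestronglyMeasurable]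
  have hUe : ∫ o, U o ∂(B.obsLaw (B.mix n)) = 3 * ((Rmax + C) ^ 2
      * ∫ x, B.weightError n πe p x ^ 2 ∂(B.saLaw (B.mix n))
      + C ^ 2 * ∫ x, (g x.1 x.2 - B.q x.1 x.2) ^ 2 ∂(B.saLaw (B.mix n))
      + ∫ s, v' s ^ 2 ∂B.stateLaw) := by
    simp only [hU]
    rw [integral_const_mul, integral_add (by exact (iW.const_mul _).add (iV.const_mul _)) iv,
      integral_add (iW.const_mul _) (iV.const_mul _), integral_const_mul, integral_const_mul,
      e1, e2, e3]
  rw [hUe]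
  have b1 := integral_sq_weightError_le hn hw hpm hp hpL
  have b2 : ∫ s, v' s ^ 2 ∂B.stateLaw
      ≤ C * ∫ x, (g x.1 x.2 - B.q x.1 x.2) ^ 2 ∂(B.saLaw (B.mix n)) :=
    integral_sq_integral_policy_le hn hov hw hgm hgb
  set α := ∫ x, (p x.1 x.2 - B.mix n x.1 x.2) ^ 2 ∂(B.saLaw (B.mix n))
  set β := ∫ x, (g x.1 x.2 - B.q x.1 x.2) ^ 2 ∂(B.saLaw (B.mix n))
  have hα : 0 ≤ α := integral_nonneg fun _ => sq_nonneg _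
  have hβ : 0 ≤ β := integral_nonneg fun _ => sq_nonneg _
  have b3 : C * β ≤ C ^ 2 * β := by
    refine mul_le_mul_of_nonneg_right ?_ hβ
    nlinarith
  have b4 := mul_le_mul_of_nonneg_left b1 (sq_nonneg (Rmax + C))
  have b5 : 0 ≤ C ^ 4 * (Rmax + C) ^ 2 * β := by positivity
  have b6 : 0 ≤ C ^ 2 * α := by positivity
  nlinarith

include hn hov hw hpm hgm hgb hp hpL in
/-- The bias of the doubly robust summand under `π_*` is of the order of the product of the errors
of the two nuisance functions. -/
lemma sq_integral_drError_le :
    (∫ o, B.drError n πe p g o ∂(B.obsLaw (B.mix n))) ^ 2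
      ≤ C ^ 4 * (∫ x, (p x.1 x.2 - B.mix n x.1 x.2) ^ 2 ∂(B.saLaw (B.mix n)))
          * ∫ x, (g x.1 x.2 - B.q x.1 x.2) ^ 2 ∂(B.saLaw (B.mix n)) := by
  have hdm : Measurable fun x : S × A => g x.1 x.2 - B.q x.1 x.2 := hgm.sub B.measurable_uncurry_q
  have hmpo := B.measurePreserving_fst_obsLaw (B.mix n)
  have hmps : MeasurePreserving (fun o : Obs S A => o.1.1) (B.obsLaw (B.mix n)) B.stateLaw :=
    B.measurePreserving_state (B.mixPolicy n hn)
  have hW := memLp_weightError hn hw hpm hp hpL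
  have hV : MemLp (fun x : S × A => g x.1 x.2 - B.q x.1 x.2) 2 (B.saLaw (B.mix n)) :=
    memLp_sub_q (B := B) hgm hgb (B.mixPolicy n hn)
  have hWm : Measurable (B.weightError n πe p) := measurable_weightError hn hpm
  have hP : IsProbabilityMeasure (B.saLaw (B.mix n)) :=
    inferInstanceAs (IsProbabilityMeasure (B.saLaw (B.mixPolicy n hn).dens))
  have iW : Integrable (B.weightError n πe p) (B.saLaw (B.mix n)) := hW.integrable (by norm_num)
  have iV : Integrable (fun x : S × A => g x.1 x.2 - B.q x.1 x.2) (B.saLaw (B.mix n)) :=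
    hV.integrable (by norm_num)
  set v' : S → ℝ := fun s => ∫ a, (g s a - B.q s a) ∂(densKernel ν πe.dens s) with hv'
  have hv'm : Measurable v' := measurable_integral_policy πe (g := fun s a => g s a - B.q s a) hdm
  have iv : Integrable v' B.stateLaw := Integrable.of_bound hv'm.aestronglyMeasurable (C + Rmax)
    (Eventually.of_forall fun s => abs_integral_policy_le πe (g := fun s a => g s a - B.q s a)
      (abs_sub_q_le hgb) s)
  have iWV : Integrable (fun x : S × A => B.weightError n πe p x * (g x.1 x.2 - B.q x.1 x.2))
      (B.saLaw (B.mix n)) := hW.integrable_mul hV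
  have iwV : Integrable (fun x : S × A => B.weight n πe x * (g x.1 x.2 - B.q x.1 x.2))
      (B.saLaw (B.mix n)) := iV.bdd_mul (c := C) (measurable_weight hn).aestronglyMeasurable
        (Eventually.of_forall hw)
  have o1 : Integrable (fun o : Obs S A => B.weightError n πe p o.1 * (o.2 - B.q o.1.1 o.1.2))
      (B.obsLaw (B.mix n)) := B.integrable_mul_reward_sub (B.mixPolicy n hn) iW
  have o2 : Integrable (fun o : Obs S A =>
      B.weightError n πe p o.1 * (g o.1.1 o.1.2 - B.q o.1.1 o.1.2)) (B.obsLaw (B.mix n)) :=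
    hmpo.integrable_comp_of_integrable iWV
  have o3 : Integrable (fun o : Obs S A =>
      B.weight n πe o.1 * (g o.1.1 o.1.2 - B.q o.1.1 o.1.2)) (B.obsLaw (B.mix n)) :=
    hmpo.integrable_comp_of_integrable iwV
  have o4 : Integrable (fun o : Obs S A => v' o.1.1) (B.obsLaw (B.mix n)) :=
    hmps.integrable_comp_of_integrable iv
  have e1 : ∫ o, B.weightError n πe p o.1 * (o.2 - B.q o.1.1 o.1.2) ∂(B.obsLaw (B.mix n)) = 0 :=
    B.integral_mul_reward_sub (B.mixPolicy n hn) iW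
  have e2 : ∫ o, B.weightError n πe p o.1 * (g o.1.1 o.1.2 - B.q o.1.1 o.1.2)
      ∂(B.obsLaw (B.mix n))
      = ∫ x, B.weightError n πe p x * (g x.1 x.2 - B.q x.1 x.2) ∂(B.saLaw (B.mix n)) := by
    exact integral_fst_obs _ (F := fun x => B.weightError n πe p x * (g x.1 x.2 - B.q x.1 x.2))
      (hWm.mul hdm)
  have e3 : ∫ o, B.weight n πe o.1 * (g o.1.1 o.1.2 - B.q o.1.1 o.1.2) ∂(B.obsLaw (B.mix n))
      = ∫ x, B.weight n πe x * (g x.1 x.2 - B.q x.1 x.2) ∂(B.saLaw (B.mix n)) := by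
    exact integral_fst_obs _ (F := fun x => B.weight n πe x * (g x.1 x.2 - B.q x.1 x.2))
      ((measurable_weight hn).mul hdm)
  have e4 : ∫ o, v' o.1.1 ∂(B.obsLaw (B.mix n)) = ∫ s, v' s ∂B.stateLaw := by
    rw [← hmps.map_eq, integral_map hmps.measurable.aemeasurable hv'm.aestronglyMeasurable]
  have e5 : ∫ x, B.weight n πe x * (g x.1 x.2 - B.q x.1 x.2) ∂(B.saLaw (B.mix n))
      = ∫ s, v' s ∂B.stateLaw := by
    have h1 := integral_saLaw_of_ac hn πe (hov.ae_dens hn)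
      (fun x : S × A => g x.1 x.2 - B.q x.1 x.2)
    have h2 := B.integral_saLaw πe (g := fun x : S × A => g x.1 x.2 - B.q x.1 x.2)
      ((memLp_sub_q (B := B) hgm hgb πe).integrable (by norm_num))
    exact h1.symm.trans h2
  have hD : ∫ o, B.drError n πe p g o ∂(B.obsLaw (B.mix n))
      = -∫ x, B.weightError n πe p x * (g x.1 x.2 - B.q x.1 x.2) ∂(B.saLaw (B.mix n)) := by
    have : B.drError n πe p g = fun o => B.weightError n πe p o.1 * (o.2 - B.q o.1.1 o.1.2)
      - B.weightError n πe p o.1 * (g o.1.1 o.1.2 - B.q o.1.1 o.1.2)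
      - B.weight n πe o.1 * (g o.1.1 o.1.2 - B.q o.1.1 o.1.2) + v' o.1.1 :=
      funext fun o => drError_eq hgb hgm o
    rw [this, integral_add (by exact (o1.sub o2).sub o3) o4, integral_sub (by exact o1.sub o2) o3,
      integral_sub o1 o2, e1, e2, e3, e4, e5]
    ring
  rw [hD, neg_sq]
  refine (sq_integral_mul_le hW hV).trans ?_
  exact mul_le_mul_of_nonneg_right (integral_sq_weightError_le hn hw hpm hp hpL)
    (integral_nonneg fun _ => sq_nonneg _)

end Bounds

end Bandit

end Remainder

end OPE

namespace OPE

/-! ### The remainder in one fold -/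

section Fold

lemma eLpNorm_two_eq_ofReal_sqrt {α : Type*} [MeasurableSpace α] {μ : Measure α} {f : α → ℝ}
    (hf : MemLp f 2 μ) : eLpNorm f 2 μ = ENNReal.ofReal (√(∫ x, f x ^ 2 ∂μ)) := by
  rw [hf.eLpNorm_eq_integral_rpow_norm (by norm_num) (by norm_num), Real.sqrt_eq_rpow]
  simp

lemma measurable_eLpNorm_two {α β : Type*} [MeasurableSpace α] [MeasurableSpace β]
    {μ : Measure β} [SFinite μ] {F : α × β → ℝ} (hF : Measurable F) :
    Measurable fun x => eLpNorm (fun y => F (x, y)) 2 μ := by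
  simp_rw [eLpNorm_eq_lintegral_rpow_enorm_toReal (p := 2) (by norm_num) (by norm_num)]
  exact (Measurable.lintegral_prod_right' (f := fun z => ‖F z‖ₑ ^ (2 : ℝ≥0∞).toReal)
    (hF.enorm.pow_const _)).pow_const _

variable {S A : Type*} [MeasurableSpace S] [MeasurableSpace A] {ν : Measure A} [SFinite ν]
  {Rmax : ℝ} {K : ℕ} {B : Bandit S A ν Rmax K} {n : Fin K → ℕ} {πe : Policy S A ν}

lemma sum_evalFold {Z : ℕ} {N : Fin K → ℕ} (f : Idx N → Fin Z) (z : Fin Z) (c : Fin K → ℝ) :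
    ∑ p ∈ evalFold f z, c p.1
      = ∑ k, ((Finset.univ.filter fun i : Fin (N k) => f ⟨k, i⟩ = z).card : ℝ) * c k := by
  rw [evalFold, Finset.sum_filter, Fintype.sum_sigma]
  refine Finset.sum_congr rfl fun k _ => ?_
  rw [← Finset.sum_filter]
  exact (Finset.sum_const (c k)).trans (nsmul_eq_mul _ _)

namespace Bandit

lemma memLp_obsLaw_logging (hn : 0 < ∑ k, n k) {D : Obs S A → ℝ}
    (hD : MemLp D 2 (B.obsLaw (B.mix n))) {k : Fin K} (hk : 0 < n k) :
    MemLp D 2 (B.obsLaw (B.logging k).dens) :=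
  hD.of_measure_le_smul (c := ((∑ j, n j : ℕ) : ℝ≥0∞)) (ENNReal.natCast_ne_top _)
    (obsLaw_logging_le hn hk)

/-- The conditional second moment of a sum over one fold. As the fold contains about the fraction
`1 / Z` of every stratum, the mean of the sum is that of the same number of draws from the mixture,
up to an error that does not grow with the sample size. -/
lemma sq_sum_integral_add_le (hn : 0 < ∑ k, n k) {D : Obs S A → ℝ}
    (hD : MemLp D 2 (B.obsLaw (B.mix n))) {Z m : ℕ} (hm : 0 < m)
    {f : Idx (fun k => m * n k) → Fin Z} (hf : IsEvenPartition f) (z : Fin Z) :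
    (∑ p ∈ evalFold f z, ∫ o, D o ∂(B.obsLaw (B.logging p.1).dens)) ^ 2
        + ∑ p ∈ evalFold f z, ∫ o, D o ^ 2 ∂(B.obsLaw (B.logging p.1).dens)
      ≤ 2 * ((∑ k, m * n k : ℕ) : ℝ) ^ 2 * (∫ o, D o ∂(B.obsLaw (B.mix n))) ^ 2
        + (2 * K + 1) * ((∑ k, m * n k : ℕ) : ℝ) * ∫ o, D o ^ 2 ∂(B.obsLaw (B.mix n)) := by
  have hP : IsProbabilityMeasure (B.obsLaw (B.mix n)) :=
    inferInstanceAs (IsProbabilityMeasure (B.obsLaw (B.mixPolicy n hn).dens))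
  have hZ : (1 : ℝ) ≤ Z := by exact_mod_cast z.pos
  have hm1 : (1 : ℝ) ≤ m := by exact_mod_cast hm
  set n₀ : ℝ := ((∑ k, n k : ℕ) : ℝ) with hn₀
  have hn0 : 0 < n₀ := by rw [hn₀]; exact_mod_cast hn
  have hN : ((∑ k, m * n k : ℕ) : ℝ) = m * n₀ := by
    rw [← Finset.mul_sum, Nat.cast_mul]
  rw [hN]
  set d : Fin K → ℝ := fun k => ∫ o, D o ∂(B.obsLaw (B.logging k).dens) with hd
  set e : Fin K → ℝ := fun k => ∫ o, D o ^ 2 ∂(B.obsLaw (B.logging k).dens) with he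
  have he0 (k : Fin K) : 0 ≤ e k := integral_nonneg fun _ => sq_nonneg _
  have hde (k : Fin K) (hk : 0 < n k) : d k ^ 2 ≤ e k := by
    have := sq_integral_mul_le (memLp_obsLaw_logging hn hD hk) (memLp_const (1 : ℝ))
    simpa using this
  have hsd : ∑ k, (n k : ℝ) * d k = n₀ * ∫ o, D o ∂(B.obsLaw (B.mix n)) := by
    rw [integral_obsLaw_mix hn (hD.integrable (by norm_num)), Finset.mul_sum]
    refine Finset.sum_congr rfl fun k _ => ?_
    rw [← hn₀]; simp only [d]; field_simp
  have hse : ∑ k, (n k : ℝ) * e k = n₀ * ∫ o, D o ^ 2 ∂(B.obsLaw (B.mix n)) := by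
    rw [integral_obsLaw_mix hn hD.integrable_sq, Finset.mul_sum]
    refine Finset.sum_congr rfl fun k _ => ?_
    rw [← hn₀]; simp only [e]; field_simp
  set ℓ : Fin K → ℝ :=
    fun k => ((Finset.univ.filter fun i : Fin (m * n k) => f ⟨k, i⟩ = z).card : ℝ) with hℓ
  have h1 : ∑ p ∈ evalFold f z, d p.1 = m * n₀ / Z * ∫ o, D o ∂(B.obsLaw (B.mix n))
      + ∑ k, (ℓ k - ((m * n k : ℕ) : ℝ) / Z) * d k := by
    rw [sum_evalFold f z d]
    have : (m : ℝ) * n₀ / Z * ∫ o, D o ∂(B.obsLaw (B.mix n))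
        = ∑ k, ((m * n k : ℕ) : ℝ) / Z * d k := by
      rw [mul_div_right_comm, mul_assoc, ← hsd, Finset.mul_sum]
      refine Finset.sum_congr rfl fun k _ => ?_
      push_cast; ring
    rw [this, ← Finset.sum_add_distrib]
    refine Finset.sum_congr rfl fun k _ => ?_
    ring
  have h2 : (∑ k, (ℓ k - ((m * n k : ℕ) : ℝ) / Z) * d k) ^ 2 ≤ K * ∑ k, (n k : ℝ) * e k := by
    have := sq_sum_le_card_mul_sum_sq (s := Finset.univ)
      (f := fun k => (ℓ k - ((m * n k : ℕ) : ℝ) / Z) * d k)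
    rw [Finset.card_univ, Fintype.card_fin] at this
    refine this.trans (mul_le_mul_of_nonneg_left (Finset.sum_le_sum fun k _ => ?_)
      (Nat.cast_nonneg K))
    rcases Nat.eq_zero_or_pos (n k) with hk | hk
    · have hl : ℓ k = 0 := by
        have : IsEmpty (Fin (m * n k)) := by rw [hk]; exact Fin.isEmpty
        simp only [hℓ]
        rw [Finset.univ_eq_empty]; simp
      simp [hl, hk]
    · have hev : (ℓ k - ((m * n k : ℕ) : ℝ) / Z) ^ 2 ≤ 1 := by
        have := hf k z
        rw [← sq_abs]
        exact pow_le_one₀ (abs_nonneg _) this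
      have hk1 : (1 : ℝ) ≤ n k := by exact_mod_cast hk
      rw [mul_pow]
      calc _ ≤ 1 * d k ^ 2 := mul_le_mul_of_nonneg_right hev (sq_nonneg _)
        _ ≤ 1 * e k := by simpa using hde k hk
        _ ≤ n k * e k := mul_le_mul_of_nonneg_right hk1 (he0 k)
  have h3 : ∑ p ∈ evalFold f z, e p.1 ≤ m * (n₀ * ∫ o, D o ^ 2 ∂(B.obsLaw (B.mix n))) := by
    calc ∑ p ∈ evalFold f z, e p.1 ≤ ∑ p : Idx (fun k => m * n k), e p.1 :=
          Finset.sum_le_sum_of_subset_of_nonneg (Finset.subset_univ _) fun p _ _ => he0 _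
      _ = _ := by
          rw [sum_idx_eq, ← hse, Finset.mul_sum]
          refine Finset.sum_congr rfl fun k _ => ?_
          push_cast; ring
  change (∑ p ∈ evalFold f z, d p.1) ^ 2 + ∑ p ∈ evalFold f z, e p.1 ≤ _
  rw [hse] at h2
  set a := ∫ o, D o ∂(B.obsLaw (B.mix n))
  set b := ∫ o, D o ^ 2 ∂(B.obsLaw (B.mix n))
  set r := ∑ k, (ℓ k - ((m * n k : ℕ) : ℝ) / Z) * d k
  have hb : 0 ≤ b := integral_nonneg fun _ => sq_nonneg _
  have h4 : (m * n₀ / Z * a) ^ 2 ≤ (m * n₀) ^ 2 * a ^ 2 := by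
    rw [mul_pow]
    refine mul_le_mul_of_nonneg_right (pow_le_pow_left₀ (by positivity) ?_ 2) (sq_nonneg _)
    exact div_le_self (by positivity) hZ
  have h5 : K * (n₀ * b) ≤ K * (m * (n₀ * b)) :=
    mul_le_mul_of_nonneg_left (le_mul_of_one_le_left (by positivity) hm1) (Nat.cast_nonneg K)
  rw [h1]
  nlinarith [sq_nonneg (m * n₀ / Z * a - r)]

/-- The event that, given the training data, the estimates of the nuisance functions have errors
below `δ` whose product is below `δ ρ`. -/
def nuisanceEvent (B : Bandit S A ν Rmax K) (n : Fin K → ℕ) {N : Fin K → ℕ}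
    (phat ghat : Dataset S A N → S → A → ℝ) (δ ρ : ℝ) : Set (Dataset S A N) :=
  {x | B.l2 n (fun s a => ghat x s a - B.q s a) < ENNReal.ofReal δ ∧
    B.l2 n (fun s a => phat x s a - B.mix n s a) < ENNReal.ofReal δ ∧
    B.l2 n (fun s a => ghat x s a - B.q s a) * B.l2 n (fun s a => phat x s a - B.mix n s a)
      < ENNReal.ofReal (δ * ρ)}

section NuisanceEvent

variable {N : Fin K → ℕ} {phat ghat : Dataset S A N → S → A → ℝ}
  (hp : Measurable fun y : Dataset S A N × (S × A) => phat y.1 y.2.1 y.2.2)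
  (hg : Measurable fun y : Dataset S A N × (S × A) => ghat y.1 y.2.1 y.2.2)

include hp hg in
lemma measurableSet_nuisanceEvent (hn : 0 < ∑ k, n k) (δ ρ : ℝ) :
    MeasurableSet (B.nuisanceEvent n phat ghat δ ρ) := by
  have hpm := measurable_eLpNorm_two (μ := B.saLaw (B.mix n))
    (hp.sub ((measurable_mix (B := B) hn).comp measurable_snd))
  have hgm := measurable_eLpNorm_two (μ := B.saLaw (B.mix n))
    (hg.sub (B.measurable_uncurry_q.comp measurable_snd))
  exact (measurableSet_lt hgm measurable_const).inter ((measurableSet_lt hpm measurable_const).inter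
    (measurableSet_lt (hgm.mul hpm) measurable_const))

include hp hg in
lemma measurable_drTerm_joint :
    Measurable fun y : Dataset S A N × Obs S A => drTerm πe (phat y.1) (ghat y.1) y.2 := by
  have hφ : Measurable fun y : Dataset S A N × Obs S A => (y.1, y.2.1) := by fun_prop
  have hint : Measurable fun y : Dataset S A N × S =>
      ∫ a, ghat y.1 y.2 a ∂(densKernel ν πe.dens y.2) := by
    have hg' : StronglyMeasurable fun w : (Dataset S A N × S) × A => ghat w.1.1 w.1.2 w.2 := by
      have : Measurable fun w : (Dataset S A N × S) × A => (w.1.1, (w.1.2, w.2)) := by fun_prop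
      exact (hg.comp this).stronglyMeasurable
    exact (hg'.integral_kernel_prod_right'
      (κ := (densKernel ν πe.dens).comap Prod.snd measurable_snd)).measurable
  have hd : Measurable fun x : S × A => πe.dens x.1 x.2 := πe.measurable_dens
  have hψ : Measurable fun y : Dataset S A N × Obs S A => (y.1, y.2.1.1) := by fun_prop
  unfold drTerm
  exact (((measurable_const.div (hp.comp hφ)).mul
    (hd.comp (measurable_fst.comp measurable_snd))).mul
    ((measurable_snd.comp measurable_snd).sub (hg.comp hφ))).add (hint.comp hψ)

end NuisanceEvent

lemma sq_integral_le_of_l2_lt {u : S → A → ℝ} {δ : ℝ} (hu : Measurable (Function.uncurry u))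
    (h : B.l2 n u < ENNReal.ofReal δ) :
    MemLp (fun x : S × A => u x.1 x.2) 2 (B.saLaw (B.mix n)) ∧
      B.l2 n u = ENNReal.ofReal (√(∫ x, u x.1 x.2 ^ 2 ∂(B.saLaw (B.mix n)))) ∧
      ∫ x, u x.1 x.2 ^ 2 ∂(B.saLaw (B.mix n)) ≤ δ ^ 2 := by
  have hL : MemLp (fun x : S × A => u x.1 x.2) 2 (B.saLaw (B.mix n)) :=
    ⟨hu.aestronglyMeasurable, h.trans ENNReal.ofReal_lt_top⟩
  have he : B.l2 n u = _ := eLpNorm_two_eq_ofReal_sqrt hL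
  refine ⟨hL, he, ?_⟩
  have h0 : 0 ≤ ∫ x, u x.1 x.2 ^ 2 ∂(B.saLaw (B.mix n)) := integral_nonneg fun _ => sq_nonneg _
  rw [he] at h
  rw [← Real.sq_sqrt h0]
  exact pow_le_pow_left₀ (Real.sqrt_nonneg _) (ENNReal.ofReal_lt_ofReal_iff'.1 h).1.le 2

/-- The constant in the bound on the remainder of one fold. -/
noncomputable def remainderConst (K : ℕ) (Rmax C : ℝ) : ℝ :=
  2 * C ^ 4 + (2 * K + 1) * (6 * (C ^ 4 * (Rmax + C) ^ 2 + 2 * C ^ 2))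

/-- While the nuisance functions are well estimated, the normalised sum over one fold of the errors
of the summands is small in probability. -/
lemma measure_nuisanceEvent_inter_le (hn : 0 < ∑ k, n k) (hov : B.WeakOverlap n πe) {C : ℝ}
    (hC1 : 1 ≤ C) (hw : ∀ x, |B.weight n πe x| ≤ C) {Z m : ℕ} (hm : 0 < m)
    (qhat pihat : CrossFit S A Z (fun k => m * n k))
    (hgb : ∀ f z x s a, |qhat.est f z x s a| ≤ C)
    (hp : ∀ f z x s a, 0 < B.mix n s a →
      0 < pihat.est f z x s a ∧ 1 / pihat.est f z x s a ≤ C)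
    {f : Idx (fun k => m * n k) → Fin Z} (hf : IsEvenPartition f) (z : Fin Z) {δ ε : ℝ}
    (hε : 0 < ε) :
    B.dataLaw (fun k => m * n k) (B.nuisanceEvent n (pihat.est f z) (qhat.est f z) δ
        (((∑ k, m * n k : ℕ) : ℝ) ^ (-(1 / 2) : ℝ)) ∩
      {x | ε * √((∑ k, m * n k : ℕ) : ℝ) ≤ |∑ p ∈ evalFold f z,
        B.drError n πe (pihat.est f z x) (qhat.est f z x) (x p)|})
      ≤ ENNReal.ofReal (remainderConst K Rmax C * δ ^ 2 / ε ^ 2) := by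
  have hN : (0 : ℝ) < ((∑ k, m * n k : ℕ) : ℝ) := by
    rw [← Finset.mul_sum]; exact_mod_cast Nat.mul_pos hm hn
  set N : ℝ := ((∑ k, m * n k : ℕ) : ℝ) with hNdef
  have hnot (p : Idx fun k => m * n k) : p ∉ evalFold f z ↔ f p ≠ z := by simp [evalFold]
  have hpdep (x y : Dataset S A fun k => m * n k) (h : ∀ i ∉ evalFold f z, x i = y i) :
      pihat.est f z x = pihat.est f z y :=
    pihat.dependsOn_train f z fun i hi => h i ((hnot i).2 hi)
  have hqdep (x y : Dataset S A fun k => m * n k) (h : ∀ i ∉ evalFold f z, x i = y i) :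
      qhat.est f z x = qhat.est f z y :=
    qhat.dependsOn_train f z fun i hi => h i ((hnot i).2 hi)
  have hpm (x) : Measurable (Function.uncurry (pihat.est f z x)) :=
    (pihat.measurable_est f z).comp measurable_prodMk_left
  have hqm (x) : Measurable (Function.uncurry (qhat.est f z x)) :=
    (qhat.measurable_est f z).comp measurable_prodMk_left
  have hconst : remainderConst K Rmax C * δ ^ 2 / ε ^ 2
      = N * (remainderConst K Rmax C * δ ^ 2) / (ε * √N) ^ 2 := by
    rw [mul_pow, Real.sq_sqrt hN.le]
    field_simp
  rw [hconst]
  refine measure_inter_sum_ge_le (fun p : Idx fun k => m * n k => B.obsLaw (B.logging p.1).dens)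
    (s := evalFold f z)
    (D := fun _ x o => B.drError n πe (pihat.est f z x) (qhat.est f z x) o)
    (measurableSet_nuisanceEvent (pihat.measurable_est f z) (qhat.measurable_est f z) hn δ _)
    (fun _ => (measurable_drTerm_joint (pihat.measurable_est f z) (qhat.measurable_est f z)).sub
      ((measurable_drScore hn).comp measurable_snd)) ?_ ?_ (by positivity) ?_
  · intro x y hxy hx
    simpa only [nuisanceEvent, Set.mem_ofPred_eq, hpdep x y hxy, hqdep x y hxy] using hx
  · intro p _ x y hxy
    rw [hpdep x y hxy, hqdep x y hxy]
  · rintro x ⟨hx1, hx2, hx3⟩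
    obtain ⟨-, q2, q3⟩ := sq_integral_le_of_l2_lt (u := fun s a => qhat.est f z x s a - B.q s a)
      ((hqm x).sub B.measurable_uncurry_q) hx1
    obtain ⟨p1, p2, p3⟩ := sq_integral_le_of_l2_lt
      (u := fun s a => pihat.est f z x s a - B.mix n s a) ((hpm x).sub (measurable_mix hn)) hx2
    rw [q2, p2, ← ENNReal.ofReal_mul (Real.sqrt_nonneg _), ← Real.sqrt_mul
      (integral_nonneg fun _ => sq_nonneg _)] at hx3
    have hx4 := (ENNReal.ofReal_lt_ofReal_iff'.1 hx3).1
    obtain ⟨b1, b2⟩ := integral_sq_drError_le hn hov hC1 hw (hpm x) (hqm x)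
      (fun s a => hgb f z x s a) (fun s a => hp f z x s a) p1
    have b3 := sq_integral_drError_le hn hov hw (hpm x) (hqm x)
      (fun s a => hgb f z x s a) (fun s a => hp f z x s a) p1
    refine ⟨fun p _ => memLp_obsLaw_logging hn b1 ?_, ?_⟩
    · exact Nat.pos_of_mul_pos_left (idx_pos p)
    refine (sq_sum_integral_add_le hn b1 hm hf z).trans ?_
    rw [← hNdef]
    set α := ∫ x_1, (pihat.est f z x x_1.1 x_1.2 - B.mix n x_1.1 x_1.2) ^ 2
      ∂(B.saLaw (B.mix n))
    set β := ∫ x_1, (qhat.est f z x x_1.1 x_1.2 - B.q x_1.1 x_1.2) ^ 2 ∂(B.saLaw (B.mix n))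
    have hα : 0 ≤ α := integral_nonneg fun _ => sq_nonneg _
    have hβ : 0 ≤ β := integral_nonneg fun _ => sq_nonneg _
    have h1 : N * (α * β) ≤ δ ^ 2 := by
      have h2 := pow_le_pow_left₀ (Real.sqrt_nonneg _) hx4.le 2
      have h3 : (N ^ (-(1 / 2) : ℝ)) ^ 2 = N⁻¹ := by
        rw [← Real.rpow_natCast, ← Real.rpow_mul hN.le]
        norm_num [Real.rpow_neg_one]
      rw [Real.sq_sqrt (mul_nonneg hβ hα), mul_pow, h3] at h2
      calc N * (α * β) = N * (β * α) := by ring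
        _ ≤ N * (δ ^ 2 * N⁻¹) := mul_le_mul_of_nonneg_left h2 hN.le
        _ = δ ^ 2 := by field_simp
    have hC4 : 0 ≤ C ^ 4 := by positivity
    have hc : 0 ≤ 3 * (C ^ 4 * (Rmax + C) ^ 2 + 2 * C ^ 2) := by positivity
    have h5 : N ^ 2 * (∫ o, B.drError n πe (pihat.est f z x) (qhat.est f z x) o
        ∂(B.obsLaw (B.mix n))) ^ 2 ≤ N * (C ^ 4 * δ ^ 2) := by
      calc _ ≤ N ^ 2 * (C ^ 4 * α * β) := mul_le_mul_of_nonneg_left b3 (by positivity)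
        _ = N * (C ^ 4 * (N * (α * β))) := by ring
        _ ≤ _ := by gcongr
    have h6 : ∫ o, B.drError n πe (pihat.est f z x) (qhat.est f z x) o ^ 2
        ∂(B.obsLaw (B.mix n)) ≤ 3 * (C ^ 4 * (Rmax + C) ^ 2 + 2 * C ^ 2) * (δ ^ 2 + δ ^ 2) :=
      b2.trans (mul_le_mul_of_nonneg_left (add_le_add p3 q3) hc)
    have h7 := mul_le_mul_of_nonneg_left h6 (show 0 ≤ (2 * (K : ℝ) + 1) * N by positivity)
    rw [remainderConst]
    linarith

end Bandit

end Fold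

end OPE

namespace OPE

/-! ### Random partitions, and the reduction to the oracle estimator -/

section Transfer

/-- A bound that holds for every admissible value of an independent finite-valued variable holds
for the variable itself. -/
lemma measure_indep_mem_le {Ω Φ E : Type*} [MeasurableSpace Ω] [MeasurableSpace E] [Finite Φ]
    [MeasurableSpace Φ] [MeasurableSingletonClass Φ] {P : Measure Ω} [IsProbabilityMeasure P]
    {μ : Measure E} {φ : Ω → Φ} {x : Ω → E} (hφ : Measurable φ) (hx : HasLaw x μ P)
    (h : IndepFun φ x P) {p : Φ → Prop} (hp : ∀ᵐ ω ∂P, p (φ ω)) {s : Φ → Set E}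
    (hs : ∀ f, MeasurableSet (s f)) {b : ℝ≥0∞} (hb : ∀ f, p f → μ (s f) ≤ b) :
    P {ω | x ω ∈ s (φ ω)} ≤ b := by
  have := Fintype.ofFinite Φ
  have hterm (f : Φ) : P (φ ⁻¹' {f} ∩ x ⁻¹' s f) ≤ P (φ ⁻¹' {f}) * b := by
    by_cases hf : p f
    · rw [h.measure_inter_preimage_eq_mul _ _ (measurableSet_singleton f) (hs f),
        ← Measure.map_apply_of_aemeasurable hx.aemeasurable (hs f), hx.map_eq]
      gcongr
      exact hb f hf
    · refine le_of_eq_of_le (measure_mono_null (fun ω hω => ?_) (ae_iff.1 hp)) zero_le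
      have : φ ω = f := hω.1
      change ¬ p (φ ω)
      rwa [this]
  calc P {ω | x ω ∈ s (φ ω)} ≤ P (⋃ f, φ ⁻¹' {f} ∩ x ⁻¹' s f) :=
        measure_mono fun ω hω => Set.mem_iUnion.2 ⟨φ ω, rfl, hω⟩
    _ ≤ ∑ f, P (φ ⁻¹' {f} ∩ x ⁻¹' s f) := measure_iUnion_fintype_le _ _
    _ ≤ ∑ f, P (φ ⁻¹' {f}) * b := Finset.sum_le_sum fun f _ => hterm f
    _ = b := by
        rw [← Finset.sum_mul, sum_measure_preimage_singleton _
          fun f _ => hφ (measurableSet_singleton f)]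
        simp

end Transfer

section Oracle

variable {S A : Type*} [MeasurableSpace S] [MeasurableSpace A] {ν : Measure A} [SFinite ν]
  {Rmax : ℝ} {K Z : ℕ} {B : Bandit S A ν Rmax K} {n : Fin K → ℕ} {πe : Policy S A ν}

/-- The sum over the observations of fold `z` of the errors of the summands of the cross-fitted
estimator. -/
noncomputable def Bandit.foldError (B : Bandit S A ν Rmax K) (n : Fin K → ℕ) (πe : Policy S A ν)
    {N : Fin K → ℕ} (qhat pihat : CrossFit S A Z N) (f : Idx N → Fin Z) (z : Fin Z)
    (x : Dataset S A N) : ℝ :=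
  ∑ p ∈ evalFold f z, B.drError n πe (pihat.est f z x) (qhat.est f z x) (x p)

lemma JDR_eq {N : Fin K → ℕ} (qhat pihat : CrossFit S A Z N) (f : Idx N → Fin Z)
    (x : Dataset S A N) : JDR πe qhat pihat f x
      = ((∑ k, N k : ℕ) : ℝ)⁻¹
        * ∑ z, ∑ p ∈ evalFold f z, drTerm πe (pihat.est f z x) (qhat.est f z x) (x p) := by
  rw [JDR, JBI]
  congr 1
  refine Finset.sum_congr rfl fun z _ => ?_
  rw [Gam, ← mul_assoc]
  rcases Nat.eq_zero_or_pos (evalFold f z).card with h | h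
  · rw [Finset.card_eq_zero.1 h]; simp
  · rw [mul_inv_cancel₀ (by exact_mod_cast h.ne'), one_mul]
    rfl

/-- The cross-fitted estimator is the average of the influence functions, up to the errors of its
summands. -/
lemma sqrt_mul_JDR_sub {N : Fin K → ℕ} (qhat pihat : CrossFit S A Z N) (f : Idx N → Fin Z)
    (x : Dataset S A N) :
    √((∑ k, N k : ℕ) : ℝ) * (JDR πe qhat pihat f x - B.value πe)
      = (√((∑ k, N k : ℕ) : ℝ))⁻¹ * ∑ p, (B.drScore n πe (x p) - B.value πe)
        + (√((∑ k, N k : ℕ) : ℝ))⁻¹ * ∑ z, B.foldError n πe qhat pihat f z x := by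
  have h1 : ∑ z, ∑ p ∈ evalFold f z, drTerm πe (pihat.est f z x) (qhat.est f z x) (x p)
      = ∑ p, B.drScore n πe (x p) + ∑ z, B.foldError n πe qhat pihat f z x := by
    rw [← Finset.sum_fiberwise (s := Finset.univ) (g := f), ← Finset.sum_add_distrib]
    refine Finset.sum_congr rfl fun z _ => ?_
    rw [Bandit.foldError, evalFold, ← Finset.sum_add_distrib]
    refine Finset.sum_congr rfl fun p _ => ?_
    rw [Bandit.drError]; ring
  have h2 : ∑ p : Idx N, (B.drScore n πe (x p) - B.value πe)
      = ∑ p, B.drScore n πe (x p) - ((∑ k, N k : ℕ) : ℝ) * B.value πe := by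
    rw [Finset.sum_sub_distrib, sum_idx_eq (fun _ => B.value πe), ← Finset.sum_mul, ← Nat.cast_sum]
  rw [JDR_eq, h1, h2]
  set r : ℝ := ((∑ k, N k : ℕ) : ℝ)
  have hr : 0 ≤ r := Nat.cast_nonneg _
  rcases hr.eq_or_lt with h | h
  · simp [← h]
  · obtain ⟨w, hw, hwr⟩ : ∃ w, √r = w ∧ r = w * w := ⟨√r, rfl, (Real.mul_self_sqrt hr).symm⟩
    have hw0 : w ≠ 0 := hw ▸ (Real.sqrt_pos.2 h).ne'
    rw [hw, hwr]
    field_simp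
    ring

lemma measurable_foldError (hn : 0 < ∑ k, n k) {N : Fin K → ℕ} (qhat pihat : CrossFit S A Z N)
    (f : Idx N → Fin Z) (z : Fin Z) : Measurable (B.foldError n πe qhat pihat f z) :=
  Finset.measurable_fun_sum _ fun p _ =>
    ((Bandit.measurable_drTerm_joint (pihat.measurable_est f z) (qhat.measurable_est f z)).sub
      ((Bandit.measurable_drScore hn).comp measurable_snd)).comp
      (measurable_id.prodMk (measurable_pi_apply p))

lemma measurable_JDR {N : Fin K → ℕ} (qhat pihat : CrossFit S A Z N) (f : Idx N → Fin Z) :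
    Measurable (JDR πe qhat pihat f) := by
  simp_rw [funext fun x => JDR_eq (πe := πe) qhat pihat f x]
  exact (Finset.measurable_fun_sum _ fun z _ => Finset.measurable_fun_sum _ fun p _ =>
    (Bandit.measurable_drTerm_joint (pihat.measurable_est f z) (qhat.measurable_est f z)).comp
      (measurable_id.prodMk (measurable_pi_apply p))).const_mul _

end Oracle

/-! ### The limit law of the oracle estimator -/

section CLT

lemma sum_range_mul_eq {g : ℕ → ℝ} (m a : ℕ) :
    ∑ i ∈ Finset.range (m * a), g i
      = ∑ j ∈ Finset.range m, ∑ i ∈ Finset.range a, g (j * a + i) := by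
  induction m with
  | zero => simp
  | succ m ih => rw [Nat.succ_mul, Finset.sum_range_add, ih, Finset.sum_range_succ]

/-- A stratified sample of `m` times the stratum sizes consists of `m` blocks. -/
lemma sum_idx_blocks {K : ℕ} {n : Fin K → ℕ} (m : ℕ) (F : Fin K → ℕ → ℝ) :
    ∑ p : Idx (fun k => m * n k), F p.1 p.2
      = ∑ j ∈ Finset.range m, ∑ p : Idx n, F p.1 (j * n p.1 + p.2) := by
  simp_rw [Fintype.sum_sigma]
  rw [Finset.sum_comm]
  refine Finset.sum_congr rfl fun k _ => ?_
  rw [Fin.sum_univ_eq_sum_range (fun i => F k i), sum_range_mul_eq]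
  refine Finset.sum_congr rfl fun j _ => ?_
  rw [Fin.sum_univ_eq_sum_range (fun i => F k (j * n k + i))]

lemma injective_block {K : ℕ} (n : Fin K → ℕ) :
    Function.Injective fun p : ℕ × Idx n => (p.2.1, p.1 * n p.2.1 + (p.2.2 : ℕ)) := by
  rintro ⟨i, k, a⟩ ⟨j, l, b⟩ h
  simp only [Prod.mk.injEq] at h
  obtain ⟨rfl, h⟩ := h
  have hpos : 0 < n k := a.pos
  have h1 : i = j := by
    have := congrArg (· / n k) h
    simpa [Nat.add_div_of_dvd_right, Nat.mul_add_div, mul_comm _ (n k), Nat.div_eq_of_lt a.2,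
      Nat.div_eq_of_lt b.2, Nat.mul_add_div hpos] using this
  subst h1
  have h2 : a = b := Fin.ext (by omega)
  rw [h2]

variable {S A Ω : Type*} [MeasurableSpace S] [MeasurableSpace A] [MeasurableSpace Ω]
  {ν : Measure A} [SFinite ν] {Rmax : ℝ} {K : ℕ} {B : Bandit S A ν Rmax K} {n : Fin K → ℕ}
  {πe : Policy S A ν} {P : Measure Ω} [IsProbabilityMeasure P] {X : Fin K → ℕ → Ω → Obs S A}

lemma hasLaw_dataset (hX : ∀ k i, HasLaw (X k i) (B.obsLaw (B.logging k).dens) P)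
    (hindep : iIndepFun (fun p : Fin K × ℕ => X p.1 p.2) P) (N : Fin K → ℕ) :
    HasLaw (fun ω (p : Idx N) => X p.1 p.2 ω) (B.dataLaw N) P := by
  have hinj : Function.Injective fun p : Idx N => (p.1, (p.2 : ℕ)) := by
    rintro ⟨k, a⟩ ⟨l, b⟩ h
    simp only [Prod.mk.injEq] at h
    obtain ⟨rfl, h⟩ := h
    rw [Fin.ext h]
  exact (hindep.precomp hinj).hasLaw_pi fun p => hX p.1 p.2

/-- The average of the influence functions is asymptotically normal: it is an average of
independent blocks, each distributed as one data set of the original stratum sizes. -/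
lemma tendstoInDistribution_drScore (hn : 0 < ∑ k, n k) {C : ℝ}
    (hC : ∀ x, |B.weight n πe x| ≤ C)
    (hX : ∀ k i, HasLaw (X k i) (B.obsLaw (B.logging k).dens) P)
    (hindep : iIndepFun (fun p : Fin K × ℕ => X p.1 p.2) P) :
    TendstoInDistribution
      (fun (m : ℕ) (ω : Ω) => (√((∑ k, m * n k : ℕ) : ℝ))⁻¹ *
        ∑ p : Idx (fun k => m * n k), (B.drScore n πe (X p.1 p.2 ω) - B.value πe))
      atTop id (fun _ => P) (gaussianReal 0 (B.Vstar n πe).toNNReal) := by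
  set n₀ : ℝ := ((∑ k, n k : ℕ) : ℝ) with hn₀
  have hn0 : 0 < n₀ := by rw [hn₀]; exact_mod_cast hn
  set Y : ℕ → Ω → Dataset S A n := fun i ω p => X p.1 (i * n p.1 + p.2) ω with hY
  have hYindep : iIndepFun Y P :=
    iIndepFun_blocks (X := fun p : ℕ × Idx n => X p.2.1 (p.1 * n p.2.1 + p.2.2))
      (fun p => (hX _ _).aemeasurable) (hindep.precomp (injective_block n))
  have hYlaw (i : ℕ) : HasLaw (Y i) (B.dataLaw n) P := by
    have hinj : Function.Injective fun p : Idx n => (p.1, i * n p.1 + (p.2 : ℕ)) := fun p p' h =>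
      congrArg Prod.snd (injective_block n (a₁ := (i, p)) (a₂ := (i, p')) h)
    exact (hindep.precomp hinj).hasLaw_pi fun p => hX _ _
  have hem : Measurable (B.effScore n πe) :=
    (Finset.measurable_fun_sum _ fun p _ =>
      (Bandit.measurable_drScore hn).comp (measurable_pi_apply p)).const_mul _
  set W : ℕ → Ω → ℝ := fun i ω => √n₀ * B.effScore n πe (Y i ω) with hW
  have hgm : Measurable fun x : Dataset S A n => √n₀ * B.effScore n πe x := hem.const_mul _
  have hWL : MemLp (W 0) 2 P := by
    have h := (Bandit.memLp_effScore (B := B) (πe := πe) hn hC).const_mul (√n₀)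
    rw [← (hYlaw 0).map_eq] at h
    exact (memLp_map_measure_iff hgm.aestronglyMeasurable (hYlaw 0).aemeasurable).1 h
  have hWmean : P[W 0] = √n₀ * B.value πe := by
    have h := (hYlaw 0).integral_comp (f := fun x => √n₀ * B.effScore n πe x)
      hgm.aestronglyMeasurable
    rw [integral_const_mul, Bandit.integral_effScore hn hC] at h
    exact h
  have hWvar : Var[W 0; P] = B.Vstar n πe := by
    have h := variance_map (μ := P) (X := fun x => √n₀ * B.effScore n πe x) hgm.aemeasurable
      (hYlaw 0).aemeasurable
    rw [(hYlaw 0).map_eq, variance_const_mul, Real.sq_sqrt hn0.le,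
      Bandit.variance_effScore hn hC] at h
    exact h.symm
  have hclt := tendstoInDistribution_inv_sqrt_mul_sum_sub (X := W) (P := P)
    (P' := gaussianReal 0 (B.Vstar n πe).toNNReal) (Y := id) (by rw [hWvar]; exact HasLaw.id) hWL
    (hYindep.comp (fun _ x => √n₀ * B.effScore n πe x) fun _ => hgm) fun i =>
      (IdentDistrib.mk (hYlaw i).aemeasurable (hYlaw 0).aemeasurable
        ((hYlaw i).map_eq.trans (hYlaw 0).map_eq.symm)).comp hgm
  refine hclt.congr (fun m => Eventually.of_forall fun ω => ?_) EventuallyEq.rfl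
  have hsum : ∑ p : Idx (fun k => m * n k), (B.drScore n πe (X p.1 p.2 ω) - B.value πe)
      = ∑ i ∈ Finset.range m, (n₀ * B.effScore n πe (Y i ω)) - m * (n₀ * B.value πe) := by
    rw [sum_idx_blocks m fun k i => B.drScore n πe (X k i ω) - B.value πe]
    have (i : ℕ) : ∑ p : Idx n, (B.drScore n πe (X p.1 (i * n p.1 + p.2) ω) - B.value πe)
        = n₀ * B.effScore n πe (Y i ω) - n₀ * B.value πe := by
      rw [Finset.sum_sub_distrib, sum_idx_eq (fun _ => B.value πe), ← Finset.sum_mul,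
        ← Nat.cast_sum, Bandit.effScore, ← hn₀, mul_inv_cancel_left₀ hn0.ne']
    simp_rw [this]
    rw [Finset.sum_sub_distrib, Finset.sum_const, Finset.card_range, nsmul_eq_mul]
  have hN : ((∑ k, m * n k : ℕ) : ℝ) = m * n₀ := by
    rw [← Finset.mul_sum, Nat.cast_mul]
  have hi : (√n₀)⁻¹ * n₀ = √n₀ := by
    rw [inv_mul_eq_div, Real.div_sqrt]
  change (√(m : ℝ))⁻¹ * (∑ i ∈ Finset.range m, √n₀ * B.effScore n πe (Y i ω) - m * P[W 0]) = _
  beta_reduce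
  rw [hWmean, hsum, hN, Real.sqrt_mul (Nat.cast_nonneg m), mul_inv, ← Finset.mul_sum,
    ← Finset.mul_sum]
  linear_combination
    (-(√(m : ℝ))⁻¹ * (∑ i ∈ Finset.range m, B.effScore n πe (Y i ω) - m * B.value πe)) * hi

end CLT

end OPE

namespace OPE

/-! ### Asymptotic negligibility of the remainder -/

section Remainder

variable {S A Ω : Type*} [MeasurableSpace S] [MeasurableSpace A] [MeasurableSpace Ω]
  {ν : Measure A} [SFinite ν] {Rmax : ℝ} {K Z : ℕ} {B : Bandit S A ν Rmax K} {n : Fin K → ℕ}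
  {πe : Policy S A ν} {P : Measure Ω}

lemma tendstoInMeasure_inv_sqrt_mul_sum (hn : 0 < ∑ k, n k) (T : Fin Z → ℕ → Ω → ℝ)
    (hT : ∀ z, ∀ ε : ℝ, 0 < ε → Tendsto (fun m : ℕ =>
      P {ω | ε * √((∑ k, m * n k : ℕ) : ℝ) ≤ |T z m ω|}) atTop (𝓝 0)) :
    TendstoInMeasure P (fun (m : ℕ) ω => (√((∑ k, m * n k : ℕ) : ℝ))⁻¹ * ∑ z, T z m ω) atTop 0 := by
  rw [tendstoInMeasure_iff_norm]
  intro ε hε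
  have hsum := tendsto_finsetSum Finset.univ fun z (_ : z ∈ Finset.univ) =>
    hT z (ε / (Z + 1)) (by positivity)
  rw [Finset.sum_const_zero] at hsum
  refine tendsto_of_tendsto_of_tendsto_of_le_of_le' tendsto_const_nhds hsum
    (Eventually.of_forall fun _ => zero_le) ?_
  filter_upwards [eventually_gt_atTop 0] with m hm
  have hN : (0 : ℝ) < ((∑ k, m * n k : ℕ) : ℝ) := by
    rw [← Finset.mul_sum]; exact_mod_cast Nat.mul_pos hm hn
  set r := √((∑ k, m * n k : ℕ) : ℝ)
  have hr : 0 < r := Real.sqrt_pos.2 hN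
  refine (measure_mono fun ω hω => ?_).trans (measure_iUnion_fintype_le P
    fun z => {ω | ε / (Z + 1) * r ≤ |T z m ω|})
  rw [Set.mem_iUnion]
  by_contra! hcon
  have hlt (z : Fin Z) : |T z m ω| ≤ ε / (Z + 1) * r := (not_le.1 (hcon z)).le
  have hω' : ε ≤ ‖r⁻¹ * ∑ z, T z m ω - 0‖ := hω
  rw [sub_zero, norm_mul, norm_inv, Real.norm_of_nonneg hr.le, Real.norm_eq_abs,
    inv_mul_eq_div, le_div_iff₀ hr] at hω'
  have h1 : |∑ z, T z m ω| ≤ Z * (ε / (Z + 1) * r) :=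
    (Finset.abs_sum_le_sum_abs _ _).trans ((Finset.sum_le_sum fun z _ => hlt z).trans (by simp))
  have h2 : Z * (ε / (Z + 1) * r) < ε * r := by
    have : (Z : ℝ) * (ε / (Z + 1) * r) = Z / (Z + 1) * (ε * r) := by ring
    rw [this]
    refine mul_lt_of_lt_one_left (by positivity) ?_
    rw [div_lt_one (by positivity)]
    linarith
  linarith

/-- The normalised remainder of one fold vanishes in probability. -/
lemma tendsto_measure_foldError [IsProbabilityMeasure P] (hn : 0 < ∑ k, n k)
    (hov : B.WeakOverlap n πe) {C : ℝ} (hC1 : 1 ≤ C) (hw : ∀ x, |B.weight n πe x| ≤ C)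
    {X : Fin K → ℕ → Ω → Obs S A}
    (hX : ∀ k i, HasLaw (X k i) (B.obsLaw (B.logging k).dens) P)
    (hindep : iIndepFun (fun p : Fin K × ℕ => X p.1 p.2) P)
    (fold : (m : ℕ) → Ω → Idx (fun k => m * n k) → Fin Z)
    (hfold_meas : ∀ m, Measurable (fold m))
    (hfold_even : ∀ m, ∀ᵐ ω ∂P, IsEvenPartition (fold m ω))
    (hfold_indep : ∀ m, IndepFun (fold m) (fun ω (p : Fin K × ℕ) => X p.1 p.2 ω) P)
    (qhat pihat : (m : ℕ) → CrossFit S A Z (fun k => m * n k))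
    (hgb : ∀ m f z x s a, |(qhat m).est f z x s a| ≤ C)
    (hp : ∀ m f z x s a, 0 < B.mix n s a →
      0 < (pihat m).est f z x s a ∧ 1 / (pihat m).est f z x s a ≤ C) (z : Fin Z)
    (hq : IsLittleOP P (fun m ω => B.l2 n (fun s a =>
      (qhat m).est (fold m ω) z (fun p => X p.1 p.2 ω) s a - B.q s a)) (fun _ => 1))
    (hpi : IsLittleOP P (fun m ω => B.l2 n (fun s a =>
      (pihat m).est (fold m ω) z (fun p => X p.1 p.2 ω) s a - B.mix n s a)) (fun _ => 1))
    (hprod : IsLittleOP P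
      (fun m ω =>
        B.l2 n (fun s a =>
          (qhat m).est (fold m ω) z (fun p => X p.1 p.2 ω) s a - B.q s a) *
        B.l2 n (fun s a =>
          (pihat m).est (fold m ω) z (fun p => X p.1 p.2 ω) s a - B.mix n s a))
      (fun m => (((∑ k, m * n k : ℕ) : ℝ)) ^ (-(1 / 2) : ℝ)))
    {ε : ℝ} (hε : 0 < ε) :
    Tendsto (fun m : ℕ => P {ω | ε * √((∑ k, m * n k : ℕ) : ℝ)
      ≤ |B.foldError n πe (qhat m) (pihat m) (fold m ω) z (fun p => X p.1 p.2 ω)|})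
      atTop (𝓝 0) := by
  rw [ENNReal.tendsto_nhds_zero]
  intro η hη
  have hη4 : 0 < η / 4 := ENNReal.div_pos hη.ne' (by norm_num)
  -- The threshold `δ` is fixed first, so that the conditional Chebyshev bound is below `η / 4`.
  obtain ⟨δ, hδη, hδ⟩ : ∃ δ : ℝ,
      ENNReal.ofReal (Bandit.remainderConst K Rmax C * δ ^ 2 / ε ^ 2) ≤ η / 4 ∧ 0 < δ := by
    have hc : Tendsto (fun δ : ℝ => ENNReal.ofReal
        (Bandit.remainderConst K Rmax C * δ ^ 2 / ε ^ 2)) (𝓝[>] 0) (𝓝 0) := by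
      have : Continuous fun δ : ℝ => ENNReal.ofReal
          (Bandit.remainderConst K Rmax C * δ ^ 2 / ε ^ 2) :=
        ENNReal.continuous_ofReal.comp (by fun_prop)
      have h0 := this.tendsto 0
      simp only [ne_eq, OfNat.ofNat_ne_zero, not_false_eq_true, zero_pow, mul_zero, zero_div,
        ENNReal.ofReal_zero] at h0
      exact h0.mono_left nhdsWithin_le_nhds
    exact ((ENNReal.tendsto_nhds_zero.1 hc _ hη4).and self_mem_nhdsWithin).exists
  filter_upwards [ENNReal.tendsto_nhds_zero.1 (hq δ hδ) _ hη4,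
    ENNReal.tendsto_nhds_zero.1 (hpi δ hδ) _ hη4, ENNReal.tendsto_nhds_zero.1 (hprod δ hδ) _ hη4,
    eventually_gt_atTop 0] with m h1 h2 h3 hm
  set s : (Idx (fun k => m * n k) → Fin Z) → Set (Dataset S A fun k => m * n k) := fun f =>
    B.nuisanceEvent n ((pihat m).est f z) ((qhat m).est f z) δ
      (((∑ k, m * n k : ℕ) : ℝ) ^ (-(1 / 2) : ℝ)) ∩
    {x | ε * √((∑ k, m * n k : ℕ) : ℝ) ≤ |B.foldError n πe (qhat m) (pihat m) f z x|} with hs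
  have h4 : P {ω | (fun p : Idx (fun k => m * n k) => X p.1 p.2 ω) ∈ s (fold m ω)} ≤ η / 4 := by
    have hφ : Measurable fun (x : Fin K × ℕ → Obs S A) (p : Idx fun k => m * n k) =>
        x (p.1, p.2) := by fun_prop
    refine (measure_indep_mem_le (hfold_meas m) (hasLaw_dataset hX hindep _)
      ((hfold_indep m).comp measurable_id hφ) (hfold_even m) (s := s) (fun f => ?_)
      fun f hf => ?_).trans hδη
    · exact (Bandit.measurableSet_nuisanceEvent ((pihat m).measurable_est f z)
        ((qhat m).measurable_est f z) hn δ _).inter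
        (measurableSet_le measurable_const (measurable_foldError hn _ _ f z).abs)
    · exact Bandit.measure_nuisanceEvent_inter_le hn hov hC1 hw hm (qhat m) (pihat m) (hgb m)
        (hp m) hf z hε
  have hη' : η = η / 4 + η / 4 + η / 4 + η / 4 := by
    have : η / 4 + η / 4 + η / 4 + η / 4 = 4 * (η / 4) := by ring
    rw [this, ENNReal.mul_div_cancel (by norm_num) (by norm_num)]
  rw [hη']
  refine le_trans (measure_mono fun ω hω => ?_) ((measure_union_le _ _).trans (add_le_add
    ((measure_union_le _ _).trans (add_le_add ((measure_union_le _ _).trans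
      (add_le_add h1 h2)) h3)) h4))
  by_contra hcon
  simp only [Set.mem_union, not_or] at hcon
  obtain ⟨⟨⟨c1, c2⟩, c3⟩, c4⟩ := hcon
  refine c4 ⟨⟨?_, ?_, not_le.1 c3⟩, hω⟩
  · have h := not_le.1 (show ¬ ENNReal.ofReal (δ * 1) ≤ _ from c1)
    rwa [mul_one] at h
  · have h := not_le.1 (show ¬ ENNReal.ofReal (δ * 1) ≤ _ from c2)
    rwa [mul_one] at h

end Remainder

end OPE

theorem mainTheorem3 {S A Ω : Type*} [MeasurableSpace S] [MeasurableSpace A] [MeasurableSpace Ω]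
    (ν : Measure A) [SigmaFinite ν] (Rmax : ℝ) (K Z : ℕ) (hZ : 0 < Z)
    -- stratum sizes, problem instance and evaluation policy
    (n : Fin K → ℕ) (hn : 0 < ∑ k, n k)
    (B : Bandit S A ν Rmax K) (πe : Policy S A ν) (hoverlap : B.WeakOverlap n πe)
    -- the data: independent draws; at stage `m` the `k`-th stratum is `X k 0, …, X k (m * n k - 1)`
    (P : Measure Ω) [IsProbabilityMeasure P] (X : Fin K → ℕ → Ω → Obs S A)
    (hX : ∀ k i, HasLaw (X k i) (B.obsLaw (B.logging k).dens) P)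
    (hindep : iIndepFun (fun p : Fin K × ℕ => X p.1 p.2) P)
    -- the random even partition at stage `m`, independent of the data
    (fold : (m : ℕ) → Ω → Idx (fun k => m * n k) → Fin Z)
    (hfold_meas : ∀ m, Measurable (fold m))
    (hfold_even : ∀ m, ∀ᵐ ω ∂P, IsEvenPartition (fold m ω))
    (hfold_indep : ∀ m, IndepFun (fold m) (fun ω (p : Fin K × ℕ) => X p.1 p.2 ω) P)
    -- the cross-fitted estimators of `q` and `π_*`
    (qhat pihat : (m : ℕ) → CrossFit S A Z (fun k => m * n k))
    -- uniform bounds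
    (C : ℝ)
    (hpi_bdd : ∀ s a, 0 < B.mix n s a → 1 / B.mix n s a ≤ C)
    (hqhat_bdd : ∀ m f z x s a, |(qhat m).est f z x s a| ≤ C)
    (hpihat_bdd : ∀ m f z x s a, 0 < B.mix n s a →
      0 < (pihat m).est f z x s a ∧ 1 / (pihat m).est f z x s a ≤ C)
    (hratio_bdd : ∀ s a, 0 < B.mix n s a → πe.dens s a / B.mix n s a ≤ C)
    -- consistency, and the product rate `o_p(n'^{-1/2})` with `n' = ∑ k, m * n k`
    (hq : ∀ z, IsLittleOP P (fun m ω => B.l2 n (fun s a =>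
      (qhat m).est (fold m ω) z (fun p => X p.1 p.2 ω) s a - B.q s a)) (fun _ => 1))
    (hpi : ∀ z, IsLittleOP P (fun m ω => B.l2 n (fun s a =>
      (pihat m).est (fold m ω) z (fun p => X p.1 p.2 ω) s a - B.mix n s a)) (fun _ => 1))
    (hprod : ∀ z, IsLittleOP P
      (fun m ω =>
        B.l2 n (fun s a =>
          (qhat m).est (fold m ω) z (fun p => X p.1 p.2 ω) s a - B.q s a) *
        B.l2 n (fun s a =>
          (pihat m).est (fold m ω) z (fun p => X p.1 p.2 ω) s a - B.mix n s a))
      (fun m => (((∑ k, m * n k : ℕ) : ℝ)) ^ (-(1 / 2) : ℝ))) :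
    -- `√n' (Ĵ - J) → N(0, V*)` in distribution, and `V*` is the efficiency bound
    TendstoInDistribution
      (fun (m : ℕ) (ω : Ω) => √((∑ k, m * n k : ℕ) : ℝ) *
        (JDR πe (qhat m) (pihat m) (fold m ω) (fun p => X p.1 p.2 ω) - B.value πe))
      atTop id (fun _ => P) (gaussianReal 0 (B.Vstar n πe).toNNReal) ∧
    IsEfficiencyBound B n πe (B.Vstar n πe) := by
  have hCb : ∀ x, |B.weight n πe x| ≤ max C 1 := Bandit.abs_weight_le hn
    (zero_le_one.trans (le_max_right C 1)) fun s a h => (hratio_bdd s a h).trans (le_max_left C 1)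
  refine ⟨?_, Bandit.isEfficiencyBound_Vstar hn hoverlap hCb⟩
  have hdata (m : ℕ) := hasLaw_dataset hX hindep fun k => m * n k
  have hpair (m : ℕ) : AEMeasurable (fun ω => (fold m ω, fun p : Idx (fun k => m * n k) =>
      X p.1 p.2 ω)) P := (hfold_meas m).aemeasurable.prodMk (hdata m).aemeasurable
  refine tendstoInDistribution_of_tendstoInMeasure_sub _ id
    (tendstoInDistribution_drScore hn hCb hX hindep) ?_ fun m => ?_
  · have hrem : (fun (m : ℕ) (ω : Ω) => √((∑ k, m * n k : ℕ) : ℝ) *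
          (JDR πe (qhat m) (pihat m) (fold m ω) (fun p => X p.1 p.2 ω) - B.value πe))
        - (fun (m : ℕ) (ω : Ω) => (√((∑ k, m * n k : ℕ) : ℝ))⁻¹ *
          ∑ p : Idx (fun k => m * n k), (B.drScore n πe (X p.1 p.2 ω) - B.value πe))
        = fun m ω => (√((∑ k, m * n k : ℕ) : ℝ))⁻¹ * ∑ z, B.foldError n πe (qhat m) (pihat m)
          (fold m ω) z (fun p => X p.1 p.2 ω) := by
      funext m ω
      simp only [Pi.sub_apply]
      rw [sqrt_mul_JDR_sub (B := B) (n := n) (qhat m) (pihat m) (fold m ω), add_sub_cancel_left]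
    rw [hrem]
    refine tendstoInMeasure_inv_sqrt_mul_sum hn _ fun z ε hε => ?_
    exact tendsto_measure_foldError hn hoverlap (le_max_right C 1) hCb hX hindep fold hfold_meas
      hfold_even hfold_indep qhat pihat
      (fun m f z x s a => (hqhat_bdd m f z x s a).trans (le_max_left C 1))
      (fun m f z x s a h => ⟨(hpihat_bdd m f z x s a h).1,
        (hpihat_bdd m f z x s a h).2.trans (le_max_left C 1)⟩) z (hq z) (hpi z) (hprod z) hε
  · have hJ : Measurable fun y :
        (Idx (fun k => m * n k) → Fin Z) × Dataset S A (fun k => m * n k) =>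
        JDR πe (qhat m) (pihat m) y.1 y.2 :=
      measurable_from_prod_countable_right fun f => measurable_JDR (qhat m) (pihat m) f
    exact ((hJ.comp_aemeasurable (hpair m)).sub_const _).const_mul _
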